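/- Let $d\ge 2$ and let $\mathcal K$ be a compact subset of $\{1,\dots,d-1\}\times \mathrm{GL}(d,\mathbb R)\times M_d(\mathbb R)\times M_d(\mathbb R)$, whose elements are written $\sigma=(\ell,P,\Lambda,R)$. For $\sigma\in\mathcal K$ write $\Lambda P^{-1}=\begin{pmatrix}A&B\\ C&D\end{pmatrix}$ with $A\in M_\ell(\mathbb R)$, and assume that $D=D(\sigma)$ is Hurwitz (all its eigenvalues have negative real part) for every $\sigma\in\mathcal K$ (the $D$-Hurwitz assumption). Put $M=A-BD^{-1}C$, $T=\begin{pmatrix}I_\ell&0\\ D^{-1}C&I_{d-\ell}\end{pmatrix}P$, let $E^\varepsilon_\ell$ be the diagonal matrix with the first $\ell$ diagonal entries equal to $1$ and the others equal to $\varepsilon$, and let $(Q)_{a,b}$ denote the submatrix of the first $a$ rows and $b$ columns of $Q$. For $\tau\ge 0$, let $\mathcal S_{\mathcal K,\tau}$ be the set of right-continuous piecewise-constant signals $\sigma:[0,\infty)\to\mathcal K$ with dwell time $\tau$: such a signal is given by a finite (possibly empty) or infinite, strictly increasing, locally finite sequence of switching times $0=t_0<t_1<t_2<\cdots$ with $t_{k+1}\ge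 t_k+\tau$, and by its values $\sigma_k=(\ell_k,P_k,\Lambda_k,R_k)\in\mathcal K$ on $[t_k,t_{k+1})$, where $t_{n+1}=+\infty$ if there are only $n$ switchings; consecutive values may coincide. Let $\mathcal S_{\mathcal K}=\mathcal S_{\mathcal K,0}$; quantities with index $k$ are those attached to $\sigma_k$. Consider the following impulsive switched systems. * $\Sigma^\varepsilon_{\mathcal K,\tau}$ ($\varepsilon>0$, $\sigma\in\mathcal S_{\mathcal K,\tau}$): $E^\varepsilon_{\ell_k}P_k\dot X=\Lambda_kX$ on $[t_k,t_{k+1})$, and $X(t_k)=R_{k-1}X(t_k^-)$ for $k\ge1$. Write $\Sigma^\varepsilon_{\mathcal K}=\Sigma^\varepsilon_{\mathcal K,0}$. * $\bar\Sigma_\tau$ ($\sigma\in\mathcal S_{\mathcal K,\tau}$): $\dot{\bar x}=M_k\bar x$ on $[t_k,t_{k+1})$, and $\bar x(t_k)=(T_kR_{k-1}T_{k-1}^{-1})_{\ell_k,\ell_{k-1}}\bar x(t_k^-)$ for $k\ge1$. * $\hat\Sigma$ ($\sigma\in\mathcal S_{\mathcal K}$): $\dot{\hat x}=0$, $\dot{\hat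 z}=D_k\hat z$ on $[t_k,t_{k+1})$, and $\begin{pmatrix}\hat x\\ \hat z\end{pmatrix}(t_k)=T_kR_{k-1}T_{k-1}^{-1}\begin{pmatrix}\hat x\\ \hat z\end{pmatrix}(t_k^-)$ for $k\ge1$. * $\tilde\Sigma$ ($\sigma\in\mathcal S_{\mathcal K}$ and arbitrary $F_0,F_1,\dots\in\hat{\mathcal F}$): $\dot{\tilde x}=M_k\tilde x$ on $[t_k,t_{k+1})$, and $\tilde x(t_k)=(T_kF_{k-1}R_{k-1}T_{k-1}^{-1})_{\ell_k,\ell_{k-1}}\tilde x(t_k^-)$ for $k\ge1$, where $\hat{\mathcal F}$ consists of $I_d$ and of all finite products of matrices $RT^{-1}\begin{pmatrix}I_\ell&0\\0&e^{sD}\end{pmatrix}T$ with $(\ell,P,\Lambda,R)\in\mathcal K$ and $s>0$. For each of these systems $\Sigma$, let $\Phi(t,0)$ be the flow from time $0$ to time $t$ along a given signal (and a given choice of the $F_k$ for $\tilde\Sigma$), let $\|\cdot\|$ be the operator norm induced by the Euclidean norms, and let $$\lambda(\Sigma)=\limsup_{t\to+\infty}\ \sup\ \frac{\log\|\Phi(t,0)\|}{t}\in[-\infty,+\infty],\qquad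 \log 0=-\infty,$$ the supremum being over all signals (and all choices of the $F_k$ for $\tilde\Sigma$). $\Sigma$ is exponentially stable if there are $c,\delta>0$ such that $\|\Phi(t,0)\|\le ce^{-\delta t}$ for all $t\ge0$ and all signals (and all choices of the $F_k$). For $\hat\Sigma$ put also $$\tilde\lambda(\hat\Sigma)=\limsup_{s\to+\infty}\ \sup\Big\{\frac{\log\|\Phi_\sigma(s,0)\|}{s} : \sigma\in\mathcal S_{\mathcal K},\ s \text{ is one of the switching times } t_k\ (k\ge1) \text{ of } \sigma\Big\}.$$ Then the following statements hold. 1. For every $\tau>0$, the limit $\lim_{\varepsilon\searrow0}\lambda(\Sigma^\varepsilon_{\mathcal K,\tau})$ exists in $[-\infty,+\infty]$ and $$\lim_{\varepsilon\searrow0}\lambda(\Sigma^\varepsilon_{\mathcal K,\tau})\le\lambda(\bar\Sigma_\tau).$$ Moreover, if $\bar\Sigma_\tau$ is exponentially stable, then $\Sigma^\varepsilon_{\mathcal K,\tau}$ is exponentially stable for every sufficiently small $\varepsilon>0$. 2. If $\tilde\lambda(\hat\Sigma)<0$, then $$\limsup_{\varepsilon\searrow0}\lambda(\Sigma^\varepsilon_{\mathcal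 K})\le\lambda(\tilde\Sigma).$$ Moreover, if in addition $\tilde\Sigma$ is exponentially stable, then $\Sigma^\varepsilon_{\mathcal K}$ is exponentially stable for every sufficiently small $\varepsilon>0$. -/

import Mathlib

open Filter Topology

noncomputable section

namespace SwitchedSystem

/-! ### Switching signals -/

/-- A right-continuous piecewise-constant signal with values in `K` and dwell time `τ`, given by
its switching times and its values. `count` is the number of switchings (possibly infinite),
`time 0 = 0`, the switching times are `time k` for `1 ≤ k ≤ count`, and `mode k` is the value on
`[time k, time (k+1))`, where `time (count + 1) = +∞` if `count` is finite. The values of `time`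
and `mode` at indices larger than `count` play no role. -/
structure Signal {α : Type*} (K : Set α) (τ : ℝ) where
  count : ℕ∞
  time : ℕ → ℝ
  mode : ℕ → α
  time_zero : time 0 = 0
  time_lt : ∀ k : ℕ, ((k + 1 : ℕ) : ℕ∞) ≤ count → time k < time (k + 1)
  dwell : ∀ k : ℕ, ((k + 1 : ℕ) : ℕ∞) ≤ count → time k + τ ≤ time (k + 1)
  locally_finite : count = ⊤ → Tendsto time atTop atTop
  mode_mem : ∀ k : ℕ, (k : ℕ∞) ≤ count → mode k ∈ K

namespace Signal

variable {α : Type*} {K : Set α} {τ : ℝ} (σ : Signal K τ)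

/-- The index `k` of the interval `[time k, time (k+1))` that contains `t ≥ 0`. -/
def index (t : ℝ) : ℕ := sSup {k : ℕ | (k : ℕ∞) ≤ σ.count ∧ σ.time k ≤ t}

theorem time_lt_time {j k : ℕ} (hjk : j < k) (hk : (k : ℕ∞) ≤ σ.count) :
    σ.time j < σ.time k := by
  induction k with
  | zero => omega
  | succ k ih =>
    have h1 := σ.time_lt k hk
    rcases Nat.lt_succ_iff_lt_or_eq.mp hjk with h | h
    · exact (ih h (le_trans (by exact_mod_cast Nat.le_succ k) hk)).trans h1
    · rw [h]; exact h1

theorem index_eq {t : ℝ} {k : ℕ} (hk : (k : ℕ∞) ≤ σ.count) (h1 : σ.time k ≤ t)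
    (h2 : ((k + 1 : ℕ) : ℕ∞) ≤ σ.count → t < σ.time (k + 1)) : σ.index t = k := by
  refine IsGreatest.csSup_eq ⟨⟨hk, h1⟩, ?_⟩
  rintro j ⟨hj, hjt⟩
  by_contra! hlt
  have hk1 : ((k + 1 : ℕ) : ℕ∞) ≤ σ.count := le_trans (by exact_mod_cast hlt) hj
  have h3 := h2 hk1
  rcases Nat.lt_or_eq_of_le (Nat.succ_le_of_lt hlt) with h | h
  · exact absurd ((σ.time_lt_time h hj).trans_le hjt) (not_lt.mpr h3.le)
  · rw [Nat.succ_eq_add_one] at h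
    rw [h] at h3
    exact absurd hjt (not_le.mpr h3)

theorem exists_index {t : ℝ} (ht : 0 ≤ t) : ∃ k : ℕ, (k : ℕ∞) ≤ σ.count ∧ σ.time k ≤ t ∧
    (((k + 1 : ℕ) : ℕ∞) ≤ σ.count → t < σ.time (k + 1)) := by
  by_contra! hcon
  have hall : ∀ k : ℕ, (k : ℕ∞) ≤ σ.count ∧ σ.time k ≤ t := by
    intro k
    induction k with
    | zero => exact ⟨by simp, by rw [σ.time_zero]; exact ht⟩
    | succ k ih => exact hcon k ih.1 ih.2
  have htop : σ.count = ⊤ := ENat.eq_top_iff_forall_ge.mpr fun m => (hall m).1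
  obtain ⟨k, hk⟩ := ((σ.locally_finite htop).eventually_gt_atTop t).exists
  exact absurd (hall k).2 (not_le.mpr hk)

theorem index_spec {t : ℝ} (ht : 0 ≤ t) :
    (σ.index t : ℕ∞) ≤ σ.count ∧ σ.time (σ.index t) ≤ t ∧
      (((σ.index t + 1 : ℕ) : ℕ∞) ≤ σ.count → t < σ.time (σ.index t + 1)) := by
  obtain ⟨k, h1, h2, h3⟩ := σ.exists_index ht
  rw [σ.index_eq h1 h2 h3]
  exact ⟨h1, h2, h3⟩

end Signal

/-! ### Flows of linear impulsive systems, with a state dimension that may vary in time -/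

section Flow

variable {n : ℕ → Type} [∀ k, Fintype (n k)] [∀ k, DecidableEq (n k)]

/-- The flow from time `0` to the switching time `t k` (after the jump) of
`x' = G k x` on `[t k, t (k+1))`, `x (t (k+1)) = J k x (t (k+1)⁻)`. -/
def transition (t : ℕ → ℝ) (G : ∀ k, Matrix (n k) (n k) ℝ)
    (J : ∀ k, Matrix (n (k + 1)) (n k) ℝ) : ∀ k, Matrix (n k) (n 0) ℝ
  | 0 => 1
  | k + 1 => J k * NormedSpace.exp ((t (k + 1) - t k) • G k) * transition t G J k

/-- The flow from time `0` to time `t ≥ 0` along the signal `σ` of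
`x' = G k x` on `[t_k, t_{k+1})`, `x (t_{k+1}) = J k x (t_{k+1}⁻)`. -/
def Signal.flow {α : Type*} {K : Set α} {τ : ℝ} (σ : Signal K τ)
    (G : ∀ k, Matrix (n k) (n k) ℝ) (J : ∀ k, Matrix (n (k + 1)) (n k) ℝ) (t : ℝ) :
    Matrix (n (σ.index t)) (n 0) ℝ :=
  NormedSpace.exp ((t - σ.time (σ.index t)) • G (σ.index t)) *
    transition σ.time G J (σ.index t)

end Flow

open scoped Matrix.Norms.L2Operator in
/-- The operator norm of a matrix induced by the Euclidean norms. -/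
def opNorm {m n : Type*} [Fintype m] [Fintype n] [DecidableEq n] (A : Matrix m n ℝ) : ℝ := ‖A‖

/-- `log r / t` for `r ≥ 0`, with the convention `log 0 = -∞`. -/
def logRate (r t : ℝ) : EReal := ENNReal.log (ENNReal.ofReal r) / (t : EReal)

/-- The maximal Lyapunov exponent `limsup_{t → ∞} sup_i log ‖Φ_i(t,0)‖ / t` of a system whose flows
have norms `φ i t = ‖Φ_i(t,0)‖`. -/
def lyapunovExponent {I : Type*} (φ : I → ℝ → ℝ) : EReal :=
  limsup (fun t : ℝ => ⨆ i, logRate (φ i t) t) atTop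

/-- Exponential stability of a system whose flows have norms `φ i t = ‖Φ_i(t,0)‖`. -/
def ExponentiallyStable {I : Type*} (φ : I → ℝ → ℝ) : Prop :=
  ∃ c > 0, ∃ δ > 0, ∀ t : ℝ, 0 ≤ t → ∀ i, φ i t ≤ c * Real.exp (-δ * t)

/-! ### Modes and the matrices attached to them -/

/-- The set `{1, …, d-1} × GL(d, ℝ) × M_d(ℝ) × M_d(ℝ)` of the quadruples `(ℓ, P, Λ, R)`. -/
abbrev Mode (d : ℕ) : Type :=
  ↥(Set.Icc 1 (d - 1)) × GL (Fin d) ℝ × Matrix (Fin d) (Fin d) ℝ × Matrix (Fin d) (Fin d) ℝ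

/-- The first `ℓ` indices. -/
abbrev Slow (d ℓ : ℕ) : Type := {i : Fin d // (i : ℕ) < ℓ}

/-- The last `d - ℓ` indices. -/
abbrev Fast (d ℓ : ℕ) : Type := {i : Fin d // ¬ (i : ℕ) < ℓ}

/-- The truncation `(Q)_{a,b}`: the first `a` lines and the first `b` columns of `Q`. -/
def truncate {d : ℕ} (Q : Matrix (Fin d) (Fin d) ℝ) (a b : ℕ) :
    Matrix (Slow d a) (Slow d b) ℝ :=
  Q.toBlock (fun i => (i : ℕ) < a) (fun j => (j : ℕ) < b)

/-- The `d × d` matrix with the given blocks, the slow indices coming first. -/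
def ofBlocks {d ℓ : ℕ} (A : Matrix (Slow d ℓ) (Slow d ℓ) ℝ) (B : Matrix (Slow d ℓ) (Fast d ℓ) ℝ)
    (C : Matrix (Fast d ℓ) (Slow d ℓ) ℝ) (D : Matrix (Fast d ℓ) (Fast d ℓ) ℝ) :
    Matrix (Fin d) (Fin d) ℝ :=
  Matrix.reindex (Equiv.sumCompl fun i : Fin d => (i : ℕ) < ℓ)
    (Equiv.sumCompl fun i : Fin d => (i : ℕ) < ℓ) (Matrix.fromBlocks A B C D)

namespace Mode

variable {d : ℕ}

abbrev ell (σ : Mode d) : ℕ := σ.1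
abbrev P (σ : Mode d) : Matrix (Fin d) (Fin d) ℝ := (σ.2.1 : Matrix (Fin d) (Fin d) ℝ)
abbrev Lam (σ : Mode d) : Matrix (Fin d) (Fin d) ℝ := σ.2.2.1
abbrev R (σ : Mode d) : Matrix (Fin d) (Fin d) ℝ := σ.2.2.2

/-- The blocks `A, B, C, D` of `Λ P⁻¹`. -/
def A (σ : Mode d) : Matrix (Slow d σ.ell) (Slow d σ.ell) ℝ := (σ.Lam * σ.P⁻¹).toBlock _ _
def B (σ : Mode d) : Matrix (Slow d σ.ell) (Fast d σ.ell) ℝ := (σ.Lam * σ.P⁻¹).toBlock _ _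
def C (σ : Mode d) : Matrix (Fast d σ.ell) (Slow d σ.ell) ℝ := (σ.Lam * σ.P⁻¹).toBlock _ _
def D (σ : Mode d) : Matrix (Fast d σ.ell) (Fast d σ.ell) ℝ := (σ.Lam * σ.P⁻¹).toBlock _ _

/-- `M = A - B D⁻¹ C`. -/
def M (σ : Mode d) : Matrix (Slow d σ.ell) (Slow d σ.ell) ℝ := σ.A - σ.B * σ.D⁻¹ * σ.C

/-- `T = [I, 0; D⁻¹ C, I] P`. -/
def T (σ : Mode d) : Matrix (Fin d) (Fin d) ℝ := ofBlocks 1 0 (σ.D⁻¹ * σ.C) 1 * σ.P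

/-- The matrix `E^ε_ℓ`. -/
def E (σ : Mode d) (ε : ℝ) : Matrix (Fin d) (Fin d) ℝ :=
  Matrix.diagonal fun i => if (i : ℕ) < σ.ell then 1 else ε

/-- The matrix of `X' = (E^ε_ℓ P)⁻¹ Λ X`, that is, of `E^ε_ℓ P X' = Λ X`. -/
def perturbedGen (σ : Mode d) (ε : ℝ) : Matrix (Fin d) (Fin d) ℝ := (σ.E ε * σ.P)⁻¹ * σ.Lam

/-- The block diagonal matrix with blocks `0` and `D`. -/
def fastGen (σ : Mode d) : Matrix (Fin d) (Fin d) ℝ := ofBlocks 0 0 0 σ.D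

/-- `R T⁻¹ [I, 0; 0, exp(s D)] T`. -/
def fastStep (σ : Mode d) (s : ℝ) : Matrix (Fin d) (Fin d) ℝ :=
  σ.R * σ.T⁻¹ * ofBlocks 1 0 0 (NormedSpace.exp (s • σ.D)) * σ.T

end Mode

/-- All eigenvalues of the real matrix `A` have negative real part. -/
def IsHurwitz {n : Type*} [Fintype n] [DecidableEq n] (A : Matrix n n ℝ) : Prop :=
  ∀ z ∈ spectrum ℂ (A.map (algebraMap ℝ ℂ)), z.re < 0

/-- The `D`-Hurwitz assumption on the set of modes `K`. -/
def DHurwitz {d : ℕ} (K : Set (Mode d)) : Prop := ∀ σ ∈ K, IsHurwitz σ.D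

/-- The set of the finite products (the empty product included) of the matrices
`R T⁻¹ [I, 0; 0, exp(s D)] T`, for modes in `K` and `s > 0`. -/
def transientSet {d : ℕ} (K : Set (Mode d)) : Set (Matrix (Fin d) (Fin d) ℝ) :=
  {F | ∃ L : List (Mode d × ℝ), (∀ p ∈ L, p.1 ∈ K ∧ 0 < p.2) ∧
    F = (L.map fun p => p.1.fastStep p.2).prod}

/-! ### The four systems, through the norms of their flows -/

section Systems

variable {d : ℕ} (K : Set (Mode d))

/-- The norm of the flow of the singularly perturbed system `Σ^ε_{K,τ}`:
`E^ε_{ℓ_k} P_k X' = Λ_k X` on `[t_k, t_{k+1})`, `X(t_{k+1}) = R_k X(t_{k+1}⁻)`. -/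
def perturbed (τ ε : ℝ) (σ : Signal K τ) (t : ℝ) : ℝ :=
  opNorm (σ.flow (n := fun _ => Fin d) (fun k => (σ.mode k).perturbedGen ε)
    (fun k => (σ.mode k).R) t)

/-- The norm of the flow of the reduced system `Σ̄_τ`: `x' = M_k x` on `[t_k, t_{k+1})`,
`x(t_{k+1}) = (T_{k+1} R_k T_k⁻¹)_{ℓ_{k+1}, ℓ_k} x(t_{k+1}⁻)`. -/
def reduced (τ : ℝ) (σ : Signal K τ) (t : ℝ) : ℝ :=
  opNorm (σ.flow (n := fun k => Slow d (σ.mode k).ell) (fun k => (σ.mode k).M)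
    (fun k => truncate ((σ.mode (k + 1)).T * (σ.mode k).R * (σ.mode k).T⁻¹)
      (σ.mode (k + 1)).ell (σ.mode k).ell) t)

/-- The norm of the flow of the transient system `Σ̂`: `x' = 0`, `z' = D_k z` on `[s_k, s_{k+1})`,
`(x, z)(s_{k+1}) = T_{k+1} R_k T_k⁻¹ (x, z)(s_{k+1}⁻)`. -/
def transient (σ : Signal K 0) (s : ℝ) : ℝ :=
  opNorm (σ.flow (n := fun _ => Fin d) (fun k => (σ.mode k).fastGen)
    (fun k => (σ.mode (k + 1)).T * (σ.mode k).R * (σ.mode k).T⁻¹) s)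

/-- The norm of the flow of `Σ̃`: `x' = M_k x` on `[t_k, t_{k+1})`,
`x(t_{k+1}) = (T_{k+1} F_k R_k T_k⁻¹)_{ℓ_{k+1}, ℓ_k} x(t_{k+1}⁻)`, where both the signal and the
matrices `F_k` in `transientSet K` are arbitrary. -/
def corrected (σF : Signal K 0 × (ℕ → transientSet K)) (t : ℝ) : ℝ :=
  opNorm (σF.1.flow (n := fun k => Slow d (σF.1.mode k).ell) (fun k => (σF.1.mode k).M)
    (fun k => truncate
      ((σF.1.mode (k + 1)).T * (σF.2 k : Matrix (Fin d) (Fin d) ℝ) * (σF.1.mode k).R *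
        (σF.1.mode k).T⁻¹)
      (σF.1.mode (k + 1)).ell (σF.1.mode k).ell) t)

/-- The exponent of `Σ̂` along switching times:
`limsup_{s → ∞} sup {log ‖Φ_σ(s,0)‖ / s : s = s_k for some switching time s_k of σ}`. -/
def switchingExponent : EReal :=
  limsup (fun s : ℝ => ⨆ (σ : Signal K 0) (k : ℕ)
    (_ : 1 ≤ k ∧ (k : ℕ∞) ≤ σ.count ∧ s = σ.time k), logRate (transient K σ s) s) atTop

end Systems

end SwitchedSystem

end

/-! In the coordinates `T X` the perturbed generator is block diagonal with blocks `M` and `D / ε`,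
plus a coupling independent of `ε` whose slow-slow block vanishes. Variation of constants then shows
that one perturbed mode flows, uniformly over the compact set of modes, like its reduced flow plus a
boundary layer of time scale `ε`. The error is at most `c ε exp (ν s)` and also at most `c s exp (ν
s)` (`DHurwitz.exists_two_time_scale_estimate`). Signals become words of (mode, duration), and flows
become products of `d × d` matrices along words.

With a dwell time `τ > 0`, the layer has died out at the end of every interval, so the letters of
the perturbed system converge uniformly to those of the reduced one. A block of `N` normalised
reduced letters has norm at most `1 / 2` for `N` large. For `ε` small the perturbed blocks have norm
at most `1`, which gives the upper bound (`DHurwitz.eventually_perturbed_bound`). The limit exists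
because it equals the reduced exponent. For the lower bound, repeating a word periodically bounds
the eigenvalues of its perturbed product, hence its trace, and trace bounds survive `ε → 0`. A
bounded set of matrices whose products all have bounded traces has joint spectral radius at most one
(`exists_norm_prod_le_of_trace_bounded`), so the reduced products inherit the growth rate
(`DHurwitz.reduced_bound_of_frequently`).

Without dwell time, the negative switching exponent makes products of fast steps decay
exponentially. Letting the duration of a single letter tend to infinity shows that the jump matrices
vanish on the slow subspaces (`DHurwitz.jump_mul_slowProj_eq_zero`). A perturbed step is then a fast
step up to an error of order `min ε s`. Perturbed letters can be replaced by fast ones one at a time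
without any constant accumulating, because the decay of the fast products absorbs the errors
(`DHurwitz.eventually_perturbed_bound_of_switchingExponent_neg`). Of the corrected system only the
growth of single modes is needed, which is visible along signals that never switch. -/

noncomputable section

namespace SwitchedSystem

open scoped Matrix.Norms.L2Operator

/-! ### Matrix semigroups with bounded traces -/

section BoundedTrace

variable {n : Type*} [Fintype n] [DecidableEq n]

/-- Write the minimal polynomial as `X ^ k * q` with `X ∤ q`. By Bézout, a multiple of `X ^ (k + 2)`
evaluates at `a` to the idempotent `e` onto the part where `a` is invertible. All exponents in it
are at least 2, so `e` has trace zero, hence `e = 0` in characteristic zero. -/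
theorem isNilpotent_of_trace_pow_eq_zero (a : Matrix n n ℝ)
    (h : ∀ j : ℕ, 2 ≤ j → (a ^ j).trace = 0) : IsNilpotent a := by
  obtain ⟨q, hq, hnd⟩ := Polynomial.exists_eq_pow_rootMultiplicity_mul_and_not_dvd
    (minpoly ℝ a) (minpoly.ne_zero (Matrix.isIntegral a)) 0
  simp only [map_zero, sub_zero] at hq hnd
  set k := Polynomial.rootMultiplicity 0 (minpoly ℝ a)
  have hcop : IsCoprime ((Polynomial.X : Polynomial ℝ) ^ (k + 2)) q :=
    ((Polynomial.irreducible_X.coprime_iff_not_dvd).2 hnd).pow_left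
  obtain ⟨u, v, huv⟩ := hcop
  have htr : ∀ w : Polynomial ℝ,
      (Polynomial.aeval a (w * Polynomial.X ^ (k + 2))).trace = 0 := by
    intro w
    induction w using Polynomial.induction_on' with
    | add p r hp hr => rw [add_mul, map_add, Matrix.trace_add, hp, hr, add_zero]
    | monomial i c =>
      rw [map_mul, Polynomial.aeval_monomial, map_pow, Polynomial.aeval_X, mul_assoc, ← pow_add,
        Algebra.algebraMap_eq_smul_one, smul_mul_assoc, one_mul, Matrix.trace_smul,
        h _ (by omega), smul_zero]
  have hkill : ∀ w : Polynomial ℝ, Polynomial.aeval a (w * Polynomial.X ^ (k + 2) * q) = 0 := by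
    intro w
    have : w * Polynomial.X ^ (k + 2) * q = w * Polynomial.X ^ 2 * minpoly ℝ a := by
      rw [hq]; ring
    rw [this, map_mul, minpoly.aeval, mul_zero]
  set e := Polynomial.aeval a (u * Polynomial.X ^ (k + 2)) with he
  have hidem : IsIdempotentElem e := by
    have h1 : u * Polynomial.X ^ (k + 2) * (u * Polynomial.X ^ (k + 2)) =
        u * Polynomial.X ^ (k + 2) - u * v * Polynomial.X ^ (k + 2) * q := by
      linear_combination (u * Polynomial.X ^ (k + 2)) * huv
    rw [IsIdempotentElem, he, ← map_mul, h1, map_sub, hkill, sub_zero]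
  have he0 : e = 0 := by
    refine Matrix.toLinAlgEquiv'.injective ?_
    rw [map_zero]
    refine LinearMap.IsIdempotentElem.eq_zero_of_trace_eq_zero (hidem.map _) ?_
    exact (Matrix.trace_toLin'_eq e).trans (htr u)
  refine ⟨k + 2, ?_⟩
  have h3 : (Polynomial.X : Polynomial ℝ) ^ (k + 2) =
      Polynomial.X ^ (k + 2) * (u * Polynomial.X ^ (k + 2)) + v * Polynomial.X ^ (k + 2) * q := by
    linear_combination -(Polynomial.X ^ (k + 2)) * huv
  have h4 := congrArg (Polynomial.aeval a) h3
  rw [map_add, hkill, add_zero, map_mul, ← he, he0, mul_zero, map_pow, Polynomial.aeval_X] at h4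
  exact h4

/-- The radical of the trace form of an algebra of matrices. -/
def traceRadical (A : Subalgebra ℝ (Matrix n n ℝ)) : Ideal A where
  carrier := {a | ∀ b : A, ((a : Matrix n n ℝ) * b).trace = 0}
  zero_mem' := by simp
  add_mem' := by
    intro a b ha hb c
    rw [Subalgebra.coe_add, add_mul, Matrix.trace_add, ha, hb, add_zero]
  smul_mem' := by
    intro c a ha b
    have := ha (b * c)
    rw [smul_eq_mul, Subalgebra.coe_mul, mul_assoc, Matrix.trace_mul_comm, mul_assoc]
    exact this

instance (A : Subalgebra ℝ (Matrix n n ℝ)) : (traceRadical A).IsTwoSided where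
  mul_mem_of_left := by
    intro a b ha c
    have := ha (b * c)
    rwa [Subalgebra.coe_mul, ← mul_assoc] at this

/-- Every element of the trace radical is nilpotent, so this ideal lies in the Jacobson radical,
which is nilpotent because a finite-dimensional algebra is Artinian. -/
theorem exists_traceRadical_pow_eq_bot (A : Subalgebra ℝ (Matrix n n ℝ)) :
    ∃ q : ℕ, traceRadical A ^ (q + 1) = ⊥ := by
  have hart : IsArtinianRing A := IsArtinianRing.of_finite ℝ A
  obtain ⟨q, hq⟩ := IsSemiprimaryRing.isNilpotent (R := A)
  have hle : traceRadical A ≤ Ring.jacobson A := by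
    rw [← Ideal.jacobson_bot]
    intro x hx
    rw [Ideal.mem_jacobson_iff]
    intro y
    have hyx : y * x ∈ traceRadical A := Ideal.mul_mem_left _ y hx
    have hnil : IsNilpotent (y * x) := by
      obtain ⟨k, hk⟩ := isNilpotent_of_trace_pow_eq_zero ((y * x : A) : Matrix n n ℝ) (by
        intro j hj
        obtain ⟨i, rfl⟩ := Nat.exists_eq_add_of_le hj
        have := hyx ((y * x) ^ (1 + i))
        rw [Subalgebra.coe_pow, ← pow_succ'] at this
        rwa [show 2 + i = 1 + i + 1 by ring])
      exact ⟨k, Subtype.ext (by rw [Subalgebra.coe_pow, hk]; rfl)⟩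
    obtain ⟨z, hz⟩ := (hnil.isUnit_one_add)
    refine ⟨(z⁻¹ : Aˣ), ?_⟩
    rw [Ideal.mem_bot, mul_assoc]
    have : (↑z⁻¹ : A) * (1 + y * x) = 1 := by rw [← hz, Units.inv_mul]
    rw [mul_add, mul_one] at this
    rw [← this]; abel
  refine ⟨q, ?_⟩
  rw [eq_bot_iff]
  refine (Ideal.pow_right_mono hle (q + 1)).trans ?_
  rw [Submodule.pow_succ, hq]
  simp

theorem mul_mem_ideal_pow_succ {𝔸 : Type*} [Ring 𝔸] {N : Ideal 𝔸} [N.IsTwoSided] {x y : 𝔸}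
    (hx : x ∈ N) {k : ℕ} (hy : y ∈ N ^ k) : x * y ∈ N ^ (k + 1) := by
  rcases eq_or_ne k 0 with rfl | hk
  · rw [zero_add, Submodule.pow_one]
    exact Ideal.mul_mem_right _ _ hx
  · rw [Submodule.pow_succ' _ hk]
    exact Ideal.mul_mem_mul hx hy

/-- Expand the product and let `P k` collect the terms with `k` factors in `N`; those with `k > q`
vanish. The base `2 * β` absorbs the binomial coefficients, so a large `γ` affects only the constant
and not the exponential rate. -/
theorem exists_norm_prod_add_le {𝔸 : Type*} [NormedRing 𝔸] {N : Ideal 𝔸} [N.IsTwoSided]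
    {q : ℕ}
    (hN : N ^ (q + 1) = ⊥) {β γ : ℝ} (hβ : 0 < β) (hγ : 0 ≤ γ) :
    ∃ C : ℝ, 0 ≤ C ∧ ∀ L : List (𝔸 × 𝔸),
      (∀ p ∈ L, ‖p.1‖ ≤ β ∧ p.2 ∈ N ∧ ‖p.2‖ ≤ γ) →
      ‖(L.map fun p => p.1 + p.2).prod‖ ≤ C * (2 * β) ^ L.length := by
  refine ⟨∑ k ∈ Finset.range (q + 1), ‖(1 : 𝔸)‖ * (γ / β) ^ k, by positivity, fun L hL => ?_⟩
  suffices h : ∃ P : ℕ → 𝔸, (∀ k, P k ∈ N ^ k) ∧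
      (∀ k, ‖P k‖ ≤ ‖(1 : 𝔸)‖ * (γ / β) ^ k * (2 * β) ^ L.length) ∧
      (L.map fun p => p.1 + p.2).prod = ∑ k ∈ Finset.range (q + 1), P k by
    obtain ⟨P, -, h2, h3⟩ := h
    rw [h3, Finset.sum_mul]
    exact norm_sum_le_of_le _ fun k _ => h2 k
  induction L with
  | nil =>
    refine ⟨fun k => if k = 0 then 1 else 0, fun k => ?_, fun k => ?_, ?_⟩
    · dsimp only
      split_ifs with h
      · subst h
        rw [Submodule.pow_zero, Ideal.one_eq_top]
        trivial
      · exact Submodule.zero_mem _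
    · dsimp only
      split_ifs with h
      · subst h; simp
      · rw [norm_zero]; positivity
    · simp
  | cons p L ih =>
    obtain ⟨P, h1, h2, h3⟩ := ih fun r hr => hL r (List.mem_cons_of_mem _ hr)
    obtain ⟨hp1, hp2, hp3⟩ := hL p List.mem_cons_self
    refine ⟨fun k => Nat.casesOn k (p.1 * P 0) (fun k => p.1 * P (k + 1) + p.2 * P k),
      fun k => ?_, fun k => ?_, ?_⟩
    · cases k with
      | zero => exact Ideal.mul_mem_left _ _ (h1 0)
      | succ k =>
        exact Submodule.add_mem _ (Ideal.mul_mem_left _ _ (h1 _))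
          (mul_mem_ideal_pow_succ hp2 (h1 k))
    · cases k with
      | zero =>
        have := h2 0
        refine (norm_mul_le _ _).trans ((mul_le_mul hp1 this (norm_nonneg _) hβ.le).trans ?_)
        rw [List.length_cons, pow_succ]
        have h0 : 0 ≤ ‖(1 : 𝔸)‖ * (γ / β) ^ 0 * (2 * β) ^ L.length := by positivity
        nlinarith
      | succ k =>
        refine (norm_add_le _ _).trans ((add_le_add ((norm_mul_le _ _).trans
          (mul_le_mul hp1 (h2 (k + 1)) (norm_nonneg _) hβ.le)) ((norm_mul_le _ _).trans
          (mul_le_mul hp3 (h2 k) (norm_nonneg _) hγ))).trans (le_of_eq ?_))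
        rw [List.length_cons, pow_succ, pow_succ]
        field_simp
        ring
    · have h4 : p.2 * P q = 0 := by
        have := mul_mem_ideal_pow_succ hp2 (h1 q)
        rwa [hN] at this
      have h5 : p.2 * ∑ k ∈ Finset.range (q + 1), P k = ∑ k ∈ Finset.range q, p.2 * P k := by
        rw [Finset.sum_range_succ, mul_add, h4, add_zero, Finset.mul_sum]
      have h6 : p.1 * ∑ k ∈ Finset.range (q + 1), P k =
          ∑ k ∈ Finset.range q, p.1 * P (k + 1) + p.1 * P 0 := by
        rw [Finset.sum_range_succ', mul_add, Finset.mul_sum]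
      rw [List.map_cons, List.prod_cons, h3, add_mul, h5, h6, Finset.sum_range_succ' (fun k => _)]
      change _ = ∑ k ∈ Finset.range q, (p.1 * P (k + 1) + p.2 * P k) + p.1 * P 0
      rw [Finset.sum_add_distrib]
      abel

/-- The traces of `W * f`, for `f` in a finite spanning family of the algebra, determine `W` modulo
the trace radical. They are bounded, and a fixed linear section lifts them to a bounded
representative `b`. -/
theorem exists_decomposition_of_trace_bounded {S : Set (Matrix n n ℝ)} {c : ℝ}
    (hc : ∀ W ∈ Submonoid.closure S, |W.trace| ≤ c) :
    ∃ β : ℝ, 0 < β ∧ ∀ W ∈ Submonoid.closure S, ∃ b r : Algebra.adjoin ℝ S,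
      W = ((b + r : Algebra.adjoin ℝ S) : Matrix n n ℝ) ∧ ‖b‖ ≤ β ∧
        r ∈ traceRadical (Algebra.adjoin ℝ S) := by
  have hfg : (Submodule.span ℝ (Submonoid.closure S : Set (Matrix n n ℝ))).FG :=
    IsNoetherian.noetherian _
  -- The spanning family is taken inside the semigroup, so that `W * f` is again a product of
  -- elements of `S` and its trace is at most `c`.
  obtain ⟨F, hFS, hspan⟩ := Submodule.fg_span_iff_fg_span_finset_subset _ |>.1 hfg
  let φ : Algebra.adjoin ℝ S →ₗ[ℝ] (F → ℝ) :=
    LinearMap.pi fun f => (Matrix.traceLinearMap n ℝ ℝ) ∘ₗ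
      (LinearMap.mulRight ℝ (f : Matrix n n ℝ)) ∘ₗ (Algebra.adjoin ℝ S).val.toLinearMap
  have hφ : ∀ a f, φ a f = ((a : Matrix n n ℝ) * f).trace := fun a f => rfl
  obtain ⟨g, hg⟩ : ∃ g : (F → ℝ) →ₗ[ℝ] Algebra.adjoin ℝ S, ∀ a, φ (g (φ a)) = φ a := by
    obtain ⟨g₀, hg₀⟩ := φ.rangeRestrict.exists_rightInverse_of_surjective φ.range_rangeRestrict
    obtain ⟨g, hg⟩ := LinearMap.exists_extend g₀
    refine ⟨g, fun a => ?_⟩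
    have h1 : g (φ a) = g₀ (φ.rangeRestrict a) := LinearMap.congr_fun hg (φ.rangeRestrict a)
    rw [h1]
    exact congrArg Subtype.val (LinearMap.congr_fun hg₀ (φ.rangeRestrict a))
  have hc0 : 0 ≤ c := (abs_nonneg _).trans (hc 1 (one_mem _))
  refine ⟨∑ f, c * ‖g (fun j => if f = j then 1 else 0)‖ + 1, by positivity, fun W hW => ?_⟩
  have hWA : W ∈ Algebra.adjoin ℝ S := by
    rw [← Subalgebra.mem_toSubmodule, Algebra.adjoin_eq_span]
    exact Submodule.subset_span hW
  let w : Algebra.adjoin ℝ S := ⟨W, hWA⟩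
  refine ⟨g (φ w), w - g (φ w), by simp [w], ?_, ?_⟩
  · rw [LinearMap.pi_apply_eq_sum_univ g (φ w)]
    refine (norm_sum_le_of_le _ fun f _ => ?_).trans (le_add_of_nonneg_right zero_le_one)
    exact (norm_smul (φ w f) (g fun j => if f = j then 1 else 0 : Matrix n n ℝ)).le.trans
      (mul_le_mul_of_nonneg_right (hc _ (mul_mem hW (hFS f.2))) (norm_nonneg _))
  · have hker : φ (w - g (φ w)) = 0 := by
      rw [map_sub, hg, sub_self]
    rintro ⟨b, hb⟩
    have hb' := hb
    rw [← Subalgebra.mem_toSubmodule, Algebra.adjoin_eq_span, hspan] at hb'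
    change (((w - g (φ w) : Algebra.adjoin ℝ S) : Matrix n n ℝ) * b).trace = 0
    clear hb
    induction hb' using Submodule.span_induction with
    | mem x hx => rw [← hφ _ ⟨x, hx⟩, hker]; rfl
    | zero => simp
    | add x y _ _ hx hy => rw [mul_add, Matrix.trace_add, hx, hy, add_zero]
    | smul t x _ hx => rw [mul_smul_comm, Matrix.trace_smul, hx, smul_zero]

theorem norm_list_prod_le_pow {𝔸 : Type*} [NormedRing 𝔸] (h1 : ‖(1 : 𝔸)‖ ≤ 1) {c : ℝ}
    (L : List 𝔸) (hL : ∀ a ∈ L, ‖a‖ ≤ c) : ‖L.prod‖ ≤ c ^ L.length := by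
  induction L with
  | nil => simpa using h1
  | cons a L ih =>
    have ha := hL a List.mem_cons_self
    rw [List.prod_cons, List.length_cons, pow_succ']
    exact (norm_mul_le _ _).trans (mul_le_mul ha (ih fun b hb => hL b (List.mem_cons_of_mem _ hb))
      (norm_nonneg _) ((norm_nonneg _).trans ha))

theorem norm_one_matrix_le : ‖(1 : Matrix n n ℝ)‖ ≤ 1 := by
  rw [← Matrix.diagonal_one, Matrix.l2_opNorm_diagonal]
  exact (pi_norm_le_iff_of_nonneg zero_le_one).2 fun i => by simp

/-- A bounded set of matrices whose products have bounded traces has joint spectral radius at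
most `1`. -/
theorem exists_norm_prod_le_of_trace_bounded {S : Set (Matrix n n ℝ)} {c C : ℝ}
    (hS : ∀ g ∈ S, ‖g‖ ≤ C) (hc : ∀ W ∈ Submonoid.closure S, |W.trace| ≤ c) {η : ℝ}
    (hη : 1 < η) :
    ∃ K : ℝ, 0 < K ∧ ∀ L : List (Matrix n n ℝ), (∀ g ∈ L, g ∈ S) →
      ‖L.prod‖ ≤ K * η ^ L.length := by
  obtain ⟨β, hβ, hdec⟩ := exists_decomposition_of_trace_bounded hc
  obtain ⟨q, hq⟩ := exists_traceRadical_pow_eq_bot (Algebra.adjoin ℝ S)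
  -- Words are cut into blocks of length `p + 1`; each block costs a factor `2 * β`, which is below
  -- `η ^ (p + 1)`.
  obtain ⟨p, hp⟩ := pow_unbounded_of_one_lt (2 * β) hη
  set C' := max C 1
  have hC' : 1 ≤ C' := le_max_right _ _
  have hC0 : 0 ≤ C' := zero_le_one.trans hC'
  have hprod : ∀ L : List (Matrix n n ℝ), (∀ g ∈ L, g ∈ S) → ‖L.prod‖ ≤ C' ^ L.length :=
    fun L hL => norm_list_prod_le_pow norm_one_matrix_le L
      fun a ha => (hS a (hL a ha)).trans (le_max_left _ _)
  -- The radical part of a block is the block minus its bounded part, whence this `γ`.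
  obtain ⟨K, hK0, hK⟩ := exists_norm_prod_add_le hq hβ (γ := C' ^ (p + 1) + β) (by positivity)
  have hblock : ∀ (m : ℕ) (L : List (Matrix n n ℝ)), (∀ g ∈ L, g ∈ S) →
      L.length = m * (p + 1) → ‖L.prod‖ ≤ K * (2 * β) ^ m := by
    intro m L hL hlen
    suffices h : ∃ B : List (Algebra.adjoin ℝ S × Algebra.adjoin ℝ S), B.length = m ∧
        (∀ x ∈ B, ‖x.1‖ ≤ β ∧ x.2 ∈ traceRadical (Algebra.adjoin ℝ S) ∧
          ‖x.2‖ ≤ C' ^ (p + 1) + β) ∧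
        L.prod = ((B.map fun x => x.1 + x.2).prod : Algebra.adjoin ℝ S) by
      obtain ⟨B, h1, h2, h3⟩ := h
      rw [h3, ← h1]
      exact hK B h2
    induction m generalizing L with
    | zero =>
      rw [zero_mul, List.length_eq_zero_iff] at hlen
      exact ⟨[], rfl, by simp, by simp [hlen]⟩
    | succ m ih =>
      have hT : ∀ g ∈ L.take (p + 1), g ∈ S := fun g hg => hL g (List.mem_of_mem_take hg)
      have hTl : (L.take (p + 1)).length = p + 1 := by
        rw [List.length_take, hlen, Nat.min_eq_left]; nlinarith
      obtain ⟨B, h1, h2, h3⟩ := ih (L.drop (p + 1)) (fun g hg => hL g (List.mem_of_mem_drop hg))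
        (by rw [List.length_drop, hlen, Nat.succ_mul, Nat.add_sub_cancel])
      obtain ⟨b, r, hbr, hb, hr⟩ := hdec (L.take (p + 1)).prod
        (Submonoid.list_prod_mem _ fun g hg => Submonoid.subset_closure (hT g hg))
      refine ⟨(b, r) :: B, by simp [h1], ?_, ?_⟩
      · intro x hx
        rcases List.mem_cons.1 hx with rfl | hx
        · refine ⟨hb, hr, ?_⟩
          have h5 : r = (b + r) - b := by abel
          rw [h5]
          refine (norm_sub_le _ _).trans (add_le_add ?_ hb)
          have := hprod _ hT
          rwa [hTl, hbr] at this
        · exact h2 x hx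
      · rw [← List.take_append_drop (p + 1) L, List.prod_append, List.map_cons, List.prod_cons,
          Subalgebra.coe_mul, ← h3, ← hbr]
  refine ⟨(K + 1) * C' ^ (p + 1), by positivity, fun L hL => ?_⟩
  set m := L.length / (p + 1)
  have hm : m * (p + 1) ≤ L.length := Nat.div_mul_le_self _ _
  have h1 := hblock m (L.take (m * (p + 1))) (fun g hg => hL g (List.mem_of_mem_take hg))
    (by rw [List.length_take, Nat.min_eq_left hm])
  have h2 := hprod (L.drop (m * (p + 1))) (fun g hg => hL g (List.mem_of_mem_drop hg))
  have h3 : (L.drop (m * (p + 1))).length ≤ p + 1 := by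
    rw [List.length_drop]
    have := Nat.lt_div_mul_add (a := L.length) (Nat.succ_pos p)
    simp only [Nat.succ_eq_add_one] at this
    change _ < m * (p + 1) + (p + 1) at this
    omega
  rw [← List.take_append_drop (m * (p + 1)) L, List.prod_append, List.take_append_drop]
  calc _ ≤ (K * (2 * β) ^ m) * C' ^ (p + 1) := (norm_mul_le _ _).trans
        (mul_le_mul h1 (h2.trans (pow_le_pow_right₀ hC' h3)) (norm_nonneg _) (by positivity))
    _ ≤ ((K + 1) * η ^ L.length) * C' ^ (p + 1) := by
        gcongr
        · linarith
        · calc (2 * β) ^ m ≤ (η ^ (p + 1)) ^ m := by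
                gcongr
                exact hp.le.trans (pow_le_pow_right₀ hη.le (Nat.le_succ p))
            _ = η ^ (m * (p + 1)) := by rw [← pow_mul, mul_comm]
            _ ≤ η ^ L.length := pow_le_pow_right₀ hη.le hm
    _ = _ := by ring

end BoundedTrace

end SwitchedSystem

end

noncomputable section

namespace SwitchedSystem

open scoped Matrix.Norms.L2Operator

/-! ### Linear differential equations with two time scales -/

section SlowFast

/-- The right-hand side is an explicit primitive of the bound on the derivative. Two source terms
are provided because the slow component is driven both by the layer and by an `O(ε)` remainder; when
one suffices, the other is switched off by `a₂ = 0`. -/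
theorem norm_sub_le_of_norm_deriv_le_exp {E : Type*} [NormedAddCommGroup E] [NormedSpace ℝ E]
    {g g' : ℝ → E} (hg : ∀ r, HasDerivAt g (g' r) r) {S a₁ k₁ l₁ a₂ k₂ l₂ : ℝ} (hS : 0 ≤ S)
    (h₁ : k₁ ≠ l₁) (h₂ : k₂ ≠ l₂)
    (hb : ∀ r, 0 ≤ r → r ≤ S → ‖g' r‖ ≤ a₁ * (Real.exp (l₁ * (S - r)) * Real.exp (k₁ * r)) +
      a₂ * (Real.exp (l₂ * (S - r)) * Real.exp (k₂ * r))) :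
    ‖g S - g 0‖ ≤ a₁ * ((Real.exp (k₁ * S) - Real.exp (l₁ * S)) / (k₁ - l₁)) +
      a₂ * ((Real.exp (k₂ * S) - Real.exp (l₂ * S)) / (k₂ - l₂)) := by
  have hd : ∀ a k l : ℝ, k ≠ l → ∀ r, HasDerivAt
      (fun r => a * ((Real.exp (l * (S - r)) * Real.exp (k * r) - Real.exp (l * S)) / (k - l)))
      (a * (Real.exp (l * (S - r)) * Real.exp (k * r))) r := by
    intro a k l hkl r
    have e1 : HasDerivAt (fun r => Real.exp (l * (S - r))) (Real.exp (l * (S - r)) * (l * -1)) r :=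
      (((hasDerivAt_id r).const_sub S).const_mul l).exp
    have e2 : HasDerivAt (fun r => Real.exp (k * r)) (Real.exp (k * r) * (k * 1)) r :=
      ((hasDerivAt_id r).const_mul k).exp
    have := ((((e1.mul e2).sub_const (Real.exp (l * S))).div_const (k - l)).const_mul a)
    refine this.congr_deriv ?_
    have : k - l ≠ 0 := sub_ne_zero.2 hkl
    field_simp
    ring
  have := image_norm_le_of_norm_deriv_right_le_deriv_boundary (a := 0) (b := S)
    (f := fun r => g r - g 0) (f' := g')
    (fun r _ => ((hg r).sub_const _).continuousAt.continuousWithinAt)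
    (fun r _ => ((hg r).sub_const _).hasDerivWithinAt)
    (B := fun r => a₁ * ((Real.exp (l₁ * (S - r)) * Real.exp (k₁ * r) - Real.exp (l₁ * S)) /
      (k₁ - l₁)) + a₂ * ((Real.exp (l₂ * (S - r)) * Real.exp (k₂ * r) - Real.exp (l₂ * S)) /
      (k₂ - l₂))) (by simp) (fun r => (hd a₁ k₁ l₁ h₁ r).add (hd a₂ k₂ l₂ h₂ r))
    (fun r hr => hb r hr.1 hr.2.le) (Set.right_mem_Icc.2 hS)
  simpa using this

variable {𝔸 : Type*} [NormedRing 𝔸] [NormedAlgebra ℝ 𝔸] [CompleteSpace 𝔸]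

/-- The two contributions of `N` meet in the middle and cancel. Integration over `[0, S]` is
Duhamel's formula with source `Q`. -/
theorem hasDerivAt_exp_smul_mul_exp_smul (N Q : 𝔸) (S r : ℝ) :
    HasDerivAt (fun r : ℝ => NormedSpace.exp ((S - r) • N) * NormedSpace.exp (r • (N + Q)))
      (NormedSpace.exp ((S - r) • N) * (Q * NormedSpace.exp (r • (N + Q)))) r := by
  have h1 : HasDerivAt (fun r : ℝ => NormedSpace.exp ((S - r) • N))
      ((-1 : ℝ) • (NormedSpace.exp ((S - r) • N) * N)) r :=
    (hasDerivAt_exp_smul_const N (S - r)).scomp r ((hasDerivAt_id r).const_sub S)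
  have h2 := hasDerivAt_exp_smul_const' (N + Q) r
  refine (h1.mul h2).congr_deriv ?_
  simp only [neg_smul, one_smul]
  noncomm_ring

-- Project Duhamel's formula by `p` and `1 - p`. Since `p * Q * p = 0`, the slow part is fed only by
-- the fast part, while convolution with the fast kernel gains a factor `ε`. The resulting pair of
-- inequalities closes for small `ε` and gives a priori bounds. Reinserting them makes the fast
-- error, and then the slow error, of order `ε`. The `O(s)` bound is the cruder estimate without
-- projections.
set_option maxHeartbeats 1000000 in
theorem exists_slow_fast_estimate {C ν δ α q : ℝ} (hC : 0 < C) (hδ : 0 < δ) (hα : 0 < α)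
    (hq : 0 ≤ q) :
    ∃ c > 0, ∃ ε₀ > 0, ∀ (p N Q : 𝔸) (ε : ℝ), 0 < ε → ε ≤ ε₀ → p * p = p → Commute p N →
      p * Q * p = 0 → ‖Q‖ ≤ q →
      (∀ s, 0 ≤ s → ‖p * NormedSpace.exp (s • N)‖ ≤ C * Real.exp ((ν - δ) * s)) →
      (∀ s, 0 ≤ s → ‖(1 - p) * NormedSpace.exp (s • N)‖ ≤ C * Real.exp (-(α / ε) * s)) →
      ∀ s, 0 ≤ s →
        ‖NormedSpace.exp (s • (N + Q)) - NormedSpace.exp (s • N)‖ ≤ c * ε * Real.exp (ν * s) ∧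
        ‖NormedSpace.exp (s • (N + Q)) - NormedSpace.exp (s • N)‖ ≤ c * s * Real.exp (ν * s) ∧
        ‖NormedSpace.exp (s • (N + Q))‖ ≤ c * Real.exp (ν * s) := by
  -- `k` is the gain from fast to slow, `X₀` and `Z₀` are the a priori bounds of the slow and fast
  -- parts, `c₁` and `c₂` the constants of their `O(ε)` errors, and `c₃` that of the `O(s)` error.
  set k := C * q / δ with hk
  have hk0 : 0 ≤ k := by positivity
  set X₀ := C + 3 * k * C
  set Z₀ := 3 * C
  have hX₀ : 0 < X₀ := by positivity
  have hZ₀ : 0 < Z₀ := by positivity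
  set c₁ := 2 * C * q / α * (X₀ + Z₀) with hc₁
  have hc₁0 : 0 ≤ c₁ := by positivity
  set c₂ := C * q * C * (2 / α) + c₁ * k with hc₂
  set c₃ := 2 * C * q * (X₀ + Z₀)
  have hc₂0 : 0 ≤ c₂ := by positivity
  have hc₃0 : 0 ≤ c₃ := by positivity
  -- The first bound gives `ν + α / ε ≥ α / (2 * ε)`; the second gives `θ * (k + 1) ≤ 1 / 2`, where
  -- `θ` is the gain into the fast part.
  set ε₀ := min (α / (2 * (|ν| + 1))) (α / (4 * (C * q + 1) * (k + 1))) with hε₀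
  refine ⟨c₁ + c₂ + c₃ + X₀ + Z₀, by positivity, ε₀, by positivity, ?_⟩
  intro p N Q ε hε hεε₀ hpp hpN hpQp hQ hslow hfast
  have hε1 : ε * (2 * (|ν| + 1)) ≤ α := by
    rw [← le_div_iff₀ (by positivity)]; exact hεε₀.trans (min_le_left _ _)
  have hε2 : ε * (4 * (C * q + 1) * (k + 1)) ≤ α := by
    rw [← le_div_iff₀ (by positivity)]; exact hεε₀.trans (min_le_right _ _)
  have hgap : α / (2 * ε) ≤ ν + α / ε := by
    have h1 : |ν| ≤ α / (2 * ε) := by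
      rw [le_div_iff₀ (by positivity)]; nlinarith
    have h2 : α / ε = α / (2 * ε) + α / (2 * ε) := by field_simp; ring
    have := neg_abs_le ν
    linarith
  have hgap0 : 0 < α / (2 * ε) := by positivity
  have hgap1 : 1 / (ν + α / ε) ≤ 2 / α * ε := by
    calc 1 / (ν + α / ε) ≤ 1 / (α / (2 * ε)) := one_div_le_one_div_of_le hgap0 hgap
      _ = 2 / α * ε := by field_simp
  set θ := 2 * C * q / α * ε with hθ
  have hθ0 : 0 ≤ θ := by positivity
  have hθ1 : θ * (k + 1) ≤ 1 / 2 := by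
    rw [hθ, div_mul_eq_mul_div, div_mul_eq_mul_div, div_le_iff₀ hα]
    nlinarith [mul_nonneg hε.le (add_nonneg hk0 zero_le_one)]
  have hexp1 : ∀ s : ℝ, 0 ≤ s → Real.exp (-(α / ε) * s) ≤ Real.exp (ν * s) := fun s hs =>
    Real.exp_le_exp.2 (mul_le_mul_of_nonneg_right (by linarith) hs)
  have hexp2 : ∀ s : ℝ, 0 ≤ s → Real.exp ((ν - δ) * s) ≤ Real.exp (ν * s) := fun s hs =>
    Real.exp_le_exp.2 (mul_le_mul_of_nonneg_right (by linarith) hs)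
  set U : ℝ → 𝔸 := fun s => NormedSpace.exp (s • N) with hU
  set V : ℝ → 𝔸 := fun s => NormedSpace.exp (s • (N + Q)) with hV
  have hU0 : U 0 = 1 := by simp [hU]
  have hV0 : V 0 = 1 := by simp [hV]
  have hVc : Continuous V := by
    rw [continuous_iff_continuousAt]
    exact fun s => (hasDerivAt_exp_smul_const (N + Q) s).continuousAt
  have hpU : ∀ s, p * U s = U s * p := fun s =>
    ((hpN.smul_right s).exp_right).eq
  have hsplit : ∀ s, ‖V s‖ ≤ ‖p * V s‖ + ‖(1 - p) * V s‖ := fun s => by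
    refine le_trans (le_of_eq ?_) (norm_add_le _ _)
    rw [sub_mul, one_mul, add_sub_cancel]
  -- the two projected Duhamel formulas
  have hDp : ∀ S r, ‖p * (U (S - r) * (Q * V r))‖ ≤
      ‖p * U (S - r)‖ * (q * ‖(1 - p) * V r‖) := by
    intro S r
    have h1 : p * (U (S - r) * (Q * V r)) = (p * U (S - r)) * (Q * ((1 - p) * V r)) := by
      -- `p` commutes with the unperturbed flow, so the slow-to-slow path contains the factor `p * Q
      -- * p`.
      have h2 : p * U (S - r) * (Q * (p * V r)) = 0 := by
        calc p * U (S - r) * (Q * (p * V r)) = p * p * U (S - r) * (Q * (p * V r)) := by rw [hpp]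
          _ = p * (p * U (S - r)) * (Q * (p * V r)) := by noncomm_ring
          _ = p * (U (S - r) * p) * (Q * (p * V r)) := by rw [hpU]
          _ = p * U (S - r) * (p * Q * p) * V r := by noncomm_ring
          _ = 0 := by rw [hpQp]; simp
      rw [sub_mul, one_mul, mul_sub, mul_sub, h2, sub_zero]
      noncomm_ring
    rw [h1]
    exact (norm_mul_le _ _).trans (mul_le_mul_of_nonneg_left ((norm_mul_le _ _).trans
      (mul_le_mul_of_nonneg_right hQ (norm_nonneg _))) (norm_nonneg _))
  have hDf : ∀ S r, ‖(1 - p) * (U (S - r) * (Q * V r))‖ ≤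
      ‖(1 - p) * U (S - r)‖ * (q * ‖V r‖) := by
    intro S r
    rw [← mul_assoc]
    exact (norm_mul_le _ _).trans (mul_le_mul_of_nonneg_left ((norm_mul_le _ _).trans
      (mul_le_mul_of_nonneg_right hQ (norm_nonneg _))) (norm_nonneg _))
  have hder : ∀ (a : 𝔸) (S r : ℝ), HasDerivAt (fun r => a * (U (S - r) * V r))
      (a * (U (S - r) * (Q * V r))) r := fun a S r =>
    (hasDerivAt_exp_smul_mul_exp_smul N Q S r).const_mul a
  have hslow' : ∀ S Z : ℝ, 0 ≤ S → 0 ≤ Z →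
      (∀ r, 0 ≤ r → r ≤ S → ‖(1 - p) * V r‖ ≤ Z * Real.exp (ν * r)) →
      ‖p * V S - p * U S‖ ≤ k * Z * Real.exp (ν * S) := by
    intro S Z hS hZ h
    have := norm_sub_le_of_norm_deriv_le_exp (hder p S) hS (a₁ := C * q * Z) (k₁ := ν)
      (l₁ := ν - δ) (a₂ := 0) (k₂ := 1) (l₂ := 0) (by linarith) one_ne_zero (by
        intro r hr0 hrS
        refine (hDp S r).trans ?_
        rw [zero_mul, add_zero]
        calc _ ≤ C * Real.exp ((ν - δ) * (S - r)) * (q * (Z * Real.exp (ν * r))) := by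
              gcongr
              · exact hslow _ (by linarith)
              · exact h r hr0 hrS
          _ = _ := by ring)
    simp only [sub_self, sub_zero, hU0, hV0, mul_one, one_mul, zero_mul, add_zero] at this
    refine this.trans ?_
    rw [show ν - (ν - δ) = δ by ring, hk]
    have h3 : C * q * Z * ((Real.exp (ν * S) - Real.exp ((ν - δ) * S)) / δ) =
      C * q / δ * Z * (Real.exp (ν * S) - Real.exp ((ν - δ) * S)) := by ring
    rw [h3]
    gcongr
    linarith [Real.exp_pos ((ν - δ) * S)]
  have hfast' : ∀ S Y : ℝ, 0 ≤ S → 0 ≤ Y →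
      (∀ r, 0 ≤ r → r ≤ S → ‖V r‖ ≤ Y * Real.exp (ν * r)) →
      ‖(1 - p) * V S - (1 - p) * U S‖ ≤ θ * Y * Real.exp (ν * S) := by
    intro S Y hS hY h
    have := norm_sub_le_of_norm_deriv_le_exp (hder (1 - p) S) hS (a₁ := C * q * Y) (k₁ := ν)
      (l₁ := -(α / ε)) (a₂ := 0) (k₂ := 1) (l₂ := 0) (by linarith) one_ne_zero (by
        intro r hr0 hrS
        refine (hDf S r).trans ?_
        rw [zero_mul, add_zero]
        calc _ ≤ C * Real.exp (-(α / ε) * (S - r)) * (q * (Y * Real.exp (ν * r))) := by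
              gcongr
              · exact hfast _ (by linarith)
              · exact h r hr0 hrS
          _ = _ := by ring)
    simp only [sub_self, sub_zero, hU0, hV0, mul_one, one_mul, zero_mul, add_zero] at this
    refine this.trans ?_
    rw [show ν - -(α / ε) = ν + α / ε by ring]
    calc C * q * Y * ((Real.exp (ν * S) - Real.exp (-(α / ε) * S)) / (ν + α / ε))
        = C * q * Y * (1 / (ν + α / ε)) * (Real.exp (ν * S) - Real.exp (-(α / ε) * S)) := by ring
      _ ≤ C * q * Y * (2 / α * ε) * Real.exp (ν * S) := by
          have h0 : 0 ≤ 1 / (ν + α / ε) := by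
            have : 0 < ν + α / ε := by linarith
            positivity
          have h4 := hexp1 S hS
          apply mul_le_mul (mul_le_mul_of_nonneg_left hgap1 (by positivity)) _ (by linarith)
            (by positivity)
          linarith [Real.exp_pos (-(α / ε) * S)]
      _ = θ * Y * Real.exp (ν * S) := by rw [hθ]; ring
  -- a priori bounds
  have hmax : ∀ (a : 𝔸) (S : ℝ), 0 ≤ S → ∃ r, 0 ≤ r ∧ r ≤ S ∧
      ∀ r', 0 ≤ r' → r' ≤ S → ‖a * V r'‖ ≤ (‖a * V r‖ * Real.exp (-(ν * r))) *
        Real.exp (ν * r') := by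
    intro a S hS
    obtain ⟨r, hr, hrm⟩ := (isCompact_Icc (a := (0 : ℝ)) (b := S)).exists_isMaxOn
      ⟨0, Set.left_mem_Icc.2 hS⟩ (f := fun r => ‖a * V r‖ * Real.exp (-(ν * r)))
      (by fun_prop)
    refine ⟨r, hr.1, hr.2, fun r' h0 h1 => ?_⟩
    have := hrm (Set.mem_Icc.2 ⟨h0, h1⟩)
    simp only [Set.mem_ofPred_eq] at this
    calc ‖a * V r'‖ = (‖a * V r'‖ * Real.exp (-(ν * r'))) * Real.exp (ν * r') := by
          rw [mul_assoc, ← Real.exp_add]; simp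
      _ ≤ _ := by gcongr
  -- The weighted maxima `X`, `Z` over `[0, S]` satisfy `X ≤ C + k Z` and `Z ≤ C + θ (X + Z)`. They
  -- are finite by continuity, so the smallness of `θ` yields bounds independent of `S`.
  have happ : ∀ S, 0 ≤ S → ‖p * V S‖ ≤ X₀ * Real.exp (ν * S) ∧
      ‖(1 - p) * V S‖ ≤ Z₀ * Real.exp (ν * S) := by
    intro S hS
    obtain ⟨r₁, hr₁, hr₁S, h₁⟩ := hmax p S hS
    obtain ⟨r₂, hr₂, hr₂S, h₂⟩ := hmax (1 - p) S hS
    set X := ‖p * V r₁‖ * Real.exp (-(ν * r₁)) with hX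
    set Z := ‖(1 - p) * V r₂‖ * Real.exp (-(ν * r₂)) with hZ
    have hX0 : 0 ≤ X := by positivity
    have hZ0 : 0 ≤ Z := by positivity
    have hcancel : ∀ r : ℝ, Real.exp (ν * r) * Real.exp (-(ν * r)) = 1 := fun r => by
      rw [← Real.exp_add]; simp
    have hXle : X ≤ C + k * Z := by
      have h3 := hslow' r₁ Z hr₁ hZ0 fun r h0 h1 => h₂ r h0 (h1.trans hr₁S)
      have h4 : ‖p * V r₁‖ ≤ (C + k * Z) * Real.exp (ν * r₁) := by
        have h5 := norm_le_norm_add_norm_sub (p * U r₁) (p * V r₁)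
        have h6 := (hslow r₁ hr₁).trans (mul_le_mul_of_nonneg_left (hexp2 r₁ hr₁) hC.le)
        change ‖p * U r₁‖ ≤ _ at h6
        rw [norm_sub_rev] at h5
        linarith
      calc X ≤ (C + k * Z) * Real.exp (ν * r₁) * Real.exp (-(ν * r₁)) := by rw [hX]; gcongr
        _ = C + k * Z := by rw [mul_assoc, hcancel, mul_one]
    have hZle : Z ≤ C + θ * (X + Z) := by
      have h3 := hfast' r₂ (X + Z) hr₂ (by positivity) fun r h0 h1 => (hsplit r).trans (by
        rw [add_mul]
        exact add_le_add (h₁ r h0 (h1.trans hr₂S)) (h₂ r h0 (h1.trans hr₂S)))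
      have h4 : ‖(1 - p) * V r₂‖ ≤ (C + θ * (X + Z)) * Real.exp (ν * r₂) := by
        have h5 := norm_le_norm_add_norm_sub ((1 - p) * U r₂) ((1 - p) * V r₂)
        have h6 := (hfast r₂ hr₂).trans (mul_le_mul_of_nonneg_left (hexp1 r₂ hr₂) hC.le)
        change ‖(1 - p) * U r₂‖ ≤ _ at h6
        rw [norm_sub_rev] at h3
        linarith
      calc Z ≤ (C + θ * (X + Z)) * Real.exp (ν * r₂) * Real.exp (-(ν * r₂)) := by
            rw [hZ]; gcongr
        _ = C + θ * (X + Z) := by rw [mul_assoc, hcancel, mul_one]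
    have hθ2 : θ ≤ 1 / 2 := by nlinarith
    have hZZ : Z ≤ Z₀ := by
      have h7 : θ * (X + Z) ≤ θ * C + θ * (k + 1) * Z := by nlinarith
      have h8 : θ * (k + 1) * Z ≤ 1 / 2 * Z := mul_le_mul_of_nonneg_right hθ1 hZ0
      have h9 : θ * C ≤ 1 / 2 * C := mul_le_mul_of_nonneg_right hθ2 hC.le
      change Z ≤ 3 * C
      linarith
    have hXX : X ≤ X₀ := by
      have : k * Z ≤ k * (3 * C) := mul_le_mul_of_nonneg_left hZZ hk0
      change X ≤ C + 3 * k * C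
      linarith
    exact ⟨(h₁ S hS le_rfl).trans (by gcongr), (h₂ S hS le_rfl).trans (by gcongr)⟩
  have happV : ∀ S, 0 ≤ S → ‖V S‖ ≤ (X₀ + Z₀) * Real.exp (ν * S) := fun S hS => by
    rw [add_mul]
    exact (hsplit S).trans (add_le_add (happ S hS).1 (happ S hS).2)
  have hfe : ∀ S, 0 ≤ S → ‖(1 - p) * V S - (1 - p) * U S‖ ≤ c₁ * ε * Real.exp (ν * S) := by
    intro S hS
    refine (hfast' S (X₀ + Z₀) hS (by positivity) fun r h0 _ => happV r h0).trans (le_of_eq ?_)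
    rw [hθ, hc₁]; ring
  -- The fast part is now known to be a layer `exp (-(α / ε) * r)` plus `O(ε)`. The integral of the
  -- layer is itself `O(ε)`, so the slow error is too.
  have hse : ∀ S, 0 ≤ S → ‖p * V S - p * U S‖ ≤ c₂ * ε * Real.exp (ν * S) := by
    intro S hS
    have := norm_sub_le_of_norm_deriv_le_exp (hder p S) hS (a₁ := C * q * C) (k₁ := -(α / ε))
      (l₁ := ν) (a₂ := C * q * (c₁ * ε)) (k₂ := ν) (l₂ := ν - δ) (by linarith) (by linarith) (by
        intro r hr0 hrS
        refine (hDp S r).trans ?_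
        have h1 : ‖(1 - p) * V r‖ ≤ C * Real.exp (-(α / ε) * r) + c₁ * ε * Real.exp (ν * r) := by
          have h5 := norm_le_norm_add_norm_sub ((1 - p) * U r) ((1 - p) * V r)
          have h6 := hfe r hr0
          have h7 := hfast r hr0
          change ‖(1 - p) * U r‖ ≤ _ at h7
          rw [norm_sub_rev] at h6
          linarith
        have h2 := hslow (S - r) (by linarith)
        have h3 := hexp2 (S - r) (by linarith)
        calc _ ≤ C * Real.exp ((ν - δ) * (S - r)) * (q * (C * Real.exp (-(α / ε) * r) +
                c₁ * ε * Real.exp (ν * r))) := by gcongr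
          _ = C * q * C * (Real.exp ((ν - δ) * (S - r)) * Real.exp (-(α / ε) * r)) +
              C * q * (c₁ * ε) * (Real.exp ((ν - δ) * (S - r)) * Real.exp (ν * r)) := by ring
          _ ≤ _ := by gcongr)
    simp only [sub_self, sub_zero, hU0, hV0, mul_one, one_mul] at this
    refine this.trans ?_
    have e1 : C * q * C * ((Real.exp (-(α / ε) * S) - Real.exp (ν * S)) / (-(α / ε) - ν)) ≤
        C * q * C * (2 / α * ε * Real.exp (ν * S)) := by
      refine mul_le_mul_of_nonneg_left ?_ (by positivity)
      rw [show (Real.exp (-(α / ε) * S) - Real.exp (ν * S)) / (-(α / ε) - ν) =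
        1 / (ν + α / ε) * (Real.exp (ν * S) - Real.exp (-(α / ε) * S)) by
          rw [show -(α / ε) - ν = -(ν + α / ε) by ring, div_neg, ← neg_div]; ring]
      have h4 := hexp1 S hS
      exact mul_le_mul hgap1 (by linarith [Real.exp_pos (-(α / ε) * S)]) (by linarith)
        (by positivity)
    have e2 : C * q * (c₁ * ε) * ((Real.exp (ν * S) - Real.exp ((ν - δ) * S)) / (ν - (ν - δ))) ≤
        c₁ * k * ε * Real.exp (ν * S) := by
      rw [show ν - (ν - δ) = δ by ring, hk]
      have h3 : C * q * (c₁ * ε) * ((Real.exp (ν * S) - Real.exp ((ν - δ) * S)) / δ) =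
        c₁ * (C * q / δ) * ε * (Real.exp (ν * S) - Real.exp ((ν - δ) * S)) := by ring
      rw [h3]
      gcongr
      linarith [Real.exp_pos ((ν - δ) * S)]
    refine (add_le_add e1 e2).trans (le_of_eq ?_)
    rw [hc₂]; ring
  intro s hs
  have hes := Real.exp_pos (ν * s)
  refine ⟨?_, ?_, ?_⟩
  · have h1 : V s - U s = (p * V s - p * U s) + ((1 - p) * V s - (1 - p) * U s) := by
      noncomm_ring
    change ‖V s - U s‖ ≤ _
    rw [h1]
    refine (norm_add_le _ _).trans ((add_le_add (hse s hs) (hfe s hs)).trans ?_)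
    rw [← add_mul, ← add_mul]
    exact mul_le_mul_of_nonneg_right (mul_le_mul_of_nonneg_right (by linarith) hε.le) hes.le
  · have h1 := norm_image_sub_le_of_norm_deriv_le_segment' (a := 0) (b := s)
      (f := fun r => U (s - r) * V r) (f' := fun r => U (s - r) * (Q * V r))
      (C := c₃ * Real.exp (ν * s))
      (fun r _ => (hasDerivAt_exp_smul_mul_exp_smul N Q s r).hasDerivWithinAt) (by
        intro r hr
        have h2 : ‖U (s - r)‖ ≤ 2 * C * Real.exp (ν * (s - r)) := by
          have h3 : U (s - r) = p * U (s - r) + (1 - p) * U (s - r) := by noncomm_ring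
          have hr' : 0 ≤ s - r := by linarith [hr.2]
          rw [h3]
          refine (norm_add_le _ _).trans ((add_le_add (hslow _ hr') (hfast _ hr')).trans ?_)
          have := mul_le_mul_of_nonneg_left (hexp1 _ hr') hC.le
          have := mul_le_mul_of_nonneg_left (hexp2 _ hr') hC.le
          linarith
        calc ‖U (s - r) * (Q * V r)‖ ≤ ‖U (s - r)‖ * (‖Q‖ * ‖V r‖) :=
              (norm_mul_le _ _).trans (mul_le_mul_of_nonneg_left (norm_mul_le _ _) (norm_nonneg _))
          _ ≤ 2 * C * Real.exp (ν * (s - r)) * (q * ((X₀ + Z₀) * Real.exp (ν * r))) := by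
              gcongr
              exact happV r hr.1
          _ = c₃ * (Real.exp (ν * (s - r)) * Real.exp (ν * r)) := by
              change _ = 2 * C * q * (X₀ + Z₀) * _; ring
          _ = c₃ * Real.exp (ν * s) := by rw [← Real.exp_add]; congr 2; ring) s
      (Set.right_mem_Icc.2 hs)
    simp only [sub_self, sub_zero, hU0, hV0, mul_one, one_mul] at h1
    refine h1.trans ?_
    rw [mul_assoc, mul_comm (Real.exp _) s, ← mul_assoc]
    gcongr
    linarith
  · refine (happV s hs).trans ?_
    gcongr
    linarith

end SlowFast

end SwitchedSystem

end

noncomputable section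

namespace SwitchedSystem

open scoped Matrix.Norms.L2Operator

/-! ### Spectral bounds for matrices and uniform exponential decay -/

section Spectral

theorem exp_mulVec_of_mulVec_eq {n : Type*} [Fintype n] [DecidableEq n] {A : Matrix n n ℂ}
    {v : n → ℂ} {c : ℂ} (h : A.mulVec v = c • v) :
    (NormedSpace.exp A).mulVec v = Complex.exp c • v := by
  have hpow : ∀ k : ℕ, (A ^ k).mulVec v = c ^ k • v := by
    intro k
    induction k with
    | zero => simp
    | succ k ih =>
      rw [pow_succ, ← Matrix.mulVec_mulVec, h, Matrix.mulVec_smul, ih, smul_smul, pow_succ']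
  let φ : Matrix n n ℂ →ₗ[ℂ] (n → ℂ) := (Matrix.mulVecBilin ℂ ℂ).flip v
  have hφ : ∀ B, φ B = B.mulVec v := fun B => rfl
  have h1 := (NormedSpace.exp_series_hasSum_exp' (𝕂 := ℂ) A).map φ.toAddMonoidHom
    φ.continuous_of_finiteDimensional
  have h2 := ((NormedSpace.exp_series_hasSum_exp' (𝕂 := ℂ) c).smul_const v)
  rw [← Complex.exp_eq_exp_ℂ] at h2
  refine h1.unique ?_
  convert h2 using 2 with k
  change φ ((k.factorial : ℂ)⁻¹ • A ^ k) = _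
  rw [hφ, Matrix.smul_mulVec, hpow, smul_assoc]

/-- `A` preserves each eigenspace of its exponential, hence has an eigenvector in it, and the
exponential acts on that vector by the exponential of the eigenvalue. -/
theorem exists_mem_spectrum_exp_eq {n : Type*} [Fintype n] [DecidableEq n] {A : Matrix n n ℂ}
    {z : ℂ} (hz : z ∈ spectrum ℂ (NormedSpace.exp A)) : ∃ c ∈ spectrum ℂ A, Complex.exp c = z := by
  rw [← Matrix.spectrum_toLin', ← Module.End.hasEigenvalue_iff_mem_spectrum] at hz
  set f : Module.End ℂ (n → ℂ) := Matrix.toLin' A with hf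
  set g : Module.End ℂ (n → ℂ) := Matrix.toLin' (NormedSpace.exp A) with hg
  have hcomm : Commute g f := by
    have h1 : Commute (NormedSpace.exp A) A := (Commute.refl A).exp_left
    rw [Commute, SemiconjBy, hf, hg, Module.End.mul_eq_comp, Module.End.mul_eq_comp,
      ← Matrix.toLin'_mul, ← Matrix.toLin'_mul, h1.eq]
  have hmap : ∀ x ∈ g.eigenspace z, f x ∈ g.eigenspace z :=
    Module.End.mapsTo_genEigenspace_of_comm hcomm z 1
  have : Nontrivial (g.eigenspace z) := Submodule.nontrivial_iff_ne_bot.2 hz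
  obtain ⟨c, hc⟩ := Module.End.exists_eigenvalue (f.restrict hmap)
  obtain ⟨v, hv⟩ := hc.exists_hasEigenvector
  have hv1 : f v = c • (v : n → ℂ) := congrArg Subtype.val hv.apply_eq_smul
  have hv0 : (v : n → ℂ) ≠ 0 := fun h => hv.2 (Subtype.ext h)
  have hv2 : g v = z • (v : n → ℂ) := Module.End.mem_eigenspace_iff.1 v.2
  refine ⟨c, ?_, ?_⟩
  · rw [← Matrix.spectrum_toLin', ← Module.End.hasEigenvalue_iff_mem_spectrum]
    exact Module.End.hasEigenvalue_of_hasEigenvector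
      ⟨Module.End.mem_eigenspace_iff.2 hv1, hv0⟩
  · have h3 : (NormedSpace.exp A).mulVec v = Complex.exp c • (v : n → ℂ) :=
      exp_mulVec_of_mulVec_eq hv1
    have h4 : Complex.exp c • (v : n → ℂ) = z • (v : n → ℂ) := h3.symm.trans hv2
    exact smul_left_injective ℂ hv0 h4

/-- By compactness of the spectrum the spectral radius is below one, and Gelfand's formula gives
geometric decay. -/
theorem tendsto_pow_of_spectrum_norm_lt_one {𝔸 : Type*} [NormedRing 𝔸] [NormedAlgebra ℂ 𝔸]
    [CompleteSpace 𝔸] {a : 𝔸} (h : ∀ z ∈ spectrum ℂ a, ‖z‖ < 1) :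
    Tendsto (fun k : ℕ => a ^ k) atTop (𝓝 0) := by
  rcases subsingleton_or_nontrivial 𝔸 with hs | hs
  · exact tendsto_const_nhds.congr fun k => Subsingleton.elim _ _
  have h1 : spectralRadius ℂ a < (1 : NNReal) :=
    spectrum.spectralRadius_lt_of_forall_lt a fun z hz => by exact_mod_cast h z hz
  obtain ⟨r, hr1, hr2⟩ := ENNReal.lt_iff_exists_nnreal_btwn.1 h1
  have h2 := (spectrum.pow_nnnorm_pow_one_div_tendsto_nhds_spectralRadius a).eventually_lt_const hr1
  have hr3 : r < 1 := by exact_mod_cast hr2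
  refine squeeze_zero_norm' ?_ (tendsto_pow_atTop_nhds_zero_of_lt_one r.2 hr3)
  filter_upwards [h2, eventually_ge_atTop 1] with k hk hk1
  have hk0 : (k : ℝ) ≠ 0 := by exact_mod_cast (by omega : k ≠ 0)
  have h3 : ((‖a ^ k‖₊ : ENNReal) ^ (1 / (k : ℝ))) ^ (k : ℝ) ≤ (r : ENNReal) ^ (k : ℝ) :=
    ENNReal.rpow_le_rpow hk.le (by positivity)
  rw [← ENNReal.rpow_mul, one_div_mul_cancel hk0, ENNReal.rpow_one, ENNReal.rpow_natCast] at h3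
  exact_mod_cast h3

variable {n : Type*} [Fintype n] [DecidableEq n]

theorem IsHurwitz.tendsto_exp_nsmul {A : Matrix n n ℝ} (hA : IsHurwitz A) :
    Tendsto (fun k : ℕ => NormedSpace.exp ((k : ℝ) • A)) atTop (𝓝 0) := by
  have hexp : ∀ B : Matrix n n ℝ, (NormedSpace.exp B).map (algebraMap ℝ ℂ) =
      NormedSpace.exp (B.map (algebraMap ℝ ℂ)) := by
    intro B
    let _ : NormedAlgebra ℚ (Matrix n n ℝ) := NormedAlgebra.restrictScalars ℚ ℝ _
    refine NormedSpace.map_exp ((algebraMap ℝ ℂ).mapMatrix (m := n)) ?_ B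
    exact continuous_id.matrix_map Complex.continuous_ofReal
  have h1 := tendsto_pow_of_spectrum_norm_lt_one
    (a := NormedSpace.exp (A.map (algebraMap ℝ ℂ))) (by
      intro z hz
      obtain ⟨c, hc, rfl⟩ := exists_mem_spectrum_exp_eq hz
      rw [Complex.norm_exp, Real.exp_lt_one_iff]
      exact hA c hc)
  have h2 : ∀ k : ℕ, NormedSpace.exp (A.map (algebraMap ℝ ℂ)) ^ k =
      (NormedSpace.exp ((k : ℝ) • A)).map (algebraMap ℝ ℂ) := by
    intro k
    rw [← hexp, Nat.cast_smul_eq_nsmul, Matrix.exp_nsmul]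
    exact (map_pow (algebraMap ℝ ℂ).mapMatrix _ _).symm
  have h3 := ((continuous_id.matrix_map Complex.continuous_re).tendsto (0 : Matrix n n ℂ)).comp h1
  rw [id, Matrix.map_zero _ Complex.zero_re] at h3
  refine h3.congr fun k => ?_
  simp only [Function.comp, h2, id]
  ext i j
  simp

theorem abs_apply_le_opNorm (A : Matrix n n ℝ) (i j : n) : |A i j| ≤ ‖A‖ := by
  have h := Matrix.l2_opNorm_mulVec A (EuclideanSpace.single j (1 : ℝ))
  rw [PiLp.norm_single, norm_one, mul_one] at h
  refine le_trans ?_ h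
  refine le_trans (le_of_eq ?_) (PiLp.norm_apply_le _ i)
  simp [Real.norm_eq_abs]

/-- Powers applied to an eigenvector show that every complex eigenvalue has modulus at most `r`, and
the trace is their sum. Only large powers are used, as suits hypotheses obtained from a limsup. -/
theorem abs_trace_le_of_norm_pow_le {A : Matrix n n ℝ} {r : ℝ} (hr : 0 < r) {m₀ : ℕ}
    (h : ∀ m : ℕ, m₀ ≤ m → ‖A ^ m‖ ≤ r ^ m) : |A.trace| ≤ Fintype.card n * r := by
  set Ac := A.map (algebraMap ℝ ℂ) with hAc
  have hroot : ∀ z ∈ Ac.charpoly.roots, ‖z‖ ≤ r := by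
    intro z hz
    have hz1 : z ∈ spectrum ℂ Ac :=
      Matrix.mem_spectrum_iff_isRoot_charpoly.2 (Polynomial.isRoot_of_mem_roots hz)
    rw [← Matrix.spectrum_toLin', ← Module.End.hasEigenvalue_iff_mem_spectrum] at hz1
    obtain ⟨v, hv⟩ := hz1.exists_hasEigenvector
    obtain ⟨i, hi⟩ := Function.ne_iff.1 hv.2
    have hpow : ∀ m : ℕ, (Ac ^ m).mulVec v = z ^ m • v := by
      intro m
      induction m with
      | zero => simp
      | succ m ih =>
        rw [pow_succ, ← Matrix.mulVec_mulVec, show Ac.mulVec v = z • v from hv.apply_eq_smul,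
          Matrix.mulVec_smul, ih, smul_smul, pow_succ']
    by_contra! hlt
    have hq : 1 < ‖z‖ / r := (one_lt_div hr).2 hlt
    obtain ⟨m, hm, hm0⟩ := (((tendsto_pow_atTop_atTop_of_one_lt hq).eventually_gt_atTop
      ((∑ j, ‖v j‖) / ‖v i‖)).and (eventually_ge_atTop m₀)).exists
    have hvi : 0 < ‖v i‖ := norm_pos_iff.2 hi
    have h1 : ‖z‖ ^ m * ‖v i‖ ≤ r ^ m * ∑ j, ‖v j‖ := by
      have h2 := congrFun (hpow m) i
      have h3 : Ac ^ m = (A ^ m).map (algebraMap ℝ ℂ) :=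
        (map_pow (algebraMap ℝ ℂ).mapMatrix A m).symm
      rw [h3, Matrix.mulVec, dotProduct, Pi.smul_apply, smul_eq_mul] at h2
      rw [← norm_pow, ← norm_mul, ← h2, Finset.mul_sum]
      refine norm_sum_le_of_le _ fun j _ => ?_
      rw [norm_mul, Matrix.map_apply]
      refine mul_le_mul_of_nonneg_right ?_ (norm_nonneg _)
      refine le_trans ?_ (h m hm0)
      refine le_trans (le_of_eq ?_) (abs_apply_le_opNorm (A ^ m) i j)
      simp
    rw [div_lt_iff₀ hvi, div_pow, div_mul_eq_mul_div, lt_div_iff₀ (by positivity)] at hm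
    linarith
  have htr : ((A.trace : ℝ) : ℂ) = Ac.charpoly.roots.sum := by
    rw [← Matrix.trace_eq_sum_roots_charpoly]
    exact (AddMonoidHom.map_trace (algebraMap ℝ ℂ).toAddMonoidHom A)
  have hcard : Ac.charpoly.roots.card ≤ Fintype.card n :=
    (Polynomial.card_roots' _).trans (Matrix.charpoly_natDegree_eq_dim Ac).le
  calc |A.trace| = ‖((A.trace : ℝ) : ℂ)‖ := by simp
    _ ≤ (Ac.charpoly.roots.map fun z => ‖z‖).sum := by
        rw [htr]; exact norm_multiset_sum_le _
    _ ≤ Ac.charpoly.roots.card • r := by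
        have := Multiset.sum_le_card_nsmul (Ac.charpoly.roots.map fun z => ‖z‖) r (by
          intro x hx
          obtain ⟨z, hz, rfl⟩ := Multiset.mem_map.1 hx
          exact hroot z hz)
        rwa [Multiset.card_map] at this
    _ ≤ Fintype.card n * r := by
        rw [nsmul_eq_mul]; gcongr

end Spectral

/-! ### Uniform decay of semigroups over a compact parameter set -/

section UniformDecay

/-- A continuous family of one-parameter semigroups indexed by a compact set, each of which is a
contraction at some time, decays uniformly. -/
theorem exists_uniform_exp_decay {X : Type*} [TopologicalSpace X] {K : Set X} (hK : IsCompact K)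
    {𝔸 : Type*} [NormedRing 𝔸] {h : X → ℝ → 𝔸}
    (hadd : ∀ x ∈ K, ∀ s t, 0 ≤ s → 0 ≤ t → h x (s + t) = h x s * h x t)
    (hcont : ∀ s, 0 ≤ s → ContinuousOn (fun x => h x s) K)
    (hbdd : ∀ S, 0 ≤ S → ∃ B, ∀ x ∈ K, ∀ s, 0 ≤ s → s ≤ S → ‖h x s‖ ≤ B)
    (hlt : ∀ x ∈ K, ∃ s, 0 < s ∧ ‖h x s‖ < 1) :
    ∃ C > 0, ∃ α > 0, ∀ x ∈ K, ∀ s, 0 ≤ s → ‖h x s‖ ≤ C * Real.exp (-α * s) := by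
  suffices H : ∃ C > 0, ∃ α > 0, ∀ x ∈ K, x ∈ K → ∀ s, 0 ≤ s → ‖h x s‖ ≤ C * Real.exp (-α * s) by
    obtain ⟨C, hC, α, hα, H⟩ := H
    exact ⟨C, hC, α, hα, fun x hx => H x hx hx⟩
  refine hK.induction_on (p := fun U => ∃ C > 0, ∃ α > 0, ∀ x ∈ U, x ∈ K → ∀ s, 0 ≤ s →
    ‖h x s‖ ≤ C * Real.exp (-α * s)) ⟨1, one_pos, 1, one_pos, by simp⟩ ?_ ?_ ?_
  · rintro U V hUV ⟨C, hC, α, hα, H⟩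
    exact ⟨C, hC, α, hα, fun x hx => H x (hUV hx)⟩
  · rintro U V ⟨C, hC, α, hα, H⟩ ⟨C', hC', α', hα', H'⟩
    refine ⟨max C C', lt_max_of_lt_left hC, min α α', lt_min hα hα', ?_⟩
    rintro x (hx | hx) hxK s hs
    · refine (H x hx hxK s hs).trans (mul_le_mul (le_max_left _ _) (Real.exp_le_exp.2 ?_)
        (Real.exp_pos _).le (hC.le.trans (le_max_left _ _)))
      have := mul_le_mul_of_nonneg_right (min_le_left α α') hs
      linarith
    · refine (H' x hx hxK s hs).trans (mul_le_mul (le_max_right _ _) (Real.exp_le_exp.2 ?_)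
        (Real.exp_pos _).le (hC.le.trans (le_max_left _ _)))
      have := mul_le_mul_of_nonneg_right (min_le_right α α') hs
      linarith
  · intro x hx
    obtain ⟨t, ht, hxt⟩ := hlt x hx
    obtain ⟨q, hq1, hq2⟩ := exists_between hxt
    have hq0 : 0 < q := (norm_nonneg _).trans_lt hq1
    obtain ⟨B, hB⟩ := hbdd t ht.le
    -- Near `x` the same time `t` still contracts by `q`, which fixes the rate. Dividing by `q` pays
    -- for the incomplete last period.
    refine ⟨_, ((hcont t ht.le).norm x hx).eventually_lt_const hq1, max B 1 / q, by positivity,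
      -Real.log q / t, div_pos (neg_pos.2 (Real.log_neg hq0 hq2)) ht, ?_⟩
    intro y hy hyK s hs
    change ‖h y t‖ < q at hy
    have hmul : ∀ (m : ℕ) (r : ℝ), 0 ≤ r → r ≤ t → ‖h y (m * t + r)‖ ≤ q ^ m * max B 1 := by
      intro m r hr hrt
      induction m with
      | zero => simpa using Or.inl (hB y hyK r hr hrt)
      | succ m ih =>
        have : ((m + 1 : ℕ) : ℝ) * t + r = t + (m * t + r) := by push_cast; ring
        rw [this, hadd y hyK t _ ht.le (by positivity), pow_succ', mul_assoc]
        exact (norm_mul_le _ _).trans (mul_le_mul hy.le ih (norm_nonneg _) hq0.le)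
    set m := ⌊s / t⌋₊
    have hm1 : (m : ℝ) * t ≤ s := by
      rw [← le_div_iff₀ ht]; exact Nat.floor_le (by positivity)
    have hm2 : s < (m + 1) * t := by
      rw [← div_lt_iff₀ ht]; exact Nat.lt_floor_add_one _
    have h2 := hmul m (s - m * t) (by linarith) (by linarith)
    rw [add_sub_cancel] at h2
    refine h2.trans ?_
    have h3 : q ^ m * q ≤ Real.exp (-(-Real.log q / t) * s) := by
      rw [← pow_succ, ← Real.exp_log (pow_pos hq0 _), Real.log_pow]
      refine Real.exp_le_exp.2 ?_
      have h4 : -(-Real.log q / t) * s = Real.log q * (s / t) := by ring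
      rw [h4, mul_comm]
      refine mul_le_mul_of_nonpos_left ?_ (Real.log_neg hq0 hq2).le
      rw [div_le_iff₀ ht]
      push_cast
      exact hm2.le
    calc q ^ m * max B 1 = max B 1 / q * (q ^ m * q) := by field_simp
      _ ≤ _ := by gcongr

end UniformDecay

end SwitchedSystem

end

noncomputable section

namespace SwitchedSystem

open scoped Matrix.Norms.L2Operator

/-- The idempotent commutes with the generator, so its product with the exponential still has the
semigroup property, although its value at time `0` need not be `1`. -/
theorem exists_uniform_exp_smul_decay {X : Type*} [TopologicalSpace X] {K : Set X}
    (hK : IsCompact K) {𝔸 : Type*} [NormedRing 𝔸] [NormedAlgebra ℝ 𝔸] [CompleteSpace 𝔸]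
    {q a : X → 𝔸} (hq : ContinuousOn q K) (ha : ContinuousOn a K)
    (hqq : ∀ x ∈ K, q x * q x = q x) (hqa : ∀ x ∈ K, Commute (q x) (a x))
    (hlt : ∀ x ∈ K, ∃ s : ℝ, 0 < s ∧ ‖q x * NormedSpace.exp (s • a x)‖ < 1) :
    ∃ C > 0, ∃ α > 0, ∀ x ∈ K, ∀ s : ℝ, 0 ≤ s →
      ‖q x * NormedSpace.exp (s • a x)‖ ≤ C * Real.exp (-α * s) := by
  let _ : NormedAlgebra ℚ 𝔸 := NormedAlgebra.restrictScalars ℚ ℝ 𝔸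
  have hc : ContinuousOn (fun y : X × ℝ => q y.1 * NormedSpace.exp (y.2 • a y.1))
      (K ×ˢ Set.univ) := by
    have h1 : ContinuousOn (fun y : X × ℝ => q y.1) (K ×ˢ Set.univ) :=
      hq.comp continuousOn_fst fun y hy => hy.1
    have h2 : ContinuousOn (fun y : X × ℝ => a y.1) (K ×ˢ Set.univ) :=
      ha.comp continuousOn_fst fun y hy => hy.1
    exact h1.mul (NormedSpace.exp_continuous.comp_continuousOn (continuousOn_snd.smul h2))
  refine exists_uniform_exp_decay hK ?_ ?_ ?_ hlt
  · intro x hx s t _ _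
    have h1 : Commute (q x) (NormedSpace.exp (s • a x)) := ((hqa x hx).smul_right s).exp_right
    have h2 : Commute (s • a x) (t • a x) :=
      ((Commute.refl (a x)).smul_left s).smul_right t
    rw [add_smul, NormedSpace.exp_add_of_commute h2]
    calc q x * (NormedSpace.exp (s • a x) * NormedSpace.exp (t • a x))
        = q x * (q x * NormedSpace.exp (s • a x)) * NormedSpace.exp (t • a x) := by
          rw [← mul_assoc (q x) (q x), hqq x hx, mul_assoc]
      _ = q x * (NormedSpace.exp (s • a x) * q x) * NormedSpace.exp (t • a x) := by rw [h1.eq]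
      _ = _ := by simp only [mul_assoc]
  · intro s _
    exact hc.comp (continuousOn_id.prodMk continuousOn_const) fun x hx => ⟨hx, trivial⟩
  · intro S _
    obtain ⟨B, hB⟩ := (hK.prod (isCompact_Icc (a := (0 : ℝ)) (b := S))).exists_bound_of_continuousOn
      (hc.mono (Set.prod_mono_right (Set.subset_univ _)))
    exact ⟨B, fun x hx s h0 h1 => hB (x, s) ⟨hx, h0, h1⟩⟩

/-! ### Block matrices -/

section Blocks

variable {d ℓ : ℕ}

theorem ofBlocks_mul (A A' : Matrix (Slow d ℓ) (Slow d ℓ) ℝ) (B B' : Matrix (Slow d ℓ) (Fast d ℓ) ℝ)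
    (C C' : Matrix (Fast d ℓ) (Slow d ℓ) ℝ) (D D' : Matrix (Fast d ℓ) (Fast d ℓ) ℝ) :
    ofBlocks A B C D * ofBlocks A' B' C' D' =
      ofBlocks (A * A' + B * C') (A * B' + B * D') (C * A' + D * C') (C * B' + D * D') := by
  simp only [ofBlocks, Matrix.reindex_apply, Matrix.submatrix_mul_equiv, Matrix.fromBlocks_multiply]

theorem ofBlocks_add (A A' : Matrix (Slow d ℓ) (Slow d ℓ) ℝ) (B B' : Matrix (Slow d ℓ) (Fast d ℓ) ℝ)
    (C C' : Matrix (Fast d ℓ) (Slow d ℓ) ℝ) (D D' : Matrix (Fast d ℓ) (Fast d ℓ) ℝ) :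
    ofBlocks A B C D + ofBlocks A' B' C' D' = ofBlocks (A + A') (B + B') (C + C') (D + D') := by
  simp only [ofBlocks, Matrix.reindex_apply, ← Matrix.fromBlocks_add, Matrix.submatrix_add]
  rfl

theorem ofBlocks_smul (c : ℝ) (A : Matrix (Slow d ℓ) (Slow d ℓ) ℝ)
    (B : Matrix (Slow d ℓ) (Fast d ℓ) ℝ) (C : Matrix (Fast d ℓ) (Slow d ℓ) ℝ)
    (D : Matrix (Fast d ℓ) (Fast d ℓ) ℝ) :
    c • ofBlocks A B C D = ofBlocks (c • A) (c • B) (c • C) (c • D) := by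
  simp only [ofBlocks, Matrix.reindex_apply, ← Matrix.fromBlocks_smul, Matrix.submatrix_smul]
  rfl

theorem ofBlocks_one_zero_zero_one (ℓ : ℕ) :
    ofBlocks (1 : Matrix (Slow d ℓ) (Slow d ℓ) ℝ) 0 0 1 = 1 := by
  simp [ofBlocks, Matrix.fromBlocks_one]

theorem ofBlocks_toBlock (Q : Matrix (Fin d) (Fin d) ℝ) (ℓ : ℕ) :
    ofBlocks (ℓ := ℓ) (Q.toBlock _ _) (Q.toBlock _ _) (Q.toBlock _ _) (Q.toBlock _ _) = Q := by
  have := Matrix.fromBlocks_toBlocks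
    (Q.submatrix (Equiv.sumCompl fun i : Fin d => (i : ℕ) < ℓ)
      (Equiv.sumCompl fun i : Fin d => (i : ℕ) < ℓ))
  ext i j
  rw [ofBlocks, Matrix.reindex_apply, Matrix.submatrix_apply]
  have h2 := congrFun (congrFun this ((Equiv.sumCompl fun i : Fin d => (i : ℕ) < ℓ).symm i))
    ((Equiv.sumCompl fun i : Fin d => (i : ℕ) < ℓ).symm j)
  rw [Matrix.submatrix_apply, Equiv.apply_symm_apply, Equiv.apply_symm_apply] at h2
  exact h2

/-- The block diagonal matrices, as a ring homomorphism. -/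
def blockDiagHom (d ℓ : ℕ) :
    Matrix (Slow d ℓ) (Slow d ℓ) ℝ × Matrix (Fast d ℓ) (Fast d ℓ) ℝ →+* Matrix (Fin d) (Fin d) ℝ where
  toFun x := ofBlocks x.1 0 0 x.2
  map_one' := ofBlocks_one_zero_zero_one ℓ
  map_mul' x y := by rw [ofBlocks_mul]; simp
  map_zero' := by simp [ofBlocks]
  map_add' x y := by rw [ofBlocks_add]; simp

theorem continuous_ofBlocks_diag : Continuous fun x : Matrix (Slow d ℓ) (Slow d ℓ) ℝ ×
    Matrix (Fast d ℓ) (Fast d ℓ) ℝ => ofBlocks x.1 0 0 x.2 := by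
  refine Continuous.matrix_reindex ?_ _ _
  exact Continuous.matrix_fromBlocks continuous_fst continuous_const continuous_const continuous_snd

theorem exp_ofBlocks (A : Matrix (Slow d ℓ) (Slow d ℓ) ℝ) (D : Matrix (Fast d ℓ) (Fast d ℓ) ℝ) :
    NormedSpace.exp (ofBlocks A 0 0 D) = ofBlocks (NormedSpace.exp A) 0 0 (NormedSpace.exp D) := by
  let _ : NormedAlgebra ℚ (Matrix (Slow d ℓ) (Slow d ℓ) ℝ) := NormedAlgebra.restrictScalars ℚ ℝ _
  let _ : NormedAlgebra ℚ (Matrix (Fast d ℓ) (Fast d ℓ) ℝ) := NormedAlgebra.restrictScalars ℚ ℝ _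
  have h := NormedSpace.map_exp (blockDiagHom d ℓ) continuous_ofBlocks_diag (A, D)
  change ofBlocks (NormedSpace.exp (A, D)).1 0 0 (NormedSpace.exp (A, D)).2 =
    NormedSpace.exp (ofBlocks A 0 0 D) at h
  rw [Prod.fst_exp, Prod.snd_exp] at h
  exact h.symm

/-- The inclusion of the slow indices, as a matrix. -/
def slowInclusion (d ℓ : ℕ) : Matrix (Fin d) (Slow d ℓ) ℝ :=
  (1 : Matrix (Fin d) (Fin d) ℝ).submatrix id Subtype.val

/-- Writing truncations as compressions replaces products whose dimensions vary with the mode by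
products of `d × d` matrices. -/
theorem transpose_slowInclusion_mul_mul (Q : Matrix (Fin d) (Fin d) ℝ) (a b : ℕ) :
    (slowInclusion d a).transpose * Q * slowInclusion d b = truncate Q a b := by
  ext i j
  simp [slowInclusion, truncate, Matrix.mul_apply, Matrix.one_apply, Matrix.toBlock_apply]

theorem transpose_slowInclusion_mul_self (ℓ : ℕ) :
    (slowInclusion d ℓ).transpose * slowInclusion d ℓ = 1 := by
  ext i j
  simp [slowInclusion, Matrix.mul_apply, Matrix.one_apply, Subtype.ext_iff]

theorem ofBlocks_eq_slowInclusion_mul (A : Matrix (Slow d ℓ) (Slow d ℓ) ℝ) :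
    ofBlocks A 0 0 0 = slowInclusion d ℓ * A * (slowInclusion d ℓ).transpose := by
  have h0 : ∀ i : Fin d, ¬ (i : ℕ) < ℓ → ∀ k : Slow d ℓ, slowInclusion d ℓ i k = 0 := by
    intro i hi k
    refine Matrix.one_apply_ne fun h => hi ?_
    have := k.2
    rwa [show i = k.1 from h]
  have h1 : ∀ i k : Slow d ℓ, slowInclusion d ℓ i k = if i = k then 1 else 0 := by
    intro i k
    simp [slowInclusion, Matrix.one_apply, Subtype.ext_iff]
  ext i j
  rw [Matrix.mul_apply]
  simp only [Matrix.mul_apply, Matrix.transpose_apply, ofBlocks, Matrix.reindex_apply,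
    Matrix.submatrix_apply]
  by_cases hi : (i : ℕ) < ℓ
  · rw [Equiv.sumCompl_symm_apply_of_pos (p := fun i : Fin d => (i : ℕ) < ℓ) hi]
    by_cases hj : (j : ℕ) < ℓ
    · rw [Equiv.sumCompl_symm_apply_of_pos (p := fun i : Fin d => (i : ℕ) < ℓ) hj]
      have hi' : ∀ k, slowInclusion d ℓ i k = _ := h1 ⟨i, hi⟩
      have hj' : ∀ k, slowInclusion d ℓ j k = _ := h1 ⟨j, hj⟩
      simp [hi', hj']
    · rw [Equiv.sumCompl_symm_apply_of_neg (p := fun i : Fin d => (i : ℕ) < ℓ) hj]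
      simp [h0 j hj]
  · rw [Equiv.sumCompl_symm_apply_of_neg (p := fun i : Fin d => (i : ℕ) < ℓ) hi]
    rcases (Equiv.sumCompl fun i : Fin d => (i : ℕ) < ℓ).symm j with k | k <;>
      simp [h0 i hi]

theorem norm_slowInclusion_le (ℓ : ℕ) : ‖slowInclusion d ℓ‖ ≤ 1 := by
  have h1 := Matrix.l2_opNorm_conjTranspose_mul_self (slowInclusion d ℓ)
  rw [Matrix.conjTranspose_eq_transpose_of_trivial, transpose_slowInclusion_mul_self] at h1
  have h2 : ‖(1 : Matrix (Slow d ℓ) (Slow d ℓ) ℝ)‖ ≤ 1 := norm_one_matrix_le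
  nlinarith [norm_nonneg (slowInclusion d ℓ)]

theorem norm_transpose_slowInclusion_le (ℓ : ℕ) : ‖(slowInclusion d ℓ).transpose‖ ≤ 1 := by
  rw [← Matrix.conjTranspose_eq_transpose_of_trivial, Matrix.l2_opNorm_conjTranspose]
  exact norm_slowInclusion_le ℓ

end Blocks

end SwitchedSystem

end

noncomputable section

namespace SwitchedSystem

open scoped Matrix.Norms.L2Operator

/-! ### The matrices attached to a mode -/

theorem IsHurwitz.isUnit_det {n : Type*} [Fintype n] [DecidableEq n] {A : Matrix n n ℝ}
    (hA : IsHurwitz A) : IsUnit A.det := by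
  rw [← Matrix.isUnit_iff_isUnit_det]
  by_contra h
  have h0 : (0 : ℂ) ∈ spectrum ℂ (A.map (algebraMap ℝ ℂ)) := by
    rw [spectrum.zero_mem_iff, Matrix.isUnit_iff_isUnit_det]
    have : (A.map (algebraMap ℝ ℂ)).det = algebraMap ℝ ℂ A.det :=
      ((algebraMap ℝ ℂ).map_det A).symm
    rw [this, isUnit_iff_ne_zero, ne_eq, not_not, map_eq_zero]
    rw [Matrix.isUnit_iff_isUnit_det, isUnit_iff_ne_zero, not_not] at h
    exact h
  exact lt_irrefl _ (hA 0 h0)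

namespace Mode

variable {d : ℕ}

/-- The block diagonal matrix with blocks `M` and `0`. -/
def slowGen (σ : Mode d) : Matrix (Fin d) (Fin d) ℝ := ofBlocks σ.M 0 0 0

/-- The part of the generator of `(x, z) = T X` that couples slow and fast variables. -/
def coupling (σ : Mode d) : Matrix (Fin d) (Fin d) ℝ :=
  ofBlocks 0 σ.B (σ.D⁻¹ * σ.C * σ.M) (σ.D⁻¹ * σ.C * σ.B)

/-- The projection on the slow variables. -/
def slowProj (σ : Mode d) : Matrix (Fin d) (Fin d) ℝ :=
  ofBlocks (ℓ := σ.ell) 1 0 0 0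

variable {σ : Mode d}

theorem one_sub_slowProj : 1 - σ.slowProj = ofBlocks (ℓ := σ.ell) 0 0 0 1 := by
  rw [sub_eq_iff_eq_add, slowProj, ofBlocks_add]
  simp [ofBlocks_one_zero_zero_one]

theorem slowProj_mul_self : σ.slowProj * σ.slowProj = σ.slowProj := by
  rw [slowProj, ofBlocks_mul]; simp

theorem slowProj_commute_slowGen : Commute σ.slowProj σ.slowGen := by
  rw [Commute, SemiconjBy, slowProj, slowGen, ofBlocks_mul, ofBlocks_mul]; simp

theorem slowProj_commute_fastGen : Commute σ.slowProj σ.fastGen := by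
  rw [Commute, SemiconjBy, slowProj, fastGen, ofBlocks_mul, ofBlocks_mul]; simp

theorem slowProj_mul_coupling_mul : σ.slowProj * σ.coupling * σ.slowProj = 0 := by
  rw [slowProj, coupling, ofBlocks_mul, ofBlocks_mul]
  simp [ofBlocks]

theorem exp_smul_slowGen (s : ℝ) :
    NormedSpace.exp (s • σ.slowGen) = ofBlocks (NormedSpace.exp (s • σ.M)) 0 0 1 := by
  rw [slowGen, ofBlocks_smul, smul_zero, smul_zero, smul_zero, exp_ofBlocks, NormedSpace.exp_zero]

theorem exp_smul_fastGen (s : ℝ) :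
    NormedSpace.exp (s • σ.fastGen) = ofBlocks 1 0 0 (NormedSpace.exp (s • σ.D)) := by
  rw [fastGen, ofBlocks_smul, smul_zero, smul_zero, smul_zero, exp_ofBlocks, NormedSpace.exp_zero]

theorem exp_smul_slowGen_add_fastGen (s r : ℝ) :
    NormedSpace.exp (s • (σ.slowGen + r • σ.fastGen)) =
      ofBlocks (NormedSpace.exp (s • σ.M)) 0 0 (NormedSpace.exp ((s * r) • σ.D)) := by
  rw [slowGen, fastGen, ofBlocks_smul, ofBlocks_add, ofBlocks_smul, ← exp_ofBlocks]
  simp [smul_smul]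

theorem slowProj_mul_ofBlocks (X : Matrix (Slow d σ.ell) (Slow d σ.ell) ℝ)
    (Y : Matrix (Fast d σ.ell) (Fast d σ.ell) ℝ) :
    σ.slowProj * ofBlocks X 0 0 Y = ofBlocks X 0 0 0 := by
  rw [slowProj, ofBlocks_mul]; simp

theorem one_sub_slowProj_mul_ofBlocks (X : Matrix (Slow d σ.ell) (Slow d σ.ell) ℝ)
    (Y : Matrix (Fast d σ.ell) (Fast d σ.ell) ℝ) :
    (1 - σ.slowProj) * ofBlocks X 0 0 Y = ofBlocks 0 0 0 Y := by
  rw [one_sub_slowProj, ofBlocks_mul]; simp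

theorem P_mul_inv : σ.P * σ.P⁻¹ = 1 := by
  rw [← Matrix.coe_units_inv, ← Units.val_mul, mul_inv_cancel, Units.val_one]

theorem P_inv_mul : σ.P⁻¹ * σ.P = 1 := by
  rw [← Matrix.coe_units_inv, ← Units.val_mul, inv_mul_cancel, Units.val_one]

theorem T_isUnit (σ : Mode d) : IsUnit σ.T := by
  have h1 : ofBlocks (ℓ := σ.ell) 1 0 (σ.D⁻¹ * σ.C) 1 * ofBlocks 1 0 (-(σ.D⁻¹ * σ.C)) 1 = 1 := by
    rw [ofBlocks_mul]; simp [ofBlocks_one_zero_zero_one]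
  have h2 : σ.T * (σ.P⁻¹ * ofBlocks 1 0 (-(σ.D⁻¹ * σ.C)) 1) = 1 := by
    rw [T, mul_assoc, ← mul_assoc σ.P, P_mul_inv, one_mul, h1]
  exact IsUnit.of_mul_eq_one _ h2

theorem T_mul_inv (σ : Mode d) : σ.T * σ.T⁻¹ = 1 :=
  Matrix.mul_nonsing_inv _ ((Matrix.isUnit_iff_isUnit_det _).1 σ.T_isUnit)

theorem T_inv_mul (σ : Mode d) : σ.T⁻¹ * σ.T = 1 :=
  Matrix.nonsing_inv_mul _ ((Matrix.isUnit_iff_isUnit_det _).1 σ.T_isUnit)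

theorem E_eq (ε : ℝ) : σ.E ε = ofBlocks (ℓ := σ.ell) 1 0 0 (ε • 1) := by
  ext i j
  simp only [E, ofBlocks, Matrix.reindex_apply, Matrix.submatrix_apply, Matrix.diagonal_apply]
  by_cases hi : (i : ℕ) < σ.ell
  · rw [Equiv.sumCompl_symm_apply_of_pos (p := fun i : Fin d => (i : ℕ) < σ.ell) hi]
    by_cases hj : (j : ℕ) < σ.ell
    · rw [Equiv.sumCompl_symm_apply_of_pos (p := fun i : Fin d => (i : ℕ) < σ.ell) hj]
      simp only [hi, if_true, Matrix.fromBlocks_apply₁₁, Matrix.one_apply, Subtype.mk.injEq]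
    · rw [Equiv.sumCompl_symm_apply_of_neg (p := fun i : Fin d => (i : ℕ) < σ.ell) hj]
      have : i ≠ j := fun h => hj (h ▸ hi)
      simp [this]
  · rw [Equiv.sumCompl_symm_apply_of_neg (p := fun i : Fin d => (i : ℕ) < σ.ell) hi]
    by_cases hj : (j : ℕ) < σ.ell
    · rw [Equiv.sumCompl_symm_apply_of_pos (p := fun i : Fin d => (i : ℕ) < σ.ell) hj]
      have : i ≠ j := fun h => hi (h ▸ hj)
      simp [this]
    · rw [Equiv.sumCompl_symm_apply_of_neg (p := fun i : Fin d => (i : ℕ) < σ.ell) hj]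
      simp only [hi, if_false, Matrix.fromBlocks_apply₂₂, Matrix.one_apply, Matrix.smul_apply,
        Subtype.mk.injEq, smul_eq_mul, mul_ite, mul_one, mul_zero]

/-- If `P X` has components `x` and `y`, then `T X` has components `x` and `z = y + D⁻¹ C x`. Since
`C x + D y = D z`, the only term of size `1 / ε` is `D z / ε`. -/
theorem T_mul_perturbedGen (hD : IsHurwitz σ.D) {ε : ℝ} (hε : ε ≠ 0) :
    σ.T * σ.perturbedGen ε = (σ.slowGen + ε⁻¹ • σ.fastGen + σ.coupling) * σ.T := by
  have hDD : σ.D * σ.D⁻¹ = 1 := Matrix.mul_nonsing_inv _ hD.isUnit_det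
  have hE : (σ.E ε)⁻¹ = ofBlocks (ℓ := σ.ell) 1 0 0 (ε⁻¹ • 1) := by
    refine Matrix.inv_eq_right_inv ?_
    rw [E_eq, ofBlocks_mul]
    simp [smul_smul, inv_mul_cancel₀ hε, ofBlocks_one_zero_zero_one]
  have hL : σ.Lam = ofBlocks σ.A σ.B σ.C σ.D * σ.P := by
    have : ofBlocks σ.A σ.B σ.C σ.D = σ.Lam * σ.P⁻¹ := ofBlocks_toBlock _ _
    rw [this, mul_assoc, P_inv_mul, mul_one]
  have h1 : σ.T * σ.perturbedGen ε = ofBlocks 1 0 (σ.D⁻¹ * σ.C) 1 *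
      (ofBlocks (ℓ := σ.ell) 1 0 0 (ε⁻¹ • 1) * ofBlocks σ.A σ.B σ.C σ.D) * σ.P := by
    rw [perturbedGen, Matrix.mul_inv_rev, hE, hL, T]
    calc _ = ofBlocks 1 0 (σ.D⁻¹ * σ.C) 1 * (σ.P * σ.P⁻¹) *
          (ofBlocks (ℓ := σ.ell) 1 0 0 (ε⁻¹ • 1) * ofBlocks σ.A σ.B σ.C σ.D) * σ.P := by
            simp only [mul_assoc]
      _ = _ := by rw [P_mul_inv, mul_one]
  rw [h1, T, ← mul_assoc (_ + _)]
  congr 1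
  rw [slowGen, fastGen, coupling, ofBlocks_smul, ofBlocks_add, ofBlocks_add, ofBlocks_mul,
    ofBlocks_mul, ofBlocks_mul, M]
  congr 1
  · simp [Matrix.mul_assoc]
  · simp
  · simp only [Matrix.mul_assoc, Matrix.mul_sub, Matrix.add_mul, Matrix.smul_mul, Matrix.mul_one,
      Matrix.one_mul, Matrix.zero_mul, zero_add, add_zero, smul_zero, ← Matrix.mul_assoc σ.D, hDD]
    abel
  · simp [Matrix.mul_assoc, add_comm]

theorem exp_smul_perturbedGen (hD : IsHurwitz σ.D) {ε : ℝ} (hε : ε ≠ 0) (s : ℝ) :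
    NormedSpace.exp (s • σ.perturbedGen ε) =
      σ.T⁻¹ * NormedSpace.exp (s • (σ.slowGen + ε⁻¹ • σ.fastGen + σ.coupling)) * σ.T := by
  rw [← Matrix.exp_conj' _ _ σ.T_isUnit]
  congr 1
  rw [mul_smul_comm, smul_mul_assoc, mul_assoc, ← T_mul_perturbedGen hD hε, ← mul_assoc, T_inv_mul,
    one_mul]

/-! #### Continuity with respect to the mode -/

theorem continuous_slowProj : Continuous (slowProj : Mode d → Matrix (Fin d) (Fin d) ℝ) := by
  have : (slowProj : Mode d → Matrix (Fin d) (Fin d) ℝ) =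
      (fun ℓ : Set.Icc 1 (d - 1) => (ofBlocks (ℓ := (ℓ : ℕ)) 1 0 0 0 : Matrix (Fin d) (Fin d) ℝ)) ∘
        Prod.fst := rfl
  rw [this]
  exact continuous_of_discreteTopology.comp continuous_fst

theorem continuous_P : Continuous (P : Mode d → Matrix (Fin d) (Fin d) ℝ) :=
  Units.continuous_val.comp (continuous_fst.comp continuous_snd)

theorem continuous_R : Continuous (R : Mode d → Matrix (Fin d) (Fin d) ℝ) :=
  continuous_snd.comp (continuous_snd.comp continuous_snd)

theorem continuous_Lam_mul_P_inv :
    Continuous fun σ : Mode d => σ.Lam * σ.P⁻¹ := by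
  have h1 : Continuous fun σ : Mode d => σ.Lam :=
    continuous_fst.comp (continuous_snd.comp continuous_snd)
  have h2 : Continuous fun σ : Mode d => σ.P⁻¹ := by
    have : (fun σ : Mode d => σ.P⁻¹) = fun σ : Mode d => ((σ.2.1⁻¹ : GL (Fin d) ℝ) :
      Matrix (Fin d) (Fin d) ℝ) := funext fun σ => (Matrix.coe_units_inv _).symm
    rw [this]
    exact Units.continuous_val.comp (continuous_inv.comp (continuous_fst.comp continuous_snd))
  exact h1.mul h2

/-- Block sizes depend on the mode, so continuity is obtained from expressions in `d × d` matrices: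
the slow projection, locally constant in the mode, and `Λ P⁻¹`. -/
theorem fastGen_eq : σ.fastGen = (1 - σ.slowProj) * (σ.Lam * σ.P⁻¹) * (1 - σ.slowProj) := by
  have : σ.Lam * σ.P⁻¹ = ofBlocks σ.A σ.B σ.C σ.D := (ofBlocks_toBlock _ _).symm
  rw [this, one_sub_slowProj, ofBlocks_mul, ofBlocks_mul, fastGen]
  simp

/-- Filling the slow block with the identity makes `D⁻¹` a block of the inverse of a `d × d` matrix
that is continuous in the mode. -/
theorem ofBlocks_D_inv_C_eq (hD : IsHurwitz σ.D) : ofBlocks (ℓ := σ.ell) 0 0 (σ.D⁻¹ * σ.C) 0 =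
    (1 - σ.slowProj) * (σ.slowProj + σ.fastGen)⁻¹ * (1 - σ.slowProj) * (σ.Lam * σ.P⁻¹) *
      σ.slowProj := by
  have hDD : σ.D * σ.D⁻¹ = 1 := Matrix.mul_nonsing_inv _ hD.isUnit_det
  have h1 : σ.Lam * σ.P⁻¹ = ofBlocks σ.A σ.B σ.C σ.D := (ofBlocks_toBlock _ _).symm
  have h2 : (σ.slowProj + σ.fastGen)⁻¹ = ofBlocks (ℓ := σ.ell) 1 0 0 σ.D⁻¹ := by
    refine Matrix.inv_eq_right_inv ?_
    rw [slowProj, fastGen, ofBlocks_add, ofBlocks_mul]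
    simp [hDD, ofBlocks_one_zero_zero_one]
  rw [h1, h2, one_sub_slowProj, slowProj, ofBlocks_mul, ofBlocks_mul, ofBlocks_mul, ofBlocks_mul]
  simp

theorem isUnit_slowProj_add_fastGen (hD : IsHurwitz σ.D) : IsUnit (σ.slowProj + σ.fastGen) := by
  have hDD : σ.D * σ.D⁻¹ = 1 := Matrix.mul_nonsing_inv _ hD.isUnit_det
  refine IsUnit.of_mul_eq_one (ofBlocks (ℓ := σ.ell) 1 0 0 σ.D⁻¹) ?_
  rw [slowProj, fastGen, ofBlocks_add, ofBlocks_mul]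
  simp [hDD, ofBlocks_one_zero_zero_one]

theorem slowGen_eq : σ.slowGen = σ.slowProj * (σ.Lam * σ.P⁻¹) * σ.slowProj -
    σ.slowProj * (σ.Lam * σ.P⁻¹) * ofBlocks (ℓ := σ.ell) 0 0 (σ.D⁻¹ * σ.C) 0 := by
  have h1 : σ.Lam * σ.P⁻¹ = ofBlocks σ.A σ.B σ.C σ.D := (ofBlocks_toBlock _ _).symm
  rw [eq_sub_iff_add_eq, h1, slowProj, slowGen, M]
  simp only [ofBlocks_mul, ofBlocks_add]
  simp [Matrix.mul_assoc]

theorem coupling_eq : σ.coupling = σ.slowProj * (σ.Lam * σ.P⁻¹) * (1 - σ.slowProj) +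
    ofBlocks (ℓ := σ.ell) 0 0 (σ.D⁻¹ * σ.C) 0 * σ.slowGen +
    ofBlocks (ℓ := σ.ell) 0 0 (σ.D⁻¹ * σ.C) 0 * (σ.Lam * σ.P⁻¹) * (1 - σ.slowProj) := by
  have h1 : σ.Lam * σ.P⁻¹ = ofBlocks σ.A σ.B σ.C σ.D := (ofBlocks_toBlock _ _).symm
  rw [h1, one_sub_slowProj, slowProj, slowGen, coupling]
  simp only [ofBlocks_mul, ofBlocks_add]
  simp

theorem T_eq : σ.T = (1 + ofBlocks (ℓ := σ.ell) 0 0 (σ.D⁻¹ * σ.C) 0) * σ.P := by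
  rw [T, ← ofBlocks_one_zero_zero_one σ.ell, ofBlocks_add]
  simp

end Mode

theorem continuousOn_matrix_inv {X : Type*} [TopologicalSpace X] {K : Set X} {n : Type*} [Fintype n]
    [DecidableEq n] {f : X → Matrix n n ℝ} (hf : ContinuousOn f K) (hu : ∀ x ∈ K, IsUnit (f x)) :
    ContinuousOn (fun x => (f x)⁻¹) K := by
  have h : (fun x => (f x)⁻¹) = fun x => (f x).det⁻¹ • (f x).adjugate := by
    funext x
    rw [Matrix.inv_def, Ring.inverse_eq_inv']
  rw [h]
  have hdet : ContinuousOn (fun x => (f x).det) K :=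
    (Continuous.matrix_det continuous_id).comp_continuousOn hf
  have hadj : ContinuousOn (fun x => (f x).adjugate) K :=
    (Continuous.matrix_adjugate continuous_id).comp_continuousOn hf
  exact (hdet.inv₀ fun x hx => ((Matrix.isUnit_iff_isUnit_det _).1 (hu x hx)).ne_zero).smul hadj

section Continuity

variable {d : ℕ} {K : Set (Mode d)}

theorem continuous_fastGen :
    Continuous (Mode.fastGen : Mode d → Matrix (Fin d) (Fin d) ℝ) := by
  rw [show (Mode.fastGen : Mode d → Matrix (Fin d) (Fin d) ℝ) = _ from
    funext fun σ => Mode.fastGen_eq]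
  have h1 := continuous_const (y := (1 : Matrix (Fin d) (Fin d) ℝ)).sub
    (Mode.continuous_slowProj (d := d))
  exact (h1.mul Mode.continuous_Lam_mul_P_inv).mul h1

theorem DHurwitz.continuousOn_D_inv_C (hD : DHurwitz K) :
    ContinuousOn (fun σ : Mode d => ofBlocks (ℓ := σ.ell) 0 0 (σ.D⁻¹ * σ.C) 0) K := by
  have h1 := continuous_const (y := (1 : Matrix (Fin d) (Fin d) ℝ)).sub
    (Mode.continuous_slowProj (d := d))
  have h2 : ContinuousOn (fun σ : Mode d => (σ.slowProj + σ.fastGen)⁻¹) K :=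
    continuousOn_matrix_inv (Mode.continuous_slowProj.add continuous_fastGen).continuousOn
      fun σ hσ => Mode.isUnit_slowProj_add_fastGen (hD σ hσ)
  refine ContinuousOn.congr ?_ fun σ hσ => Mode.ofBlocks_D_inv_C_eq (hD σ hσ)
  exact (((h1.continuousOn.mul h2).mul h1.continuousOn).mul
    Mode.continuous_Lam_mul_P_inv.continuousOn).mul Mode.continuous_slowProj.continuousOn

theorem DHurwitz.continuousOn_slowGen (hD : DHurwitz K) :
    ContinuousOn (Mode.slowGen : Mode d → Matrix (Fin d) (Fin d) ℝ) K := by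
  refine ContinuousOn.congr ?_ fun σ _ => Mode.slowGen_eq
  have h1 := (Mode.continuous_slowProj (d := d)).mul Mode.continuous_Lam_mul_P_inv
  exact (h1.mul Mode.continuous_slowProj).continuousOn.sub
    (h1.continuousOn.mul hD.continuousOn_D_inv_C)

theorem DHurwitz.continuousOn_coupling (hD : DHurwitz K) :
    ContinuousOn (Mode.coupling : Mode d → Matrix (Fin d) (Fin d) ℝ) K := by
  refine ContinuousOn.congr ?_ fun σ _ => Mode.coupling_eq
  have h1 := continuous_const (y := (1 : Matrix (Fin d) (Fin d) ℝ)).sub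
    (Mode.continuous_slowProj (d := d))
  exact (((Mode.continuous_slowProj.mul Mode.continuous_Lam_mul_P_inv).mul h1).continuousOn.add
    (hD.continuousOn_D_inv_C.mul hD.continuousOn_slowGen)).add
    ((hD.continuousOn_D_inv_C.mul Mode.continuous_Lam_mul_P_inv.continuousOn).mul h1.continuousOn)

theorem DHurwitz.continuousOn_T (hD : DHurwitz K) :
    ContinuousOn (Mode.T : Mode d → Matrix (Fin d) (Fin d) ℝ) K := by
  refine ContinuousOn.congr ?_ fun σ _ => Mode.T_eq
  exact (continuousOn_const.add hD.continuousOn_D_inv_C).mul Mode.continuous_P.continuousOn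

theorem DHurwitz.continuousOn_T_inv (hD : DHurwitz K) :
    ContinuousOn (fun σ : Mode d => σ.T⁻¹) K :=
  continuousOn_matrix_inv hD.continuousOn_T fun σ _ => σ.T_isUnit

theorem DHurwitz.exists_bound (hK : IsCompact K) (hD : DHurwitz K) : ∃ b : ℝ, 1 ≤ b ∧
    ∀ σ ∈ K, ‖σ.T‖ ≤ b ∧ ‖σ.T⁻¹‖ ≤ b ∧ ‖σ.R‖ ≤ b ∧ ‖σ.coupling‖ ≤ b := by
  obtain ⟨b₁, h₁⟩ := hK.exists_bound_of_continuousOn hD.continuousOn_T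
  obtain ⟨b₂, h₂⟩ := hK.exists_bound_of_continuousOn hD.continuousOn_T_inv
  obtain ⟨b₃, h₃⟩ := hK.exists_bound_of_continuousOn (Mode.continuous_R (d := d)).continuousOn
  obtain ⟨b₄, h₄⟩ := hK.exists_bound_of_continuousOn hD.continuousOn_coupling
  refine ⟨max 1 (max (max b₁ b₂) (max b₃ b₄)), le_max_left _ _, fun σ hσ => ⟨?_, ?_, ?_, ?_⟩⟩
  · exact (h₁ σ hσ).trans (by simp)
  · exact (h₂ σ hσ).trans (by simp)
  · exact (h₃ σ hσ).trans (by simp)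
  · exact (h₄ σ hσ).trans (by simp)

theorem DHurwitz.exists_fast_decay (hK : IsCompact K) (hD : DHurwitz K) :
    ∃ C > 0, ∃ α > 0, ∀ σ ∈ K, ∀ s : ℝ, 0 ≤ s →
      ‖ofBlocks (ℓ := σ.ell) 0 0 0 (NormedSpace.exp (s • σ.D))‖ ≤ C * Real.exp (-α * s) := by
  have heq : ∀ (σ : Mode d) (s : ℝ), (1 - σ.slowProj) * NormedSpace.exp (s • σ.fastGen) =
      ofBlocks (ℓ := σ.ell) 0 0 0 (NormedSpace.exp (s • σ.D)) := fun σ s => by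
    rw [Mode.exp_smul_fastGen, Mode.one_sub_slowProj_mul_ofBlocks]
  simp_rw [← heq]
  refine exists_uniform_exp_smul_decay hK
    (continuous_const.sub Mode.continuous_slowProj).continuousOn continuous_fastGen.continuousOn
    (fun σ _ => ?_) (fun σ _ => ?_) fun σ hσ => ?_
  · rw [Mode.one_sub_slowProj, ofBlocks_mul]; simp
  · exact (Commute.one_left _).sub_left Mode.slowProj_commute_fastGen
  · have h1 : Continuous fun X : Matrix (Fast d σ.ell) (Fast d σ.ell) ℝ =>
        (ofBlocks 0 0 0 X : Matrix (Fin d) (Fin d) ℝ) :=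
      continuous_ofBlocks_diag.comp (continuous_const.prodMk continuous_id)
    have h2 := ((h1.tendsto 0).comp (hD σ hσ).tendsto_exp_nsmul).norm
    have h3 : ‖(ofBlocks 0 0 0 (0 : Matrix (Fast d σ.ell) (Fast d σ.ell) ℝ) :
        Matrix (Fin d) (Fin d) ℝ)‖ = 0 := by simp [ofBlocks]
    rw [h3] at h2
    obtain ⟨k, hk, hk1⟩ := ((h2.eventually_lt_const one_pos).and (eventually_ge_atTop 1)).exists
    refine ⟨k, by exact_mod_cast hk1, ?_⟩
    rw [heq]
    exact hk

end Continuity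

end SwitchedSystem

end

noncomputable section

namespace SwitchedSystem

open scoped Matrix.Norms.L2Operator

/-! ### The flow of one mode -/

section ModeFlow

variable {d : ℕ} {K : Set (Mode d)}

/-- The flow of the reduced system of a mode, in the original coordinates. -/
def Mode.reducedFlow (σ : Mode d) (s : ℝ) : Matrix (Fin d) (Fin d) ℝ :=
  σ.T⁻¹ * ofBlocks (NormedSpace.exp (s • σ.M)) 0 0 0 * σ.T

/-- The flow of the boundary layer of a mode, in the original coordinates. -/
def Mode.layerFlow (σ : Mode d) (s : ℝ) : Matrix (Fin d) (Fin d) ℝ :=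
  σ.T⁻¹ * ofBlocks 0 0 0 (NormedSpace.exp (s • σ.D)) * σ.T

theorem norm_mul_mul_le {l m n o : Type*} [Fintype l] [Fintype m] [Fintype n] [Fintype o]
    [DecidableEq m] [DecidableEq n] [DecidableEq o] {a c : ℝ} {A : Matrix l m ℝ}
    {B : Matrix m n ℝ} {C : Matrix n o ℝ} (hA : ‖A‖ ≤ a) (hC : ‖C‖ ≤ c) :
    ‖A * B * C‖ ≤ a * c * ‖B‖ := by
  have ha := (norm_nonneg _).trans hA
  calc ‖A * B * C‖ ≤ ‖A‖ * ‖B‖ * ‖C‖ :=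
        (Matrix.l2_opNorm_mul _ _).trans
          (mul_le_mul_of_nonneg_right (Matrix.l2_opNorm_mul _ _) (norm_nonneg _))
    _ ≤ a * ‖B‖ * c := by gcongr
    _ = _ := by ring

theorem DHurwitz.exists_layer_decay (hK : IsCompact K) (hD : DHurwitz K) :
    ∃ C > 0, ∃ α > 0, ∀ σ ∈ K, ∀ s : ℝ, 0 ≤ s → ‖σ.layerFlow s‖ ≤ C * Real.exp (-α * s) := by
  obtain ⟨b, hb, hbK⟩ := hD.exists_bound hK
  obtain ⟨C, hC, α, hα, h⟩ := hD.exists_fast_decay hK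
  refine ⟨b * b * C, by positivity, α, hα, fun σ hσ s hs => ?_⟩
  obtain ⟨h1, h2, -, -⟩ := hbK σ hσ
  refine (norm_mul_mul_le h2 h1).trans ?_
  rw [mul_assoc (b * b)]
  exact mul_le_mul_of_nonneg_left (h σ hσ s hs) (by positivity)

theorem Mode.conj_exp_smul_eq (σ : Mode d) (s ε : ℝ) :
    σ.T⁻¹ * NormedSpace.exp (s • (σ.slowGen + ε⁻¹ • σ.fastGen)) * σ.T =
      σ.reducedFlow s + σ.layerFlow (s / ε) := by
  rw [Mode.exp_smul_slowGen_add_fastGen, reducedFlow, layerFlow, ← add_mul, ← mul_add,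
    ofBlocks_add]
  simp [div_eq_mul_inv]

/-- Uniform approximation of the flow of a singularly perturbed mode by the sum of the flow of the
reduced system and of a boundary layer. -/
theorem DHurwitz.exists_two_time_scale_estimate (hK : IsCompact K) (hD : DHurwitz K) {C μ ν : ℝ}
    (hμν : μ < ν) (hM : ∀ σ ∈ K, ∀ s : ℝ, 0 ≤ s → ‖σ.reducedFlow s‖ ≤ C * Real.exp (μ * s)) :
    ∃ c > 0, ∃ ε₀ > 0, ∀ σ ∈ K, ∀ ε, 0 < ε → ε ≤ ε₀ → ∀ s : ℝ, 0 ≤ s →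
      ‖NormedSpace.exp (s • σ.perturbedGen ε) - (σ.reducedFlow s + σ.layerFlow (s / ε))‖ ≤
        c * ε * Real.exp (ν * s) ∧
      ‖NormedSpace.exp (s • σ.perturbedGen ε) - (σ.reducedFlow s + σ.layerFlow (s / ε))‖ ≤
        c * s * Real.exp (ν * s) ∧
      ‖NormedSpace.exp (s • σ.perturbedGen ε)‖ ≤ c * Real.exp (ν * s) := by
  obtain ⟨b, hb, hbK⟩ := hD.exists_bound hK
  obtain ⟨C₁, hC₁, α, hα, hfast⟩ := hD.exists_fast_decay hK
  -- With `δ = ν - μ`, the slow rate `ν - δ` is the given `μ`; the factor `b * b` is the cost of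
  -- conjugating by `T`.
  obtain ⟨c, hc, ε₀, hε₀, H⟩ := exists_slow_fast_estimate (𝔸 := Matrix (Fin d) (Fin d) ℝ)
    (C := max (b * b * C) C₁) (ν := ν) (δ := ν - μ) (α := α) (q := b) (lt_max_of_lt_right hC₁)
    (by linarith) hα (by linarith)
  refine ⟨b * b * c, by positivity, ε₀, hε₀, fun σ hσ ε hε hεε₀ s hs => ?_⟩
  obtain ⟨hT, hT', -, hQ⟩ := hbK σ hσ
  have hbb : 0 ≤ b * b := by positivity
  obtain ⟨h1, h2, h3⟩ := H σ.slowProj (σ.slowGen + ε⁻¹ • σ.fastGen) σ.coupling ε hε hεε₀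
    Mode.slowProj_mul_self
    (Mode.slowProj_commute_slowGen.add_right (Mode.slowProj_commute_fastGen.smul_right _))
    Mode.slowProj_mul_coupling_mul hQ (by
      intro r hr
      rw [Mode.exp_smul_slowGen_add_fastGen, Mode.slowProj_mul_ofBlocks]
      have h4 : (ofBlocks (NormedSpace.exp (r • σ.M)) 0 0 0 : Matrix (Fin d) (Fin d) ℝ) =
          σ.T * σ.reducedFlow r * σ.T⁻¹ := by
        rw [Mode.reducedFlow, mul_assoc, mul_assoc _ σ.T, σ.T_mul_inv, mul_one, ← mul_assoc,
          σ.T_mul_inv, one_mul]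
      rw [h4, sub_sub_cancel]
      calc _ ≤ b * b * ‖σ.reducedFlow r‖ := norm_mul_mul_le hT hT'
        _ ≤ b * b * (C * Real.exp (μ * r)) := mul_le_mul_of_nonneg_left (hM σ hσ r hr) hbb
        _ = b * b * C * Real.exp (μ * r) := by ring
        _ ≤ _ := mul_le_mul_of_nonneg_right (le_max_left _ _) (Real.exp_pos _).le) (by
      intro r hr
      rw [Mode.exp_smul_slowGen_add_fastGen, Mode.one_sub_slowProj_mul_ofBlocks]
      refine (hfast σ hσ (r * ε⁻¹) (by positivity)).trans ?_
      rw [show -α * (r * ε⁻¹) = -(α / ε) * r by ring]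
      exact mul_le_mul_of_nonneg_right (le_max_right _ _) (Real.exp_pos _).le) s hs
  rw [← σ.conj_exp_smul_eq s ε, Mode.exp_smul_perturbedGen (hD σ hσ) hε.ne', ← sub_mul, ← mul_sub]
  refine ⟨?_, ?_, ?_⟩
  · refine (norm_mul_mul_le hT' hT).trans ((mul_le_mul_of_nonneg_left h1 hbb).trans ?_)
    exact le_of_eq (by ring)
  · refine (norm_mul_mul_le hT' hT).trans ((mul_le_mul_of_nonneg_left h2 hbb).trans ?_)
    exact le_of_eq (by ring)
  · refine (norm_mul_mul_le hT' hT).trans ((mul_le_mul_of_nonneg_left h3 hbb).trans ?_)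
    exact le_of_eq (by ring)

end ModeFlow

/-! ### Signals and words -/

section Words

variable {d : ℕ} {K : Set (Mode d)} {τ : ℝ}

/-- A finite sequence of modes with their durations, the last one coming first. -/
abbrev Word (d : ℕ) : Type := List (Mode d × ℝ)

namespace Word

/-- The product of the matrices attached to the letters of a word. -/
def prod (g : Mode d → ℝ → Matrix (Fin d) (Fin d) ℝ) (L : Word d) : Matrix (Fin d) (Fin d) ℝ :=
  (L.map fun p => g p.1 p.2).prod

/-- The total duration of a word. -/
def time (L : Word d) : ℝ := (L.map Prod.snd).sum

/-- The words of the signals with values in `K` and dwell time `τ`. -/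
def Admissible (K : Set (Mode d)) (τ : ℝ) (L : Word d) : Prop :=
  ∀ p ∈ L, p.1 ∈ K ∧ 0 < p.2 ∧ τ ≤ p.2

variable {g : Mode d → ℝ → Matrix (Fin d) (Fin d) ℝ}

@[simp] theorem prod_nil : prod g [] = 1 := rfl

@[simp] theorem prod_cons (p : Mode d × ℝ) (L : Word d) :
    prod g (p :: L) = g p.1 p.2 * prod g L := by simp [prod]

theorem prod_append (L L' : Word d) : prod g (L ++ L') = prod g L * prod g L' := by
  simp [prod]

@[simp] theorem time_nil : time ([] : Word d) = 0 := rfl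

@[simp] theorem time_cons (p : Mode d × ℝ) (L : Word d) : time (p :: L) = p.2 + time L := by
  simp [time]

theorem time_append (L L' : Word d) : time (L ++ L') = time L + time L' := by simp [time]

theorem Admissible.nil : Admissible K τ [] := by simp [Admissible]

theorem admissible_cons {p : Mode d × ℝ} {L : Word d} :
    Admissible K τ (p :: L) ↔ (p.1 ∈ K ∧ 0 < p.2 ∧ τ ≤ p.2) ∧ Admissible K τ L := by
  simp [Admissible]

theorem admissible_append {L L' : Word d} :
    Admissible K τ (L ++ L') ↔ Admissible K τ L ∧ Admissible K τ L' :=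
  List.forall_mem_append

theorem Admissible.time_nonneg {L : Word d} (hL : Admissible K τ L) : 0 ≤ L.time :=
  List.sum_nonneg fun x hx => by
    obtain ⟨p, hp, rfl⟩ := List.mem_map.1 hx
    exact (hL p hp).2.1.le

theorem Admissible.length_mul_le_time {L : Word d} (hL : Admissible K τ L) :
    L.length * τ ≤ L.time := by
  induction L with
  | nil => simp
  | cons p L ih =>
    rw [admissible_cons] at hL
    have := ih hL.2
    rw [time_cons, List.length_cons]
    push_cast
    linarith [hL.1.2.2]

end Word

namespace Signal

/-- The word of a signal up to its `k`-th switching time. -/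
def word (σ : Signal K τ) : ℕ → Word d
  | 0 => []
  | k + 1 => (σ.mode k, σ.time (k + 1) - σ.time k) :: σ.word k

theorem word_admissible (σ : Signal K τ) {k : ℕ} (hk : (k : ℕ∞) ≤ σ.count) :
    Word.Admissible K τ (σ.word k) := by
  induction k with
  | zero => exact Word.Admissible.nil
  | succ k ih =>
    have hk' : (k : ℕ∞) ≤ σ.count := le_trans (by exact_mod_cast k.le_succ) hk
    refine Word.admissible_cons.2 ⟨⟨σ.mode_mem k hk', ?_, ?_⟩, ih hk'⟩
    · exact sub_pos.2 (σ.time_lt k hk)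
    · have := σ.dwell k hk
      change τ ≤ σ.time (k + 1) - σ.time k
      linarith

theorem time_word (σ : Signal K τ) (k : ℕ) : (σ.word k).time = σ.time k := by
  induction k with
  | zero => exact σ.time_zero.symm
  | succ k ih => rw [word, Word.time_cons, ih]; simp

end Signal

/-- The signal that follows a word, and keeps its last mode forever. -/
def Word.signal {L : Word d} (hL : Word.Admissible K τ L) {p : Mode d} (hp : p ∈ K) :
    Signal K τ where
  count := L.length
  -- The list is in reverse chronological order: its last `k` letters are the first `k` intervals,
  -- and the letter of interval `k` sits at position `L.length - 1 - k`.
  time k := Word.time (L.drop (L.length - k))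
  mode k := if h : k < L.length then (L[L.length - 1 - k]).1 else p
  time_zero := by simp
  time_lt k hk := by
    have hk' : k + 1 ≤ L.length := by exact_mod_cast hk
    have h1 : L.length - (k + 1) < L.length := by omega
    have h2 : L.length - (k + 1) + 1 = L.length - k := by omega
    rw [List.drop_eq_getElem_cons h1, h2, Word.time_cons]
    linarith [(hL _ (List.getElem_mem h1)).2.1]
  dwell k hk := by
    have hk' : k + 1 ≤ L.length := by exact_mod_cast hk
    have h1 : L.length - (k + 1) < L.length := by omega
    have h2 : L.length - (k + 1) + 1 = L.length - k := by omega
    rw [List.drop_eq_getElem_cons h1, h2, Word.time_cons]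
    linarith [(hL _ (List.getElem_mem h1)).2.2]
  locally_finite h := absurd h (ENat.natCast_ne_top _)
  mode_mem k hk := by
    split_ifs with h
    · exact (hL _ (List.getElem_mem _)).1
    · exact hp

section

variable {L : Word d} (hL : Word.Admissible K τ L) {p : Mode d} (hp : p ∈ K)

theorem Word.word_signal {k : ℕ} (hk : k ≤ L.length) :
    (Word.signal hL hp).word k = L.drop (L.length - k) := by
  induction k with
  | zero => simp [Signal.word]
  | succ k ih =>
    have h1 : L.length - (k + 1) < L.length := by omega
    have h2 : L.length - (k + 1) + 1 = L.length - k := by omega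
    have h3 : L.length - 1 - k = L.length - (k + 1) := by omega
    rw [Signal.word, ih (by omega), List.drop_eq_getElem_cons h1, h2]
    congr 1
    refine Prod.ext ?_ ?_
    · change (if h : k < L.length then (L[L.length - 1 - k]).1 else p) = _
      rw [dif_pos (by omega)]
      simp only [h3]
    · change Word.time (L.drop (L.length - (k + 1))) - Word.time (L.drop (L.length - k)) = _
      rw [List.drop_eq_getElem_cons h1, h2, Word.time_cons]
      ring

theorem Word.word_signal_length : (Word.signal hL hp).word L.length = L := by
  rw [Word.word_signal hL hp le_rfl]; simp

theorem Word.time_signal_length : (Word.signal hL hp).time L.length = L.time := by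
  rw [← Signal.time_word, Word.word_signal_length]

theorem Word.mode_signal_length : (Word.signal hL hp).mode L.length = p :=
  dif_neg (lt_irrefl _)

theorem Word.index_signal {t : ℝ} (ht : L.time ≤ t) :
    (Word.signal hL hp).index t = L.length := by
  refine (Word.signal hL hp).index_eq le_rfl ((Word.time_signal_length hL hp).trans_le ht) ?_
  intro h
  have h2 : L.length + 1 ≤ L.length := by exact_mod_cast (show _ ≤ ((L.length : ℕ) : ℕ∞) from h)
  omega

end

end Words

end SwitchedSystem

end

noncomputable section

namespace SwitchedSystem

open scoped Matrix.Norms.L2Operator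

/-! ### The flows of the four systems as products along words -/

section Flows

variable {d : ℕ} {K : Set (Mode d)} {τ : ℝ}

/-- The flow of a singularly perturbed mode, followed by its jump. -/
def Mode.perturbedStep (ε : ℝ) (σ : Mode d) (s : ℝ) : Matrix (Fin d) (Fin d) ℝ :=
  σ.R * NormedSpace.exp (s • σ.perturbedGen ε)

/-- The flow of the reduced system of a mode, followed by its jump. -/
def Mode.reducedStep (σ : Mode d) (s : ℝ) : Matrix (Fin d) (Fin d) ℝ :=
  σ.R * σ.reducedFlow s

theorem perturbed_eq_of_index_eq (ε : ℝ) (σ : Signal K τ) {t : ℝ} {k : ℕ} (hk : σ.index t = k) :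
    perturbed K τ ε σ t = ‖NormedSpace.exp ((t - σ.time k) • (σ.mode k).perturbedGen ε) *
      (σ.word k).prod (Mode.perturbedStep ε)‖ := by
  have htr : ∀ k, transition (n := fun _ => Fin d) σ.time (fun k => (σ.mode k).perturbedGen ε)
      (fun k => (σ.mode k).R) k = (σ.word k).prod (Mode.perturbedStep ε) := by
    intro k
    induction k with
    | zero => rfl
    | succ k ih => rw [transition, ih, Signal.word, Word.prod_cons, Mode.perturbedStep]
  subst hk
  rw [← htr]
  rfl

theorem exists_word_perturbed_eq (σ : Signal K τ) {t : ℝ} (ht : 0 ≤ t) :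
    ∃ L : Word d, L.Admissible K τ ∧ ∃ p ∈ K, ∃ s, 0 ≤ s ∧ L.time + s = t ∧
      ∀ ε, perturbed K τ ε σ t =
        ‖NormedSpace.exp (s • p.perturbedGen ε) * L.prod (Mode.perturbedStep ε)‖ := by
  obtain ⟨h1, h2, -⟩ := σ.index_spec ht
  refine ⟨σ.word (σ.index t), σ.word_admissible h1, σ.mode (σ.index t), σ.mode_mem _ h1,
    t - σ.time (σ.index t), by linarith, ?_, fun ε => perturbed_eq_of_index_eq ε σ rfl⟩
  rw [σ.time_word]; ring

theorem exists_signal_perturbed_eq {L : Word d} (hL : L.Admissible K τ) {p : Mode d} (hp : p ∈ K)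
    {s : ℝ} (hs : 0 ≤ s) : ∃ σ : Signal K τ, ∀ ε, perturbed K τ ε σ (L.time + s) =
      ‖NormedSpace.exp (s • p.perturbedGen ε) * L.prod (Mode.perturbedStep ε)‖ := by
  refine ⟨Word.signal hL hp, fun ε => ?_⟩
  rw [perturbed_eq_of_index_eq ε _ (Word.index_signal hL hp (by linarith)),
    Word.word_signal_length, Word.time_signal_length, Word.mode_signal_length,
    add_sub_cancel_left]

/-- The reduced transition is a compression, between slow subspaces, of a product along the word:
each inclusion and its transpose combine with `exp (s M)` into the reduced flow of the mode. -/
theorem reduced_transition_eq (σ : Signal K τ) (k : ℕ) :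
    transition (n := fun k => Slow d (σ.mode k).ell) σ.time (fun k => (σ.mode k).M)
      (fun k => truncate ((σ.mode (k + 1)).T * (σ.mode k).R * (σ.mode k).T⁻¹)
        (σ.mode (k + 1)).ell (σ.mode k).ell) k =
      (slowInclusion d (σ.mode k).ell).transpose * (σ.mode k).T *
        (σ.word k).prod Mode.reducedStep * (σ.mode 0).T⁻¹ * slowInclusion d (σ.mode 0).ell := by
  induction k with
  | zero =>
    rw [transition, Signal.word, Word.prod_nil, Matrix.mul_one,
      Matrix.mul_assoc _ (σ.mode 0).T, Mode.T_mul_inv, Matrix.mul_one,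
      transpose_slowInclusion_mul_self]
  | succ k ih =>
    rw [transition, ih, Signal.word, Word.prod_cons, Mode.reducedStep, Mode.reducedFlow,
      ← transpose_slowInclusion_mul_mul, ofBlocks_eq_slowInclusion_mul]
    simp only [Matrix.mul_assoc]

theorem reduced_eq_of_index_eq (σ : Signal K τ) {t : ℝ} {k : ℕ} (hk : σ.index t = k) :
    reduced K τ σ t = ‖(slowInclusion d (σ.mode k).ell).transpose * (σ.mode k).T *
        ((σ.mode k).reducedFlow (t - σ.time k) * (σ.word k).prod Mode.reducedStep) *
        (σ.mode 0).T⁻¹ * slowInclusion d (σ.mode 0).ell‖ := by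
  subst hk
  have h : σ.flow (n := fun k => Slow d (σ.mode k).ell) (fun k => (σ.mode k).M)
      (fun k => truncate ((σ.mode (k + 1)).T * (σ.mode k).R * (σ.mode k).T⁻¹)
        (σ.mode (k + 1)).ell (σ.mode k).ell) t =
      (slowInclusion d (σ.mode (σ.index t)).ell).transpose * (σ.mode (σ.index t)).T *
        ((σ.mode (σ.index t)).reducedFlow (t - σ.time (σ.index t)) *
          (σ.word (σ.index t)).prod Mode.reducedStep) *
        (σ.mode 0).T⁻¹ * slowInclusion d (σ.mode 0).ell := by
    rw [Signal.flow, reduced_transition_eq, Mode.reducedFlow, ofBlocks_eq_slowInclusion_mul]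
    simp only [Matrix.mul_assoc]
    rw [← Matrix.mul_assoc (σ.mode (σ.index t)).T (σ.mode (σ.index t)).T⁻¹, Mode.T_mul_inv,
      Matrix.one_mul, ← Matrix.mul_assoc (slowInclusion d _).transpose (slowInclusion d _),
      transpose_slowInclusion_mul_self, Matrix.one_mul]
  rw [← h]
  rfl

/-- The projection on the slow subspace of a mode, in the original coordinates. -/
def Mode.slowProjector (σ : Mode d) : Matrix (Fin d) (Fin d) ℝ :=
  σ.T⁻¹ * slowInclusion d σ.ell * ((slowInclusion d σ.ell).transpose * σ.T)

theorem Mode.slowProjector_mul_reducedFlow (σ : Mode d) (s : ℝ) :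
    σ.slowProjector * σ.reducedFlow s = σ.reducedFlow s := by
  rw [slowProjector, reducedFlow, ofBlocks_eq_slowInclusion_mul]
  simp only [Matrix.mul_assoc]
  rw [← Matrix.mul_assoc σ.T σ.T⁻¹, Mode.T_mul_inv, Matrix.one_mul,
    ← Matrix.mul_assoc (slowInclusion d _).transpose (slowInclusion d _),
    transpose_slowInclusion_mul_self, Matrix.one_mul]

theorem Mode.reducedFlow_mul_slowProjector (σ : Mode d) (s : ℝ) :
    σ.reducedFlow s * σ.slowProjector = σ.reducedFlow s := by
  rw [slowProjector, reducedFlow, ofBlocks_eq_slowInclusion_mul]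
  simp only [Matrix.mul_assoc]
  rw [← Matrix.mul_assoc σ.T σ.T⁻¹, Mode.T_mul_inv, Matrix.one_mul,
    ← Matrix.mul_assoc (slowInclusion d _).transpose (slowInclusion d _),
    transpose_slowInclusion_mul_self, Matrix.one_mul]

theorem reducedFlow_mul_prod_mul_slowProjector (σ : Signal K τ) (k : ℕ) (s : ℝ) :
    (σ.mode k).reducedFlow s * (σ.word k).prod Mode.reducedStep * (σ.mode 0).slowProjector =
      (σ.mode k).reducedFlow s * (σ.word k).prod Mode.reducedStep := by
  induction k generalizing s with
  | zero => rw [Signal.word, Word.prod_nil, mul_one, Mode.reducedFlow_mul_slowProjector]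
  | succ k ih =>
    rw [Signal.word, Word.prod_cons, Mode.reducedStep]
    simp only [mul_assoc] at ih ⊢
    rw [ih]

theorem Mode.slowProjector_mul_reducedFlow_mul (σ : Mode d) (s : ℝ)
    (X : Matrix (Fin d) (Fin d) ℝ) :
    σ.slowProjector * (σ.reducedFlow s * X) = σ.reducedFlow s * X := by
  rw [← mul_assoc, σ.slowProjector_mul_reducedFlow]

/-- A matrix fixed by the slow projectors on both sides is recovered from its compression, so
passing to slow coordinates loses no more than a constant factor. -/
theorem norm_le_of_slowProjector_mul_eq {p q : Mode d} {X : Matrix (Fin d) (Fin d) ℝ} {a b : ℝ}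
    (hp : ‖p.T⁻¹ * slowInclusion d p.ell‖ ≤ a)
    (hq : ‖(slowInclusion d q.ell).transpose * q.T‖ ≤ b)
    (hpX : p.slowProjector * X = X) (hXq : X * q.slowProjector = X) :
    ‖X‖ ≤ a * b * ‖(slowInclusion d p.ell).transpose * p.T * X * q.T⁻¹ *
      slowInclusion d q.ell‖ := by
  have h : X = p.T⁻¹ * slowInclusion d p.ell * ((slowInclusion d p.ell).transpose * p.T * X *
      q.T⁻¹ * slowInclusion d q.ell) * ((slowInclusion d q.ell).transpose * q.T) := by
    conv_lhs => rw [← hpX, ← hXq, Mode.slowProjector, Mode.slowProjector]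
    simp only [Matrix.mul_assoc]
  conv_lhs => rw [h]
  exact norm_mul_mul_le hp hq

/-- Growth of the reduced system and growth of word products are equivalent up to a constant. The
first direction serves the lower bound on the exponents, the second the upper bound. -/
theorem DHurwitz.exists_reduced_comparison (hK : IsCompact K) (hD : DHurwitz K) (τ : ℝ) :
    ∃ b : ℝ, 0 < b ∧
      (∀ (σ : Signal K τ) (t : ℝ), 0 ≤ t → ∃ L : Word d, L.Admissible K τ ∧ ∃ p ∈ K, ∃ s,
        0 ≤ s ∧ L.time + s = t ∧
          reduced K τ σ t ≤ b * ‖p.reducedFlow s * L.prod Mode.reducedStep‖) ∧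
      (∀ L : Word d, L.Admissible K τ → ∀ p ∈ K, ∀ s, 0 ≤ s → ∃ σ : Signal K τ,
        ‖p.reducedFlow s * L.prod Mode.reducedStep‖ ≤ b * reduced K τ σ (L.time + s)) := by
  obtain ⟨b, hb, hbK⟩ := hD.exists_bound hK
  have hb0 : 0 ≤ b := by linarith
  have hin : ∀ σ ∈ K, ‖(slowInclusion d σ.ell).transpose * σ.T‖ ≤ b := fun σ hσ =>
    (Matrix.l2_opNorm_mul _ _).trans ((mul_le_mul (norm_transpose_slowInclusion_le _)
      (hbK σ hσ).1 (norm_nonneg _) zero_le_one).trans (one_mul b).le)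
  have hout : ∀ σ ∈ K, ‖σ.T⁻¹ * slowInclusion d σ.ell‖ ≤ b := fun σ hσ =>
    (Matrix.l2_opNorm_mul _ _).trans ((mul_le_mul (hbK σ hσ).2.1 (norm_slowInclusion_le _)
      (norm_nonneg _) hb0).trans (mul_one b).le)
  refine ⟨b * b, by positivity, fun σ t ht => ?_, fun L hL p hp s hs => ?_⟩
  · obtain ⟨h1, h2, -⟩ := σ.index_spec ht
    refine ⟨σ.word (σ.index t), σ.word_admissible h1, σ.mode (σ.index t), σ.mode_mem _ h1,
      t - σ.time (σ.index t), by linarith, by rw [σ.time_word]; ring, ?_⟩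
    rw [reduced_eq_of_index_eq σ rfl, Matrix.mul_assoc _ (σ.mode 0).T⁻¹]
    exact norm_mul_mul_le (hin _ (σ.mode_mem _ h1)) (hout _ (σ.mode_mem 0 (by simp)))
  · refine ⟨Word.signal hL hp, ?_⟩
    have h1 := norm_le_of_slowProjector_mul_eq
      (hout _ ((Word.signal hL hp).mode_mem L.length le_rfl))
      (hin _ ((Word.signal hL hp).mode_mem 0 (by simp)))
      (((Word.signal hL hp).mode L.length).slowProjector_mul_reducedFlow_mul s _)
      (reducedFlow_mul_prod_mul_slowProjector (Word.signal hL hp) L.length s)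
    have h2 := reduced_eq_of_index_eq (Word.signal hL hp)
      (Word.index_signal hL hp (le_add_of_nonneg_right hs))
    rw [Word.time_signal_length, add_sub_cancel_left] at h2
    rw [← h2, Word.word_signal_length, Word.mode_signal_length] at h1
    exact h1

theorem DHurwitz.exists_transient_comparison (hK : IsCompact K) (hD : DHurwitz K) :
    ∃ b : ℝ, 0 < b ∧ ∀ L : Word d, L.Admissible K 0 → L ≠ [] → ∃ (σ : Signal K 0) (k : ℕ),
      1 ≤ k ∧ (k : ℕ∞) ≤ σ.count ∧ L.time = σ.time k ∧
        ‖L.prod Mode.fastStep‖ ≤ b * transient K σ L.time := by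
  obtain ⟨b, hb, hbK⟩ := hD.exists_bound hK
  refine ⟨b * b, by positivity, fun L hL hne => ?_⟩
  obtain ⟨p, hp⟩ := List.exists_mem_of_ne_nil L hne
  have hpK : p.1 ∈ K := (hL p hp).1
  set σ : Signal K 0 := Word.signal hL hpK
  refine ⟨σ, L.length, List.length_pos_iff.2 hne, le_rfl, (Word.time_signal_length hL hpK).symm, ?_⟩
  have htr : ∀ k, transition (n := fun _ => Fin d) σ.time (fun k => (σ.mode k).fastGen)
      (fun k => (σ.mode (k + 1)).T * (σ.mode k).R * (σ.mode k).T⁻¹) k =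
      (σ.mode k).T * (σ.word k).prod Mode.fastStep * (σ.mode 0).T⁻¹ := by
    intro k
    induction k with
    | zero => rw [transition, Signal.word, Word.prod_nil, mul_one, Mode.T_mul_inv]
    | succ k ih =>
      rw [transition, ih, Signal.word, Word.prod_cons, Mode.fastStep, Mode.exp_smul_fastGen]
      simp only [mul_assoc]
  have hidx : σ.index L.time = L.length := Word.index_signal hL hpK le_rfl
  have htime : σ.time L.length = L.time := Word.time_signal_length hL hpK
  have hword : σ.word L.length = L := Word.word_signal_length hL hpK
  have h1 : transient K σ L.time =
      ‖(σ.mode L.length).T * L.prod Mode.fastStep * (σ.mode 0).T⁻¹‖ := by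
    have h2 : ∀ k, σ.index L.time = k → transient K σ L.time =
        ‖NormedSpace.exp ((L.time - σ.time k) • (σ.mode k).fastGen) *
          ((σ.mode k).T * (σ.word k).prod Mode.fastStep * (σ.mode 0).T⁻¹)‖ := by
      rintro k rfl
      rw [← htr]
      rfl
    rw [h2 _ hidx, htime, hword, sub_self, zero_smul, NormedSpace.exp_zero, one_mul]
  have h3 : L.prod Mode.fastStep = (σ.mode L.length).T⁻¹ *
      ((σ.mode L.length).T * L.prod Mode.fastStep * (σ.mode 0).T⁻¹) * (σ.mode 0).T := by
    simp only [mul_assoc, Mode.T_inv_mul, mul_one]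
    rw [← mul_assoc, Mode.T_inv_mul, one_mul]
  rw [h1]
  conv_lhs => rw [h3]
  exact norm_mul_mul_le (hbK _ (σ.mode_mem _ le_rfl)).2.1 (hbK _ (σ.mode_mem 0 (by simp))).1

theorem DHurwitz.exists_corrected_comparison (hK : IsCompact K) (hD : DHurwitz K) :
    ∃ b : ℝ, 0 < b ∧ ∀ p ∈ K, ∀ s, 0 ≤ s → ∃ σF : Signal K 0 × (ℕ → transientSet K),
      ‖p.reducedFlow s‖ ≤ b * corrected K σF s := by
  obtain ⟨b, hb, hbK⟩ := hD.exists_bound hK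
  have hb0 : 0 ≤ b := by linarith
  refine ⟨b * b, by positivity, fun p hp s hs => ?_⟩
  -- A signal that never switches: the matrices `F` do not intervene, and the flow is that of a
  -- single mode.
  set σ : Signal K 0 := Word.signal Word.Admissible.nil hp
  let F : ℕ → transientSet K := fun _ => ⟨1, [], by simp, by simp⟩
  refine ⟨(σ, F), ?_⟩
  have hidx : σ.index s = 0 := Word.index_signal Word.Admissible.nil hp hs
  have h1 : corrected K (σ, F) s = ‖NormedSpace.exp (s • p.M)‖ := by
    have h2 : ∀ k, σ.index s = k → corrected K (σ, F) s =
        ‖NormedSpace.exp ((s - σ.time k) • (σ.mode k).M) *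
          transition (n := fun k => Slow d (σ.mode k).ell) σ.time (fun k => (σ.mode k).M)
            (fun k => truncate ((σ.mode (k + 1)).T * (F k : Matrix (Fin d) (Fin d) ℝ) *
              (σ.mode k).R * (σ.mode k).T⁻¹) (σ.mode (k + 1)).ell (σ.mode k).ell) k‖ := by
      rintro k rfl
      rfl
    rw [h2 0 hidx, transition, Matrix.mul_one, σ.time_zero, sub_zero]
    have hm : σ.mode 0 = p := Word.mode_signal_length Word.Admissible.nil hp
    rw [hm]
  rw [h1, Mode.reducedFlow, ofBlocks_eq_slowInclusion_mul]
  have h3 : p.T⁻¹ * (slowInclusion d p.ell * NormedSpace.exp (s • p.M) *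
      (slowInclusion d p.ell).transpose) * p.T = (p.T⁻¹ * slowInclusion d p.ell) *
      NormedSpace.exp (s • p.M) * ((slowInclusion d p.ell).transpose * p.T) := by
    simp only [Matrix.mul_assoc]
  rw [h3]
  refine norm_mul_mul_le ?_ ?_
  · exact (Matrix.l2_opNorm_mul _ _).trans ((mul_le_mul (hbK p hp).2.1 (norm_slowInclusion_le _)
      (norm_nonneg _) hb0).trans (mul_one b).le)
  · exact (Matrix.l2_opNorm_mul _ _).trans ((mul_le_mul (norm_transpose_slowInclusion_le _)
      (hbK p hp).1 (norm_nonneg _) zero_le_one).trans (one_mul b).le)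

end Flows

/-! ### Lyapunov exponents and growth bounds -/

section Growth

theorem logRate_le_iff {r t μ : ℝ} (ht : 0 < t) : logRate r t ≤ μ ↔ r ≤ Real.exp (μ * t) := by
  have ht' : (0 : EReal) < t := by exact_mod_cast ht
  rw [logRate, EReal.div_le_iff_le_mul ht' (EReal.coe_ne_top t), ← EReal.coe_mul,
    ← EReal.exp_le_exp_iff, ENNReal.exp_log, EReal.exp_coe,
    ENNReal.ofReal_le_ofReal_iff (Real.exp_pos _).le, mul_comm]

variable {I : Type*} {φ : I → ℝ → ℝ}

theorem exists_bound_of_lyapunovExponent_lt {μ : ℝ} (h : lyapunovExponent φ < μ) :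
    ∃ t₀ > 0, ∀ t, t₀ ≤ t → ∀ i, φ i t ≤ Real.exp (μ * t) := by
  obtain ⟨t₁, ht₁⟩ := eventually_atTop.1 (eventually_lt_of_limsup_lt h)
  refine ⟨max t₁ 1, by positivity, fun t ht i => ?_⟩
  have ht0 : 0 < t := one_pos.trans_le ((le_max_right _ _).trans ht)
  rw [← logRate_le_iff ht0]
  exact (le_iSup (fun i => logRate (φ i t) t) i).trans (ht₁ t ((le_max_left _ _).trans ht)).le

theorem lyapunovExponent_le_of_bound {c μ : ℝ}
    (h : ∀ t, 0 ≤ t → ∀ i, φ i t ≤ c * Real.exp (μ * t)) : lyapunovExponent φ ≤ μ := by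
  refine EReal.le_of_forall_lt_iff_le.1 fun ν hν => ?_
  have hμν : μ < ν := by exact_mod_cast hν
  refine limsup_le_of_le (by isBoundedDefault) ?_
  have h1 : Tendsto (fun t : ℝ => Real.exp ((ν - μ) * t)) atTop atTop :=
    Real.tendsto_exp_atTop.comp (tendsto_id.const_mul_atTop (sub_pos.2 hμν))
  filter_upwards [h1.eventually_ge_atTop c, eventually_gt_atTop 0] with t ht ht0
  refine iSup_le fun i => (logRate_le_iff ht0).2 ((h t ht0.le i).trans ?_)
  calc c * Real.exp (μ * t) ≤ Real.exp ((ν - μ) * t) * Real.exp (μ * t) := by gcongr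
    _ = Real.exp (ν * t) := by rw [← Real.exp_add]; ring_nf

end Growth

end SwitchedSystem

end

noncomputable section

namespace SwitchedSystem

open scoped Matrix.Norms.L2Operator

/-! ### Products along words -/

section Products

variable {ι 𝔸 : Type*} [NormedRing 𝔸] {f g : ι → 𝔸} {B η : ℝ}

theorem norm_map_prod_le_pow (h1 : ‖(1 : 𝔸)‖ ≤ 1) {L : List ι} (hf : ∀ i ∈ L, ‖f i‖ ≤ B) :
    ‖(L.map f).prod‖ ≤ B ^ L.length := by
  simpa using norm_list_prod_le_pow h1 (L.map f) (by simpa using hf)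

theorem norm_map_prod_sub_le (h1 : ‖(1 : 𝔸)‖ ≤ 1) (hB : 1 ≤ B) (hη : 0 ≤ η) {L : List ι}
    (hf : ∀ i ∈ L, ‖f i‖ ≤ B) (hg : ∀ i ∈ L, ‖g i‖ ≤ B) (hfg : ∀ i ∈ L, ‖f i - g i‖ ≤ η) :
    ‖(L.map f).prod - (L.map g).prod‖ ≤ L.length * B ^ L.length * η := by
  induction L with
  | nil => simp
  | cons i L ih =>
    simp only [List.forall_mem_cons] at hf hg hfg
    have h2 := ih hf.2 hg.2 hfg.2
    have h3 := norm_map_prod_le_pow h1 hg.2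
    have hB0 : 0 < B := one_pos.trans_le hB
    have h4 : B ^ L.length ≤ B ^ (L.length + 1) := pow_le_pow_right₀ hB (Nat.le_succ _)
    simp only [List.map_cons, List.prod_cons, List.length_cons]
    calc ‖f i * (L.map f).prod - g i * (L.map g).prod‖
        = ‖f i * ((L.map f).prod - (L.map g).prod) + (f i - g i) * (L.map g).prod‖ := by
          congr 1; noncomm_ring
      _ ≤ ‖f i‖ * ‖(L.map f).prod - (L.map g).prod‖ + ‖f i - g i‖ * ‖(L.map g).prod‖ :=
          (norm_add_le _ _).trans (add_le_add (norm_mul_le _ _) (norm_mul_le _ _))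
      _ ≤ B * (L.length * B ^ L.length * η) + η * B ^ (L.length + 1) := by
          have := h3.trans h4
          gcongr
          exacts [hf.1, hfg.1]
      _ = _ := by push_cast; ring

/-- If all products of `N` letters have norm at most `1`, all products are bounded. -/
theorem norm_map_prod_le_of_forall_length_eq (h1 : ‖(1 : 𝔸)‖ ≤ 1) (hB : 1 ≤ B) {N : ℕ}
    (hN : 0 < N) {p : ι → Prop} (hf : ∀ i, p i → ‖f i‖ ≤ B)
    (hblock : ∀ L : List ι, (∀ i ∈ L, p i) → L.length = N → ‖(L.map f).prod‖ ≤ 1)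
    (L : List ι) (hL : ∀ i ∈ L, p i) : ‖(L.map f).prod‖ ≤ B ^ N := by
  induction h : L.length using Nat.strong_induction_on generalizing L with
  | _ n ih =>
    subst h
    rcases lt_or_ge L.length N with hlt | hge
    · exact (norm_map_prod_le_pow h1 fun i hi => hf i (hL i hi)).trans
        (pow_le_pow_right₀ hB hlt.le)
    · have h2 := ih (L.drop N).length (by rw [List.length_drop]; omega) (L.drop N)
        (fun i hi => hL i (List.mem_of_mem_drop hi)) rfl
      have h3 := hblock (L.take N) (fun i hi => hL i (List.mem_of_mem_take hi))
        (by rw [List.length_take]; omega)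
      rw [← List.take_append_drop N L, List.map_append, List.prod_append]
      refine (norm_mul_le _ _).trans ?_
      calc _ ≤ 1 * B ^ N := mul_le_mul h3 h2 (norm_nonneg _) zero_le_one
        _ = _ := one_mul _

end Products

/-! ### Words normalised by an exponential rate -/

section Scaling

variable {d : ℕ} {K : Set (Mode d)} {τ : ℝ}

theorem Word.prod_exp_smul (ν : ℝ) (g : Mode d → ℝ → Matrix (Fin d) (Fin d) ℝ) (L : Word d) :
    L.prod (fun σ s => Real.exp (-ν * s) • g σ s) = Real.exp (-ν * L.time) • L.prod g := by
  induction L with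
  | nil => simp
  | cons p L ih =>
    rw [prod_cons, prod_cons, ih, time_cons, smul_mul_smul_comm, mul_add, Real.exp_add]

theorem norm_exp_smul_le {n : Type*} [Fintype n] [DecidableEq n] {X : Matrix n n ℝ} {c ν s : ℝ}
    (h : ‖X‖ ≤ c * Real.exp (ν * s)) : ‖Real.exp (-ν * s) • X‖ ≤ c := by
  rw [norm_smul, Real.norm_of_nonneg (Real.exp_pos _).le]
  calc _ ≤ Real.exp (-ν * s) * (c * Real.exp (ν * s)) := by gcongr
    _ = c * Real.exp (-ν * s + ν * s) := by rw [Real.exp_add]; ring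
    _ = c := by simp

theorem le_of_norm_exp_smul_le {n : Type*} [Fintype n] [DecidableEq n] {X : Matrix n n ℝ}
    {c ν s : ℝ} (h : ‖Real.exp (-ν * s) • X‖ ≤ c) : ‖X‖ ≤ c * Real.exp (ν * s) := by
  rw [norm_smul, Real.norm_of_nonneg (Real.exp_pos _).le] at h
  calc ‖X‖ = Real.exp (-ν * s + ν * s) * ‖X‖ := by simp
    _ = (Real.exp (-ν * s) * ‖X‖) * Real.exp (ν * s) := by rw [Real.exp_add]; ring
    _ ≤ _ := by gcongr

/-! ### Uniform growth of the flows of the modes -/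

theorem Mode.reducedFlow_eq (σ : Mode d) (s : ℝ) :
    σ.reducedFlow s = σ.T⁻¹ * (σ.slowProj * NormedSpace.exp (s • σ.slowGen)) * σ.T := by
  rw [reducedFlow, exp_smul_slowGen, slowProj_mul_ofBlocks]

theorem Mode.reducedFlow_add (σ : Mode d) (s t : ℝ) :
    σ.reducedFlow (s + t) = σ.reducedFlow s * σ.reducedFlow t := by
  have h1 : σ.reducedFlow s * σ.reducedFlow t =
      σ.T⁻¹ * (ofBlocks (NormedSpace.exp (s • σ.M)) 0 0 0 *
        ofBlocks (NormedSpace.exp (t • σ.M)) 0 0 0) * σ.T := by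
    rw [reducedFlow, reducedFlow]
    simp only [mul_assoc]
    rw [← mul_assoc σ.T σ.T⁻¹, T_mul_inv, one_mul]
  rw [h1, reducedFlow, ofBlocks_mul, add_smul, Matrix.exp_add_of_commute]
  · simp
  · exact ((Commute.refl σ.M).smul_left s).smul_right t

theorem DHurwitz.continuousOn_reducedFlow (hD : DHurwitz K) :
    ContinuousOn (fun y : Mode d × ℝ => y.1.reducedFlow y.2) (K ×ˢ Set.univ) := by
  let _ : NormedAlgebra ℚ (Matrix (Fin d) (Fin d) ℝ) := NormedAlgebra.restrictScalars ℚ ℝ _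
  have h0 : ∀ {f : Mode d → Matrix (Fin d) (Fin d) ℝ}, ContinuousOn f K →
      ContinuousOn (fun y : Mode d × ℝ => f y.1) (K ×ˢ Set.univ) := fun hf =>
    hf.comp continuousOn_fst fun y hy => hy.1
  refine ContinuousOn.congr ?_ fun y _ => y.1.reducedFlow_eq y.2
  exact ((h0 hD.continuousOn_T_inv).mul ((h0 Mode.continuous_slowProj.continuousOn).mul
    (NormedSpace.exp_continuous.comp_continuousOn
      (continuousOn_snd.smul (h0 hD.continuousOn_slowGen))))).mul (h0 hD.continuousOn_T)

theorem DHurwitz.exists_reducedFlow_bound (hK : IsCompact K) (hD : DHurwitz K) {μ : ℝ}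
    (h : ∀ σ ∈ K, ∃ s, 0 < s ∧ ‖σ.reducedFlow s‖ < Real.exp (μ * s)) :
    ∃ C > 0, ∀ σ ∈ K, ∀ s, 0 ≤ s → ‖σ.reducedFlow s‖ ≤ C * Real.exp (μ * s) := by
  have hc : ContinuousOn (fun y : Mode d × ℝ => Real.exp (-μ * y.2) • y.1.reducedFlow y.2)
      (K ×ˢ Set.univ) :=
    (by fun_prop : Continuous fun y : Mode d × ℝ => Real.exp (-μ * y.2)).continuousOn.smul
      hD.continuousOn_reducedFlow
  obtain ⟨C, hC, α, hα, H⟩ := exists_uniform_exp_decay hK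
    (h := fun σ s => Real.exp (-μ * s) • σ.reducedFlow s)
    (fun σ _ s t _ _ => by
      rw [σ.reducedFlow_add, smul_mul_smul_comm, ← Real.exp_add, ← mul_add])
    (fun s _ => hc.comp (continuousOn_id.prodMk continuousOn_const) fun x hx => ⟨hx, trivial⟩)
    (fun S _ => by
      obtain ⟨B, hB⟩ := (hK.prod
        (isCompact_Icc (a := (0 : ℝ)) (b := S))).exists_bound_of_continuousOn
        (hc.mono (Set.prod_mono_right (Set.subset_univ _)))
      exact ⟨B, fun x hx s h0 h1 => hB (x, s) ⟨hx, h0, h1⟩⟩)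
    (fun σ hσ => by
      obtain ⟨s, hs, hlt⟩ := h σ hσ
      refine ⟨s, hs, ?_⟩
      rw [norm_smul, Real.norm_of_nonneg (Real.exp_pos _).le]
      calc _ < Real.exp (-μ * s) * Real.exp (μ * s) := by gcongr
        _ = 1 := by rw [← Real.exp_add]; simp)
  refine ⟨C, hC, fun σ hσ s hs => le_of_norm_exp_smul_le ((H σ hσ s hs).trans ?_)⟩
  refine (mul_le_mul_of_nonneg_left (Real.exp_le_one_iff.2 ?_) hC.le).trans_eq (mul_one C)
  nlinarith

theorem DHurwitz.exists_reducedFlow_bound_of_eventually (hK : IsCompact K) (hD : DHurwitz K)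
    {C μ ν t₀ : ℝ} (hμν : μ < ν)
    (h : ∀ σ ∈ K, ∀ s, t₀ ≤ s → 0 ≤ s → ‖σ.reducedFlow s‖ ≤ C * Real.exp (μ * s)) :
    ∃ C' > 0, ∀ σ ∈ K, ∀ s, 0 ≤ s → ‖σ.reducedFlow s‖ ≤ C' * Real.exp (ν * s) := by
  have h1 : Tendsto (fun t : ℝ => Real.exp ((ν - μ) * t)) atTop atTop :=
    Real.tendsto_exp_atTop.comp (tendsto_id.const_mul_atTop (sub_pos.2 hμν))
  obtain ⟨s, hs1, hs2, hs3⟩ := ((h1.eventually_gt_atTop C).and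
    ((eventually_gt_atTop 0).and (eventually_ge_atTop t₀))).exists
  refine hD.exists_reducedFlow_bound hK fun σ hσ => ⟨s, hs2, (h σ hσ s hs3 hs2.le).trans_lt ?_⟩
  calc C * Real.exp (μ * s) < Real.exp ((ν - μ) * s) * Real.exp (μ * s) := by gcongr
    _ = _ := by rw [← Real.exp_add]; ring_nf

theorem DHurwitz.exists_reducedFlow_exp_bound (hK : IsCompact K) (hD : DHurwitz K) :
    ∃ C > 0, ∃ μ : ℝ, ∀ σ ∈ K, ∀ s, 0 ≤ s → ‖σ.reducedFlow s‖ ≤ C * Real.exp (μ * s) := by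
  obtain ⟨B, hB⟩ := hK.exists_bound_of_continuousOn (hD.continuousOn_reducedFlow.comp
    (continuousOn_id.prodMk (continuousOn_const (c := (1 : ℝ)))) fun x hx => ⟨hx, trivial⟩)
  -- The bound `B` at time `1` serves as a rate, because `B < exp B`.
  obtain ⟨C, hC, H⟩ := hD.exists_reducedFlow_bound hK (μ := B) fun σ hσ =>
    ⟨1, one_pos, (hB σ hσ).trans_lt (by linarith [Real.add_one_le_exp (B * 1)])⟩
  exact ⟨C, hC, B, H⟩

/-! ### Upper bound with a positive dwell time -/

theorem tendsto_layer_error {c C α ν : ℝ} (hα : 0 < α) (hτ : 0 < τ) :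
    Tendsto (fun ε : ℝ => c * ε + C * Real.exp (-(α / ε + ν) * τ)) (𝓝[>] 0) (𝓝 0) := by
  have h1 : Tendsto (fun ε : ℝ => α / ε + ν) (𝓝[>] 0) atTop :=
    tendsto_atTop_add_const_right _ _ (tendsto_inv_nhdsGT_zero.const_mul_atTop hα)
  have h2 : Tendsto (fun ε : ℝ => Real.exp (-(α / ε + ν) * τ)) (𝓝[>] 0) (𝓝 0) :=
    Real.tendsto_exp_atBot.comp ((tendsto_neg_atTop_atBot.comp h1).atBot_mul_const hτ)
  have h3 : Tendsto (fun ε : ℝ => c * ε) (𝓝[>] 0) (𝓝 (c * 0)) :=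
    (tendsto_nhdsWithin_of_tendsto_nhds tendsto_id).const_mul c
  simpa using h3.add (h2.const_mul C)

/-- The normalised letters of the perturbed system converge to those of the reduced system,
uniformly for durations at least `τ > 0`. -/
theorem DHurwitz.eventually_step_sub_le (hK : IsCompact K) (hD : DHurwitz K) (hτ : 0 < τ)
    {C μ ν : ℝ} (hμν : μ < ν)
    (hM : ∀ σ ∈ K, ∀ s : ℝ, 0 ≤ s → ‖σ.reducedFlow s‖ ≤ C * Real.exp (μ * s)) :
    ∃ B ≥ 1, ∀ η > 0, ∀ᶠ ε in 𝓝[>] (0 : ℝ), ∀ σ ∈ K, ∀ s, 0 ≤ s →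
      ‖NormedSpace.exp (s • σ.perturbedGen ε)‖ ≤ B * Real.exp (ν * s) ∧
      ‖σ.perturbedStep ε s‖ ≤ B * Real.exp (ν * s) ∧
      ‖σ.reducedStep s‖ ≤ B * Real.exp (ν * s) ∧
      (τ ≤ s → ‖NormedSpace.exp (s • σ.perturbedGen ε) - σ.reducedFlow s‖ ≤
        η * Real.exp (ν * s)) ∧
      (τ ≤ s → ‖σ.perturbedStep ε s - σ.reducedStep s‖ ≤ η * Real.exp (ν * s)) := by
  obtain ⟨b, hb, hbK⟩ := hD.exists_bound hK
  obtain ⟨c, hc, ε₀, hε₀, H⟩ := hD.exists_two_time_scale_estimate hK hμν hM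
  obtain ⟨C₂, hC₂, α, hα, hlayer⟩ := hD.exists_layer_decay hK
  have hb0 : 0 < b := by linarith
  refine ⟨max 1 (b * max c C), le_max_left _ _, fun η hη => ?_⟩
  have h1 := (tendsto_layer_error (c := c) (C := C₂) (ν := ν) hα hτ).eventually_lt_const
    (show (0 : ℝ) < η / b by positivity)
  have h2 : ∀ᶠ ε in 𝓝[>] (0 : ℝ), 0 ≤ α / ε + ν :=
    (tendsto_atTop_add_const_right _ _
      (tendsto_inv_nhdsGT_zero.const_mul_atTop hα)).eventually_ge_atTop 0
  filter_upwards [h1, h2, self_mem_nhdsWithin, Ioc_mem_nhdsGT hε₀] with ε h1 h2 hε hεε₀ σ hσ s hs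
  obtain ⟨H1, -, H3⟩ := H σ hσ ε hε hεε₀.2 s hs
  have hR := (hbK σ hσ).2.2.1
  have hR' : ∀ {X : Matrix (Fin d) (Fin d) ℝ} {x : ℝ}, ‖X‖ ≤ x → ‖σ.R * X‖ ≤ b * x :=
    fun hX => (norm_mul_le _ _).trans (mul_le_mul hR hX (norm_nonneg _) hb0.le)
  have hE := Real.exp_pos (ν * s)
  have hdiff : τ ≤ s → ‖NormedSpace.exp (s • σ.perturbedGen ε) - σ.reducedFlow s‖ ≤
      η / b * Real.exp (ν * s) := by
    intro hτs
    -- The dwell time enters here: as `s ≥ τ` and `α / ε + ν ≥ 0`, the normalised layer is largest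
    -- at `s = τ`, where it tends to zero with `ε`.
    have h4 : Real.exp (-α * (s / ε)) ≤ Real.exp (-(α / ε + ν) * τ) * Real.exp (ν * s) := by
      rw [← Real.exp_add, Real.exp_le_exp]
      have h5 : -α * (s / ε) = -(α / ε + ν) * s + ν * s := by ring
      rw [h5]
      have := mul_le_mul_of_nonneg_left hτs h2
      linarith
    calc ‖NormedSpace.exp (s • σ.perturbedGen ε) - σ.reducedFlow s‖
        = ‖(NormedSpace.exp (s • σ.perturbedGen ε) -
            (σ.reducedFlow s + σ.layerFlow (s / ε))) + σ.layerFlow (s / ε)‖ := by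
          congr 1; abel
      _ ≤ c * ε * Real.exp (ν * s) + C₂ * (Real.exp (-(α / ε + ν) * τ) * Real.exp (ν * s)) :=
          (norm_add_le _ _).trans (add_le_add H1 ((hlayer σ hσ _ (div_nonneg hs
            (Set.mem_Ioi.1 hε).le)).trans (mul_le_mul_of_nonneg_left h4 hC₂.le)))
      _ = (c * ε + C₂ * Real.exp (-(α / ε + ν) * τ)) * Real.exp (ν * s) := by ring
      _ ≤ _ := by gcongr
  refine ⟨H3.trans ?_, (hR' H3).trans ?_, (hR' (hM σ hσ s hs)).trans ?_, fun hτs => ?_,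
    fun hτs => ?_⟩
  · gcongr
    refine le_max_of_le_right ?_
    calc c ≤ max c C := le_max_left _ _
      _ ≤ b * max c C := le_mul_of_one_le_left (le_max_of_le_left hc.le) hb
  · rw [← mul_assoc]
    gcongr
    exact le_max_of_le_right (by gcongr; exact le_max_left _ _)
  · rw [← mul_assoc]
    have h6 : Real.exp (μ * s) ≤ Real.exp (ν * s) := by gcongr
    calc b * C * Real.exp (μ * s) ≤ max 1 (b * max c C) * Real.exp (μ * s) := by
          gcongr
          exact le_max_of_le_right (by gcongr; exact le_max_right _ _)
      _ ≤ _ := by gcongr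
  · refine (hdiff hτs).trans ?_
    gcongr
    exact div_le_self hη.le hb
  · rw [Mode.perturbedStep, Mode.reducedStep, ← mul_sub]
    refine (hR' (hdiff hτs)).trans_eq ?_
    field_simp

/-- Normalise letters by `exp (-ν s)`. Since `N` letters last at least `N τ`, the slack `ν - μ`
brings every reduced block of `N` letters below `1 / 2`. With `N` fixed, small `ε` keeps perturbed
blocks within `1 / 2` of the reduced ones, hence of norm at most `1`. -/
theorem DHurwitz.eventually_perturbed_bound (hK : IsCompact K) (hD : DHurwitz K) (hτ : 0 < τ)
    {C t₀ μ ν : ℝ} (hμν : μ < ν)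
    (h : ∀ t, t₀ ≤ t → 0 ≤ t → ∀ σ, reduced K τ σ t ≤ C * Real.exp (μ * t)) :
    ∀ᶠ ε in 𝓝[>] (0 : ℝ), ∃ c > 0, ∀ t, 0 ≤ t → ∀ σ,
      perturbed K τ ε σ t ≤ c * Real.exp (ν * t) := by
  obtain ⟨b, hb, -, hcomp⟩ := hD.exists_reduced_comparison hK τ
  obtain ⟨r, hr, hrK⟩ := hD.exists_bound hK
  have hword : ∀ L : Word d, L.Admissible K τ → ∀ p ∈ K, ∀ s, 0 ≤ s → t₀ ≤ L.time + s →
      ‖p.reducedFlow s * L.prod Mode.reducedStep‖ ≤ b * C * Real.exp (μ * (L.time + s)) := by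
    intro L hL p hp s hs hts
    obtain ⟨σ, hσ⟩ := hcomp L hL p hp s hs
    refine hσ.trans ?_
    rw [mul_assoc]
    exact mul_le_mul_of_nonneg_left (h _ hts (add_nonneg hL.time_nonneg hs) σ) hb.le
  obtain ⟨C₁, hC₁, hM⟩ := hD.exists_reducedFlow_bound_of_eventually hK (C := b * C) (t₀ := t₀)
    (show μ < (μ + ν) / 2 by linarith) (fun σ hσ s hst hs => by
      simpa using hword [] .nil σ hσ s hs (by simpa using hst))
  obtain ⟨B, hB, hstep⟩ := hD.eventually_step_sub_le hK hτ (show (μ + ν) / 2 < ν by linarith) hM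
  have hC : 0 ≤ max C 0 := le_max_right _ _
  have hlim : Tendsto (fun N : ℕ => Real.exp ((ν - μ) * (N * τ))) atTop atTop :=
    Real.tendsto_exp_atTop.comp
      ((tendsto_natCast_atTop_atTop.atTop_mul_const hτ).const_mul_atTop (sub_pos.2 hμν))
  obtain ⟨N, hN1, hN2, hN3⟩ := ((hlim.eventually_ge_atTop (2 * (r * (b * max C 0)))).and
    (((tendsto_natCast_atTop_atTop (R := ℝ)).atTop_mul_const hτ).eventually_ge_atTop t₀ |>.and
      (eventually_gt_atTop 0))).exists
  have hB0 : 0 < B := one_pos.trans_le hB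
  -- The telescoping estimate over `N` letters costs `N * B ^ N`, so this tolerance per letter gives
  -- `1 / 2` per block.
  have hη : 0 < 1 / (2 * (N * B ^ N)) := by positivity
  filter_upwards [hstep _ hη] with ε hε
  let f : Mode d × ℝ → Matrix (Fin d) (Fin d) ℝ := fun p =>
    Real.exp (-ν * p.2) • p.1.perturbedStep ε p.2
  let g : Mode d × ℝ → Matrix (Fin d) (Fin d) ℝ := fun p =>
    Real.exp (-ν * p.2) • p.1.reducedStep p.2
  have hfB : ∀ p : Mode d × ℝ, (p.1 ∈ K ∧ 0 < p.2 ∧ τ ≤ p.2) → ‖f p‖ ≤ B := fun p hp =>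
    norm_exp_smul_le (hε p.1 hp.1 p.2 hp.2.1.le).2.1
  have hgB : ∀ p : Mode d × ℝ, (p.1 ∈ K ∧ 0 < p.2 ∧ τ ≤ p.2) → ‖g p‖ ≤ B := fun p hp =>
    norm_exp_smul_le (hε p.1 hp.1 p.2 hp.2.1.le).2.2.1
  have hfg : ∀ p : Mode d × ℝ, (p.1 ∈ K ∧ 0 < p.2 ∧ τ ≤ p.2) →
      ‖f p - g p‖ ≤ 1 / (2 * (N * B ^ N)) := fun p hp => by
    have := (hε p.1 hp.1 p.2 hp.2.1.le).2.2.2.2 hp.2.2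
    simp only [f, g, ← smul_sub]
    exact norm_exp_smul_le this
  have hblock : ∀ L : Word d, L.Admissible K τ → L.length = N → ‖(L.map f).prod‖ ≤ 1 := by
    intro L hL hLN
    have h1 := norm_map_prod_sub_le norm_one_matrix_le hB hη.le (fun p hp => hfB p (hL p hp))
      (fun p hp => hgB p (hL p hp)) fun p hp => hfg p (hL p hp)
    have h2 : ‖(L.map g).prod‖ ≤ 1 / 2 := by
      have h3 : (L.map g).prod = Real.exp (-ν * L.time) • L.prod Mode.reducedStep :=
        Word.prod_exp_smul ν Mode.reducedStep L
      have hLt := hL.length_mul_le_time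
      rw [hLN] at hLt
      -- The hypothesis bounds flows just before a jump, so the last letter in time is split off and
      -- its jump matrix is estimated by `r`.
      obtain ⟨p, L', rfl⟩ := List.exists_cons_of_ne_nil
        (List.ne_nil_of_length_pos (by omega : 0 < L.length))
      obtain ⟨hp, hL'⟩ := Word.admissible_cons.1 hL
      have h4 := hword L' hL' p.1 hp.1 p.2 hp.2.1.le
        (by rw [Word.time_cons] at hLt; linarith)
      rw [add_comm, ← Word.time_cons] at h4
      have h5 : ‖Word.prod Mode.reducedStep (p :: L')‖ ≤
          r * (b * max C 0 * Real.exp (μ * Word.time (p :: L'))) := by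
        rw [Word.prod_cons, Mode.reducedStep, mul_assoc]
        refine (norm_mul_le _ _).trans (mul_le_mul (hrK p.1 hp.1).2.2.1 (h4.trans ?_)
          (norm_nonneg _) (by linarith))
        gcongr
        exact le_max_left _ _
      rw [h3]
      refine norm_exp_smul_le (h5.trans ?_)
      have h6 : 2 * (r * (b * max C 0)) ≤ Real.exp ((ν - μ) * Word.time (p :: L')) :=
        hN1.trans (Real.exp_le_exp.2 (mul_le_mul_of_nonneg_left hLt (by linarith)))
      have h7 : Real.exp (ν * Word.time (p :: L')) =
          Real.exp ((ν - μ) * Word.time (p :: L')) * Real.exp (μ * Word.time (p :: L')) := by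
        rw [← Real.exp_add]; ring_nf
      rw [h7]
      have := mul_le_mul_of_nonneg_right h6 (Real.exp_pos (μ * Word.time (p :: L'))).le
      linarith
    rw [hLN] at h1
    have h8 : (N : ℝ) * B ^ N * (1 / (2 * (N * B ^ N))) = 1 / 2 := by field_simp
    calc ‖(L.map f).prod‖ = ‖((L.map f).prod - (L.map g).prod) + (L.map g).prod‖ := by
          rw [sub_add_cancel]
      _ ≤ 1 / 2 + 1 / 2 := (norm_add_le _ _).trans (add_le_add (h1.trans_eq h8) h2)
      _ = 1 := by norm_num
  refine ⟨B * B ^ N, by positivity, fun t ht σ => ?_⟩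
  obtain ⟨L, hL, p, hp, s, hs, hLs, hpert⟩ := exists_word_perturbed_eq σ ht
  have h1 := norm_map_prod_le_of_forall_length_eq norm_one_matrix_le hB hN3 hfB hblock L hL
  have h2 : (L.map f).prod = Real.exp (-ν * L.time) • L.prod (Mode.perturbedStep ε) :=
    Word.prod_exp_smul ν (Mode.perturbedStep ε) L
  rw [h2] at h1
  rw [hpert]
  calc _ ≤ (B * Real.exp (ν * s)) * (B ^ N * Real.exp (ν * L.time)) :=
        (norm_mul_le _ _).trans (mul_le_mul (hε p hp s hs).1 (le_of_norm_exp_smul_le h1)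
          (norm_nonneg _) (by positivity))
    _ = B * B ^ N * Real.exp (ν * (L.time + s)) := by rw [mul_add, Real.exp_add]; ring
    _ = _ := by rw [hLs]

end Scaling

end SwitchedSystem

end

noncomputable section

namespace SwitchedSystem

open scoped Matrix.Norms.L2Operator

/-! ### Lower bound with a positive dwell time -/

section LowerBound

variable {d : ℕ} {K : Set (Mode d)} {τ : ℝ}

namespace Word

variable {g : Mode d → ℝ → Matrix (Fin d) (Fin d) ℝ}

theorem prod_flatten_replicate (L : Word d) (m : ℕ) :
    prod g (List.replicate m L).flatten = prod g L ^ m := by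
  induction m with
  | zero => simp
  | succ m ih => rw [List.replicate_succ, List.flatten_cons, prod_append, ih, pow_succ']

theorem time_flatten_replicate (L : Word d) (m : ℕ) :
    time (List.replicate m L).flatten = m * time L := by
  induction m with
  | zero => simp
  | succ m ih => rw [List.replicate_succ, List.flatten_cons, time_append, ih]; push_cast; ring

theorem Admissible.flatten_replicate {L : Word d} (hL : L.Admissible K τ) (m : ℕ) :
    Admissible K τ (List.replicate m L).flatten := by
  intro p hp
  obtain ⟨L', hL', hp⟩ := List.mem_flatten.1 hp
  rw [List.eq_of_mem_replicate hL'] at hp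
  exact hL p hp

theorem Admissible.time_pos {L : Word d} (hL : L.Admissible K τ) (hne : L ≠ []) : 0 < L.time := by
  obtain ⟨p, L', rfl⟩ := List.exists_cons_of_ne_nil hne
  obtain ⟨hp, hL'⟩ := admissible_cons.1 hL
  rw [time_cons]
  exact add_pos_of_pos_of_nonneg hp.2.1 hL'.time_nonneg

theorem tendsto_prod {G : ℝ → Mode d → ℝ → Matrix (Fin d) (Fin d) ℝ} {l : Filter ℝ} {L : Word d}
    (h : ∀ p ∈ L, Tendsto (fun ε => G ε p.1 p.2) l (𝓝 (g p.1 p.2))) :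
    Tendsto (fun ε => L.prod (G ε)) l (𝓝 (L.prod g)) := by
  induction L with
  | nil => exact tendsto_const_nhds
  | cons p L ih =>
    simp only [List.forall_mem_cons] at h
    simp only [prod_cons]
    exact h.1.mul (ih h.2)

end Word

theorem exp_mul_pow (a : ℝ) (m : ℕ) : Real.exp (a * m) = Real.exp a ^ m := by
  rw [mul_comm, Real.exp_nat_mul]

/-- Repeating the word periodically gives admissible signals at arbitrarily large times, so the
powers of its product obey the growth bound. The trace bound then carries no constant depending on
`ε` or `t₀`, and can pass to the limit. -/
theorem abs_trace_prod_perturbedStep_le {ε μ t₀ : ℝ}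
    (h : ∀ t, t₀ ≤ t → ∀ σ, perturbed K τ ε σ t ≤ Real.exp (μ * t)) {L : Word d}
    (hL : L.Admissible K τ) :
    |(L.prod (Mode.perturbedStep ε)).trace| ≤ d * Real.exp (μ * L.time) := by
  rcases eq_or_ne L [] with rfl | hne
  · simp
  obtain ⟨p, hp⟩ := List.exists_mem_of_ne_nil L hne
  have hlim : Tendsto (fun m : ℕ => (m : ℝ) * L.time) atTop atTop :=
    tendsto_natCast_atTop_atTop.atTop_mul_const (hL.time_pos hne)
  obtain ⟨m₀, hm₀⟩ := eventually_atTop.1 (hlim.eventually_ge_atTop t₀)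
  refine (abs_trace_le_of_norm_pow_le (Real.exp_pos _) (m₀ := m₀) fun m hm => ?_).trans_eq
    (by rw [Fintype.card_fin])
  obtain ⟨σ, hσ⟩ := exists_signal_perturbed_eq (hL.flatten_replicate m) (hL p hp).1 le_rfl
  have h1 := h (m * L.time) (hm₀ m hm) σ
  have h2 := hσ ε
  rw [add_zero, Word.time_flatten_replicate, zero_smul, NormedSpace.exp_zero, one_mul,
    Word.prod_flatten_replicate] at h2
  rw [h2] at h1
  refine h1.trans_eq ?_
  rw [← exp_mul_pow]
  ring_nf

theorem abs_trace_exp_perturbedGen_le {ε μ t₀ : ℝ}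
    (h : ∀ t, t₀ ≤ t → ∀ σ, perturbed K τ ε σ t ≤ Real.exp (μ * t)) {p : Mode d} (hp : p ∈ K)
    {s : ℝ} (hs : 0 < s) :
    |(NormedSpace.exp (s • p.perturbedGen ε)).trace| ≤ d * Real.exp (μ * s) := by
  have hlim : Tendsto (fun m : ℕ => (m : ℝ) * s) atTop atTop :=
    tendsto_natCast_atTop_atTop.atTop_mul_const hs
  obtain ⟨m₀, hm₀⟩ := eventually_atTop.1 (hlim.eventually_ge_atTop t₀)
  refine (abs_trace_le_of_norm_pow_le (Real.exp_pos _) (m₀ := m₀) fun m hm => ?_).trans_eq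
    (by rw [Fintype.card_fin])
  obtain ⟨σ, hσ⟩ := exists_signal_perturbed_eq (L := []) (τ := τ) .nil hp
    (mul_nonneg m.cast_nonneg hs.le)
  have h1 := h (m * s) (hm₀ m hm) σ
  have h2 := hσ ε
  rw [Word.time_nil, zero_add, Word.prod_nil, mul_one] at h2
  rw [h2] at h1
  rw [← Matrix.exp_nsmul, ← Nat.cast_smul_eq_nsmul ℝ, smul_smul, ← exp_mul_pow]
  refine h1.trans_eq ?_
  ring_nf

theorem DHurwitz.tendsto_perturbed (hK : IsCompact K) (hD : DHurwitz K) {σ : Mode d} (hσ : σ ∈ K)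
    {s : ℝ} (hs : 0 < s) :
    Tendsto (fun ε => NormedSpace.exp (s • σ.perturbedGen ε)) (𝓝[>] 0) (𝓝 (σ.reducedFlow s)) ∧
      Tendsto (fun ε => σ.perturbedStep ε s) (𝓝[>] 0) (𝓝 (σ.reducedStep s)) := by
  obtain ⟨C, -, μ, hM⟩ := hD.exists_reducedFlow_exp_bound hK
  -- For one fixed letter, its own duration `s` plays the role of the dwell time.
  obtain ⟨B, -, H⟩ := hD.eventually_step_sub_le hK hs (lt_add_one μ) hM
  have h1 : Tendsto (fun ε => NormedSpace.exp (s • σ.perturbedGen ε)) (𝓝[>] 0)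
      (𝓝 (σ.reducedFlow s)) := by
    rw [Metric.tendsto_nhds]
    intro η hη
    filter_upwards [H (η / 2 / Real.exp ((μ + 1) * s)) (by positivity)] with ε hε
    rw [dist_eq_norm]
    have h2 := (hε σ hσ s hs.le).2.2.2.1 le_rfl
    rw [div_mul_cancel₀ _ (Real.exp_pos _).ne'] at h2
    linarith
  exact ⟨h1, h1.const_mul σ.R⟩

theorem abs_trace_le_of_frequently {l : Filter ℝ} {n : Type*} [Fintype n] [DecidableEq n]
    {f : ℝ → Matrix n n ℝ} {A : Matrix n n ℝ} {c : ℝ} (hf : Tendsto f l (𝓝 A))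
    (h : ∃ᶠ ε in l, |(f ε).trace| ≤ c) : |A.trace| ≤ c := by
  have hcont : Continuous fun X : Matrix n n ℝ => |X.trace| := (continuous_id.matrix_trace).abs
  exact isClosed_Iic.mem_of_frequently_of_tendsto h ((hcont.tendsto A).comp hf)

/-- Trace bounds pass to the reduced products along any sequence of `ε`. The bounded-trace theorem
is used twice: for the powers of a single reduced flow, so that normalised letters are bounded over
all durations, and then for words in these letters. -/
theorem DHurwitz.reduced_bound_of_frequently (hK : IsCompact K) (hD : DHurwitz K) (hτ : 0 < τ)
    {μ ν : ℝ} (hμν : μ < ν)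
    (h : ∃ᶠ ε in 𝓝[>] (0 : ℝ), ∃ t₀, ∀ t, t₀ ≤ t → ∀ σ,
      perturbed K τ ε σ t ≤ Real.exp (μ * t)) :
    ∃ c, ∀ t, 0 ≤ t → ∀ σ, reduced K τ σ t ≤ c * Real.exp (ν * t) := by
  have htrW : ∀ L : Word d, L.Admissible K τ →
      |(L.prod Mode.reducedStep).trace| ≤ d * Real.exp (μ * L.time) := fun L hL =>
    abs_trace_le_of_frequently (Word.tendsto_prod fun p hp =>
      (hD.tendsto_perturbed hK (hL p hp).1 (hL p hp).2.1).2)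
      (h.mono fun ε ⟨t₀, ht₀⟩ => abs_trace_prod_perturbedStep_le ht₀ hL)
  have htrM : ∀ σ ∈ K, ∀ s, 0 < s → |(σ.reducedFlow s).trace| ≤ d * Real.exp (μ * s) :=
    fun σ hσ s hs => abs_trace_le_of_frequently (hD.tendsto_perturbed hK hσ hs).1
      (h.mono fun ε ⟨t₀, ht₀⟩ => abs_trace_exp_perturbedGen_le ht₀ hσ hs)
  set ν₁ := (μ + ν) / 2
  obtain ⟨C, hC, hM⟩ : ∃ C > 0, ∀ σ ∈ K, ∀ s, 0 ≤ s →
      ‖σ.reducedFlow s‖ ≤ C * Real.exp (ν₁ * s) := by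
    refine hD.exists_reducedFlow_bound hK fun σ hσ => ?_
    -- Exponents start at one because the reduced flow at time `0` is a projector, not the identity.
    have hpow : ∀ m : ℕ, (Real.exp (-μ) • σ.reducedFlow 1) ^ (m + 1) =
        Real.exp (-μ * (m + 1 : ℕ)) • σ.reducedFlow (m + 1 : ℕ) := by
      intro m
      induction m with
      | zero => simp
      | succ m ih =>
        rw [pow_succ, ih, smul_mul_smul_comm, ← Real.exp_add, ← σ.reducedFlow_add]
        push_cast
        ring_nf
    obtain ⟨k, -, hk⟩ := exists_norm_prod_le_of_trace_bounded
      (S := {Real.exp (-μ) • σ.reducedFlow 1}) (c := d) (fun g hg => by rw [hg]) (by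
        intro W hW
        obtain ⟨m, rfl⟩ := Submonoid.mem_closure_singleton.1 hW
        rcases m with _ | m
        · simp
        · rw [hpow, Matrix.trace_smul, smul_eq_mul, abs_mul, abs_of_pos (Real.exp_pos _)]
          calc _ ≤ Real.exp (-μ * (m + 1 : ℕ)) * (d * Real.exp (μ * (m + 1 : ℕ))) := by
                gcongr
                exact htrM σ hσ _ (by positivity)
            _ = d * Real.exp (-μ * (m + 1 : ℕ) + μ * (m + 1 : ℕ)) := by
                rw [Real.exp_add]; ring
            _ = d := by simp)
      (Real.one_lt_exp_iff.2 (show 0 < (ν - μ) / 4 by linarith))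
    have hlim : Tendsto (fun m : ℕ => Real.exp ((ν - μ) / 4 * (m + 1 : ℕ))) atTop atTop :=
      Real.tendsto_exp_atTop.comp (((tendsto_natCast_atTop_atTop (R := ℝ)).comp
        (tendsto_add_atTop_nat 1)).const_mul_atTop (by linarith))
    obtain ⟨m, hm⟩ := (hlim.eventually_gt_atTop k).exists
    refine ⟨(m + 1 : ℕ), by positivity, ?_⟩
    have h1 := hk (List.replicate (m + 1) (Real.exp (-μ) • σ.reducedFlow 1))
      fun g hg => List.eq_of_mem_replicate hg
    rw [List.prod_replicate, List.length_replicate, hpow, ← exp_mul_pow] at h1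
    refine (le_of_norm_exp_smul_le h1).trans_lt ?_
    calc _ < Real.exp ((ν - μ) / 4 * (m + 1 : ℕ)) * Real.exp ((ν - μ) / 4 * (m + 1 : ℕ)) *
          Real.exp (μ * (m + 1 : ℕ)) := by gcongr
      _ = Real.exp (ν₁ * (m + 1 : ℕ)) := by
          rw [← Real.exp_add, ← Real.exp_add]; simp only [ν₁]; ring_nf
  obtain ⟨r, hr, hrK⟩ := hD.exists_bound hK
  obtain ⟨b, hb, hcomp, -⟩ := hD.exists_reduced_comparison hK τ
  let f : Mode d × ℝ → Matrix (Fin d) (Fin d) ℝ := fun p =>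
    Real.exp (-ν₁ * p.2) • p.1.reducedStep p.2
  have hf : ∀ L : Word d, (L.map f).prod = Real.exp (-ν₁ * L.time) • L.prod Mode.reducedStep :=
    fun L => Word.prod_exp_smul ν₁ Mode.reducedStep L
  let S : Set (Matrix (Fin d) (Fin d) ℝ) := f '' {p | p.1 ∈ K ∧ 0 < p.2 ∧ τ ≤ p.2}
  have hclosure : ∀ W ∈ Submonoid.closure S, ∃ L : Word d, L.Admissible K τ ∧
      W = (L.map f).prod := by
    intro W hW
    induction hW using Submonoid.closure_induction with
    | mem W hW =>
      obtain ⟨p, hp, rfl⟩ := hW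
      exact ⟨[p], Word.admissible_cons.2 ⟨hp, .nil⟩, by simp⟩
    | one => exact ⟨[], .nil, by simp⟩
    | mul W W' _ _ ih ih' =>
      obtain ⟨L, hL, rfl⟩ := ih
      obtain ⟨L', hL', rfl⟩ := ih'
      exact ⟨L ++ L', Word.admissible_append.2 ⟨hL, hL'⟩, by simp⟩
  obtain ⟨k, hk0, hk⟩ := exists_norm_prod_le_of_trace_bounded (S := S) (c := d) (C := r * C)
    (by
      rintro _ ⟨p, hp, rfl⟩
      refine norm_exp_smul_le ((norm_mul_le _ _).trans ?_)
      rw [mul_assoc]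
      exact mul_le_mul (hrK p.1 hp.1).2.2.1 (hM p.1 hp.1 p.2 hp.2.1.le) (norm_nonneg _)
        (by linarith))
    (by
      intro W hW
      obtain ⟨L, hL, rfl⟩ := hclosure W hW
      rw [hf, Matrix.trace_smul, smul_eq_mul, abs_mul, abs_of_pos (Real.exp_pos _)]
      calc _ ≤ Real.exp (-ν₁ * L.time) * (d * Real.exp (μ * L.time)) := by
            gcongr
            exact htrW L hL
        _ = d * Real.exp (-((ν - μ) / 2 * L.time)) := by
            rw [mul_left_comm, ← Real.exp_add]; simp only [ν₁]; ring_nf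
        _ ≤ d * 1 := by
            gcongr
            rw [Real.exp_le_one_iff, neg_nonpos]
            exact mul_nonneg (by linarith) hL.time_nonneg
        _ = d := mul_one _)
    -- The permitted growth per letter becomes growth at rate `(ν - μ) / 2` per unit time, since a
    -- letter lasts at least `τ`.
    (Real.one_lt_exp_iff.2 (show 0 < (ν - μ) / 2 * τ from mul_pos (by linarith) hτ))
  refine ⟨b * (C * k), fun t ht σ => ?_⟩
  obtain ⟨L, hL, p, hp, s, hs, hLs, hred⟩ := hcomp σ t ht
  have h1 := hk (L.map f) (by
    intro g hg
    obtain ⟨q, hq, rfl⟩ := List.mem_map.1 hg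
    exact ⟨q, hL q hq, rfl⟩)
  rw [hf, List.length_map, ← exp_mul_pow] at h1
  have h2 : k * Real.exp ((ν - μ) / 2 * τ * L.length) ≤
      k * Real.exp ((ν - μ) / 2 * L.time) := by
    refine mul_le_mul_of_nonneg_left (Real.exp_le_exp.2 ?_) hk0.le
    rw [mul_assoc]
    exact mul_le_mul_of_nonneg_left (by linarith [hL.length_mul_le_time]) (by linarith)
  have h3 := le_of_norm_exp_smul_le (h1.trans h2)
  have h4 : Real.exp (ν₁ * s) ≤ Real.exp (ν * s) := by
    rw [Real.exp_le_exp]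
    exact mul_le_mul_of_nonneg_right (by simp only [ν₁]; linarith) hs
  refine hred.trans ?_
  rw [mul_assoc b]
  refine mul_le_mul_of_nonneg_left ?_ hb.le
  calc _ ≤ (C * Real.exp (ν * s)) *
          (k * Real.exp ((ν - μ) / 2 * L.time) * Real.exp (ν₁ * L.time)) :=
        (norm_mul_le _ _).trans (mul_le_mul ((hM p hp s hs).trans (by gcongr)) h3
          (norm_nonneg _) (by positivity))
    _ = C * k * (Real.exp (ν * s) *
          Real.exp ((ν - μ) / 2 * L.time + ν₁ * L.time)) := by rw [Real.exp_add]; ring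
    _ = C * k * Real.exp (ν * (L.time + s)) := by
        rw [← Real.exp_add]; simp only [ν₁]; ring_nf
    _ = _ := by rw [hLs]

end LowerBound

end SwitchedSystem

end

noncomputable section

namespace SwitchedSystem

open scoped Matrix.Norms.L2Operator

/-! ### Upper bound without dwell time -/

section NoDwell

variable {d : ℕ} {K : Set (Mode d)}

theorem Mode.fastStep_eq_exp (σ : Mode d) (s : ℝ) :
    σ.fastStep s = σ.R * σ.T⁻¹ * NormedSpace.exp (s • σ.fastGen) * σ.T := by
  rw [fastStep, exp_smul_fastGen]

theorem Mode.fastStep_eq_fastStep_add_mul (σ : Mode d) (s r : ℝ) :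
    σ.fastStep s =
      σ.fastStep (s + r) * (σ.T⁻¹ * NormedSpace.exp ((-r) • σ.fastGen) * σ.T) := by
  have h1 : NormedSpace.exp (s • σ.fastGen) =
      NormedSpace.exp ((s + r) • σ.fastGen) * NormedSpace.exp ((-r) • σ.fastGen) := by
    rw [← Matrix.exp_add_of_commute _ _
      (((Commute.refl σ.fastGen).smul_left _).smul_right _), ← add_smul]
    congr 2
    ring
  rw [fastStep_eq_exp, fastStep_eq_exp, h1]
  simp only [mul_assoc]
  rw [← mul_assoc σ.T σ.T⁻¹, T_mul_inv, one_mul]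

theorem Mode.fastStep_eq_add (σ : Mode d) (s : ℝ) :
    σ.fastStep s = σ.R * σ.T⁻¹ * σ.slowProj * σ.T + σ.R * σ.layerFlow s := by
  have h1 : (ofBlocks 1 0 0 (NormedSpace.exp (s • σ.D)) : Matrix (Fin d) (Fin d) ℝ) =
      σ.slowProj + ofBlocks 0 0 0 (NormedSpace.exp (s • σ.D)) := by
    rw [slowProj, ofBlocks_add]; simp
  rw [fastStep, h1, layerFlow]
  noncomm_ring

/-- If `Σ̂` decays along switching times, the products of the matrices `fastStep` decay
exponentially with the duration. -/
theorem DHurwitz.exists_fastStep_prod_bound (hK : IsCompact K) (hD : DHurwitz K)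
    (h : switchingExponent K < 0) :
    ∃ c > 0, ∃ β > 0, ∀ L : Word d, L.Admissible K 0 →
      ‖L.prod Mode.fastStep‖ ≤ c * Real.exp (-β * L.time) := by
  obtain ⟨b, hb, hcomp⟩ := hD.exists_transient_comparison hK
  obtain ⟨x, hx1, hx2⟩ := EReal.lt_iff_exists_real_btwn.1 h
  have hx0 : x < 0 := by exact_mod_cast hx2
  obtain ⟨s₁, hs₁⟩ := eventually_atTop.1 (eventually_lt_of_limsup_lt hx1)
  set s₀ := max s₁ 1
  have hs₀ : 0 < s₀ := by positivity
  have hlong : ∀ L : Word d, L.Admissible K 0 → L ≠ [] → s₀ ≤ L.time →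
      ‖L.prod Mode.fastStep‖ ≤ b * Real.exp (x * L.time) := by
    intro L hL hne hs
    obtain ⟨σ, k, hk1, hk2, hk3, hle⟩ := hcomp L hL hne
    refine hle.trans (mul_le_mul_of_nonneg_left ((logRate_le_iff (hs₀.trans_le hs)).1 ?_) hb.le)
    refine le_trans ?_ (hs₁ L.time ((le_max_left _ _).trans hs)).le
    exact le_iSup_of_le σ (le_iSup_of_le k (le_iSup_of_le ⟨hk1, hk2, hk3⟩ le_rfl))
  obtain ⟨r, hr, hrK⟩ := hD.exists_bound hK
  let _ : NormedAlgebra ℚ (Matrix (Fin d) (Fin d) ℝ) := NormedAlgebra.restrictScalars ℚ ℝ _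
  obtain ⟨B, hB⟩ := hK.exists_bound_of_continuousOn
    (f := fun σ : Mode d => NormedSpace.exp ((-s₀) • σ.fastGen))
    (NormedSpace.exp_continuous.comp (continuous_fastGen.const_smul (-s₀))).continuousOn
  refine ⟨max 1 (b * (r * r * max B 0)), by positivity, -x, by linarith, fun L hL => ?_⟩
  rcases L.eq_nil_or_concat with rfl | ⟨L, p, rfl⟩
  · simpa using Or.inl (norm_one_matrix_le (n := Fin d))
  obtain ⟨hL', hp⟩ := Word.admissible_append.1 (List.concat_eq_append ▸ hL)
  have hp := hp p (by simp)
  rw [List.concat_eq_append, neg_neg]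
  -- The hypothesis controls only durations beyond `s₀`. The earliest letter, last in the list, is
  -- lengthened by `s₀`; the right factor that undoes this is bounded uniformly on `K`.
  have hadm : Word.Admissible K 0 (L ++ [(p.1, p.2 + s₀)]) :=
    Word.admissible_append.2 ⟨hL', Word.admissible_cons.2
      ⟨⟨hp.1, by linarith [hp.2.1], by linarith [hp.2.1]⟩, .nil⟩⟩
  have htime : Word.time (L ++ [(p.1, p.2 + s₀)]) = Word.time (L ++ [p]) + s₀ := by
    simp only [Word.time_append, Word.time_cons, Word.time_nil]; ring
  have htime0 : 0 ≤ Word.time (L ++ [p]) :=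
    (Word.admissible_append.2 ⟨hL', Word.admissible_cons.2 ⟨hp, .nil⟩⟩ :
      Word.Admissible K 0 (L ++ [p])).time_nonneg
  have h1 := hlong _ hadm (by simp) (by rw [htime]; linarith)
  have h2 : Word.prod Mode.fastStep (L ++ [p]) =
      Word.prod Mode.fastStep (L ++ [(p.1, p.2 + s₀)]) *
        (p.1.T⁻¹ * NormedSpace.exp ((-s₀) • p.1.fastGen) * p.1.T) := by
    simp only [Word.prod_append, Word.prod_cons, Word.prod_nil, mul_one]
    rw [p.1.fastStep_eq_fastStep_add_mul p.2 s₀, ← mul_assoc]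
  have h3 : ‖p.1.T⁻¹ * NormedSpace.exp ((-s₀) • p.1.fastGen) * p.1.T‖ ≤ r * r * max B 0 :=
    (norm_mul_mul_le (hrK p.1 hp.1).2.1 (hrK p.1 hp.1).1).trans
      (mul_le_mul_of_nonneg_left ((hB p.1 hp.1).trans (le_max_left _ _)) (by positivity))
  have h4 : Real.exp (x * Word.time (L ++ [(p.1, p.2 + s₀)])) ≤
      Real.exp (x * Word.time (L ++ [p])) := by
    rw [htime, Real.exp_le_exp]
    nlinarith
  rw [h2]
  calc _ ≤ (b * Real.exp (x * Word.time (L ++ [p]))) * (r * r * max B 0) :=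
        (norm_mul_le _ _).trans (mul_le_mul (h1.trans (by gcongr)) h3 (norm_nonneg _)
          (by positivity))
    _ = b * (r * r * max B 0) * Real.exp (x * Word.time (L ++ [p])) := by ring
    _ ≤ _ := by gcongr; exact le_max_right _ _

/-- If `Σ̂` decays along switching times, jumps annihilate the slow subspaces. -/
theorem DHurwitz.jump_mul_slowProj_eq_zero (hK : IsCompact K) (hD : DHurwitz K) {c β : ℝ}
    (hβ : 0 < β) (h : ∀ L : Word d, L.Admissible K 0 →
      ‖L.prod Mode.fastStep‖ ≤ c * Real.exp (-β * L.time)) {σ : Mode d} (hσ : σ ∈ K) :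
    σ.R * σ.T⁻¹ * σ.slowProj * σ.T = 0 := by
  obtain ⟨C, hC, α, hα, hlayer⟩ := hD.exists_layer_decay hK
  have hlim : ∀ {a c : ℝ}, 0 < a →
      Tendsto (fun s : ℝ => c * Real.exp (-a * s)) atTop (𝓝 0) := by
    intro a c ha
    have h1 : Tendsto (fun s : ℝ => Real.exp (-a * s)) atTop (𝓝 0) :=
      Real.tendsto_exp_atBot.comp (tendsto_id.const_mul_atTop_of_neg (neg_neg_of_pos ha))
    simpa using h1.const_mul c
  -- A one-letter word of duration `s` is this constant matrix plus a layer. Both the word and the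
  -- layer decay as `s → ∞`, so the constant is zero.
  have h1 : ∀ᶠ s in atTop, ‖σ.R * σ.T⁻¹ * σ.slowProj * σ.T‖ ≤
      c * Real.exp (-β * s) + ‖σ.R‖ * C * Real.exp (-α * s) := by
    filter_upwards [eventually_gt_atTop 0] with s hs
    have h2 := h [(σ, s)] (Word.admissible_cons.2 ⟨⟨hσ, hs, hs.le⟩, .nil⟩)
    simp only [Word.prod_cons, Word.prod_nil, mul_one, Word.time_cons, Word.time_nil,
      add_zero] at h2
    rw [eq_sub_of_add_eq (σ.fastStep_eq_add s).symm]
    refine (norm_sub_le _ _).trans (add_le_add h2 ((norm_mul_le _ _).trans ?_))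
    rw [mul_assoc]
    exact mul_le_mul_of_nonneg_left (hlayer σ hσ s hs.le) (norm_nonneg _)
  have h3 := ge_of_tendsto ((hlim hβ).add (hlim (c := ‖σ.R‖ * C) hα)) h1
  rw [add_zero] at h3
  exact norm_le_zero_iff.1 h3

/-- With `γ = β / ε + ν` the claim is `exp (-γ s) + k m ≤ 1`. For `γ s ≤ 1` the loss `γ s / 2` of
the exponential covers `k s`; for `γ s ≥ 1` both terms are at most `1 / 2`. Hence the need for both
the `O(s)` and the `O(ε)` error, and the constant exactly one lets arbitrarily many switchings be
iterated. -/
theorem exp_neg_mul_add_le {β ε s k ν : ℝ} (hs : 0 ≤ s) (hk : 0 ≤ k)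
    (hε : k * ε ≤ 1 / 2) (hγ : 2 * k ≤ β / ε + ν) (hγ0 : 0 < β / ε + ν) {m : ℝ} (hm1 : m ≤ ε)
    (hm2 : m ≤ s) :
    Real.exp (-β * (s / ε)) + k * m * Real.exp (ν * s) ≤ Real.exp (ν * s) := by
  set γ := β / ε + ν
  have h1 : Real.exp (-β * (s / ε)) = Real.exp (-(γ * s)) * Real.exp (ν * s) := by
    rw [← Real.exp_add]; simp only [γ]; ring_nf
  rw [h1, ← add_mul]
  refine mul_le_of_le_one_left (Real.exp_pos _).le ?_
  have hx : 0 ≤ γ * s := by positivity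
  have h2 : Real.exp (-(γ * s)) ≤ (1 + γ * s)⁻¹ := by
    rw [Real.exp_neg]
    exact inv_anti₀ (by linarith) (by linarith [Real.add_one_le_exp (γ * s)])
  rcases le_total (γ * s) 1 with h | h
  · have h3 : (1 + γ * s)⁻¹ ≤ 1 - γ * s / 2 := by
      rw [inv_le_iff_one_le_mul₀ (by linarith)]
      nlinarith
    have h4 : k * m ≤ k * s := mul_le_mul_of_nonneg_left hm2 hk
    have h5 := mul_le_mul_of_nonneg_right hγ hs
    linarith
  · have h3 : (1 + γ * s)⁻¹ ≤ 2⁻¹ := inv_anti₀ two_pos (by linarith)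
    have h4 : k * m ≤ k * ε := mul_le_mul_of_nonneg_left hm1 hk
    linarith

/-- Perturbed letters are traded for fast ones under a prefix of fast steps. The exchange multiplies
the bound by at most `exp (ν s)`, so no dwell time is needed. -/
theorem DHurwitz.eventually_perturbed_bound_of_switchingExponent_neg (hK : IsCompact K)
    (hD : DHurwitz K) (hsw : switchingExponent K < 0) {C t₀ μ ν : ℝ} (hμν : μ < ν)
    (h : ∀ t, t₀ ≤ t → 0 ≤ t → ∀ σF, corrected K σF t ≤ C * Real.exp (μ * t)) :
    ∀ᶠ ε in 𝓝[>] (0 : ℝ), ∃ c > 0, ∀ t, 0 ≤ t → ∀ σ,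
      perturbed K 0 ε σ t ≤ c * Real.exp (ν * t) := by
  obtain ⟨b, hb, hcomp⟩ := hD.exists_corrected_comparison hK
  obtain ⟨C₁, hC₁, hM⟩ := hD.exists_reducedFlow_bound_of_eventually hK (C := b * C) (t₀ := t₀)
    (show μ < (μ + ν) / 2 by linarith) (fun σ hσ s hst hs => by
      obtain ⟨σF, hσF⟩ := hcomp σ hσ s hs
      refine hσF.trans ?_
      rw [mul_assoc]
      exact mul_le_mul_of_nonneg_left (h s hst hs σF) hb.le)
  obtain ⟨c, hc, ε₀, hε₀, hest⟩ := hD.exists_two_time_scale_estimate hK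
    (show (μ + ν) / 2 < ν by linarith) hM
  obtain ⟨c', hc', β, hβ, hfast⟩ := hD.exists_fastStep_prod_bound hK hsw
  obtain ⟨r, hr, hrK⟩ := hD.exists_bound hK
  have hγ : Tendsto (fun ε : ℝ => β / ε + ν) (𝓝[>] 0) atTop :=
    tendsto_atTop_add_const_right _ _ (tendsto_inv_nhdsGT_zero.const_mul_atTop hβ)
  set k := c' * (r * c)
  have hk : 0 < k := by positivity
  filter_upwards [Ioc_mem_nhdsGT hε₀, Ioc_mem_nhdsGT (show 0 < 1 / (2 * k) by positivity),
    hγ.eventually_ge_atTop (2 * k)] with ε hε hε' hε''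
  have hkε : k * ε ≤ 1 / 2 := by
    have := mul_le_mul_of_nonneg_left hε'.2 hk.le
    field_simp at this ⊢
    linarith
  have herr : ∀ σ ∈ K, ∀ s, 0 ≤ s →
      ‖σ.perturbedStep ε s - σ.fastStep (s / ε)‖ ≤ r * c * min ε s * Real.exp (ν * s) := by
    intro σ hσ s hs
    have h1 := hD.jump_mul_slowProj_eq_zero hK hβ hfast hσ
    -- The reduced flow takes values in the slow subspace, which the jump annihilates; only the
    -- layer remains, and it accounts for the whole fast step.
    have h2 : σ.R * σ.reducedFlow s = 0 := by
      have : σ.R * σ.reducedFlow s = σ.R * σ.T⁻¹ * σ.slowProj * σ.T *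
          (σ.T⁻¹ * NormedSpace.exp (s • σ.slowGen) * σ.T) := by
        rw [σ.reducedFlow_eq]
        simp only [mul_assoc]
        rw [← mul_assoc σ.T σ.T⁻¹, Mode.T_mul_inv, one_mul]
      rw [this, h1, zero_mul]
    have h3 : σ.perturbedStep ε s - σ.fastStep (s / ε) = σ.R *
        (NormedSpace.exp (s • σ.perturbedGen ε) -
          (σ.reducedFlow s + σ.layerFlow (s / ε))) := by
      rw [Mode.perturbedStep, σ.fastStep_eq_add, h1, zero_add, mul_sub, mul_add, h2, zero_add]
    obtain ⟨h4, h5, -⟩ := hest σ hσ ε hε.1 hε.2 s hs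
    rw [h3]
    refine (norm_mul_le _ _).trans ((mul_le_mul (hrK σ hσ).2.2.1
      (show _ ≤ c * min ε s * Real.exp (ν * s) from ?_) (norm_nonneg _)
      (by linarith)).trans_eq (by ring))
    rcases min_choice ε s with hm | hm <;> rw [hm]
    exacts [h4, h5]
  -- Carrying an arbitrary fast prefix `L` lets the main term be absorbed into a longer prefix, so
  -- its constant `c'` is not multiplied at each step. The error term uses the induction hypothesis
  -- with empty prefix, whence `k = c' * (r * c)`.
  have key : ∀ W : Word d, W.Admissible K 0 → ∀ L : Word d, L.Admissible K 0 →
      ‖L.prod Mode.fastStep * W.prod (Mode.perturbedStep ε)‖ ≤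
        c' * Real.exp (-β * L.time) * Real.exp (ν * W.time) := by
    intro W
    induction W with
    | nil => exact fun _ L hL => by simpa using hfast L hL
    | cons p W ih =>
      intro hpW L hL
      obtain ⟨hp, hW⟩ := Word.admissible_cons.1 hpW
      have hs : 0 < p.2 := hp.2.1
      have hsε : 0 < p.2 / ε := div_pos hs hε.1
      have h1 := ih hW (L ++ [(p.1, p.2 / ε)])
        (Word.admissible_append.2 ⟨hL, Word.admissible_cons.2 ⟨⟨hp.1, hsε, hsε.le⟩, .nil⟩⟩)
      have h2 := ih hW [] .nil
      simp only [Word.prod_append, Word.prod_cons, Word.prod_nil, mul_one, Word.time_append,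
        Word.time_cons, Word.time_nil, add_zero, one_mul, mul_zero, Real.exp_zero] at h1 h2
      rw [mul_add, Real.exp_add] at h1
      rw [Word.prod_cons, Word.time_cons]
      have h3 := herr p.1 hp.1 p.2 hs.le
      have h4 := exp_neg_mul_add_le hs.le hk.le hkε hε'' (by linarith) (min_le_left ε p.2)
        (min_le_right ε p.2)
      calc _ = ‖L.prod Mode.fastStep * p.1.fastStep (p.2 / ε) * Word.prod (Mode.perturbedStep ε) W +
            L.prod Mode.fastStep * (p.1.perturbedStep ε p.2 - p.1.fastStep (p.2 / ε)) *
              Word.prod (Mode.perturbedStep ε) W‖ := by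
            congr 1; noncomm_ring
        _ ≤ c' * (Real.exp (-β * L.time) * Real.exp (-β * (p.2 / ε))) * Real.exp (ν * Word.time W) +
            c' * Real.exp (-β * L.time) * (c' * Real.exp (ν * Word.time W)) *
              (r * c * min ε p.2 * Real.exp (ν * p.2)) := by
            refine (norm_add_le _ _).trans (add_le_add h1 ((norm_mul_mul_le (hfast L hL)
              h2).trans (mul_le_mul_of_nonneg_left h3 (by positivity))))
        _ = c' * Real.exp (-β * L.time) * Real.exp (ν * Word.time W) *
            (Real.exp (-β * (p.2 / ε)) + k * min ε p.2 * Real.exp (ν * p.2)) := by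
            simp only [k]; ring
        _ ≤ c' * Real.exp (-β * L.time) * Real.exp (ν * Word.time W) * Real.exp (ν * p.2) := by
            gcongr
        _ = _ := by rw [mul_add, Real.exp_add]; ring
  refine ⟨c * c', by positivity, fun t ht σ => ?_⟩
  obtain ⟨L, hL, p, hp, s, hs, hLs, hpert⟩ := exists_word_perturbed_eq σ ht
  have h1 := key L hL [] .nil
  simp only [Word.prod_nil, one_mul, Word.time_nil, mul_zero, Real.exp_zero, mul_one] at h1
  rw [hpert]
  calc _ ≤ (c * Real.exp (ν * s)) * (c' * Real.exp (ν * L.time)) :=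
        (norm_mul_le _ _).trans (mul_le_mul (hest p hp ε hε.1 hε.2 s hs).2.2 h1
          (norm_nonneg _) (by positivity))
    _ = c * c' * Real.exp (ν * (L.time + s)) := by rw [mul_add, Real.exp_add]; ring
    _ = _ := by rw [hLs]

end NoDwell

/-! ### Convergence of the Lyapunov exponents -/

section Limits

variable {d : ℕ} {K : Set (Mode d)} {τ : ℝ}

theorem ExponentiallyStable.of_eventually_bound {I J : Type*} {φ : ℝ → I → ℝ → ℝ}
    {ψ : J → ℝ → ℝ} {l : Filter ℝ}
    (H : ∀ {C μ ν : ℝ}, μ < ν → (∀ t, 0 ≤ t → ∀ j, ψ j t ≤ C * Real.exp (μ * t)) →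
      ∀ᶠ ε in l, ∃ c > 0, ∀ t, 0 ≤ t → ∀ i, φ ε i t ≤ c * Real.exp (ν * t))
    (h : ExponentiallyStable ψ) : ∀ᶠ ε in l, ExponentiallyStable (φ ε) := by
  obtain ⟨c, -, δ, hδ, h⟩ := h
  filter_upwards [H (show -δ < -(δ / 2) by linarith) h] with ε ⟨c', hc', hε⟩
  exact ⟨c', hc', δ / 2, by positivity, hε⟩

theorem eventually_lyapunovExponent_lt {I J : Type*} {φ : ℝ → I → ℝ → ℝ}
    {ψ : J → ℝ → ℝ} {l : Filter ℝ}
    (H : ∀ {t₀ μ ν : ℝ}, μ < ν → (∀ t, t₀ ≤ t → ∀ j, ψ j t ≤ Real.exp (μ * t)) →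
      ∀ᶠ ε in l, ∃ c > 0, ∀ t, 0 ≤ t → ∀ i, φ ε i t ≤ c * Real.exp (ν * t))
    {a : EReal} (ha : lyapunovExponent ψ < a) : ∀ᶠ ε in l, lyapunovExponent (φ ε) < a := by
  obtain ⟨ν, hν1, hν2⟩ := EReal.lt_iff_exists_real_btwn.1 ha
  obtain ⟨μ, hμ1, hμ2⟩ := EReal.lt_iff_exists_real_btwn.1 hν1
  obtain ⟨t₀, -, ht₀⟩ := exists_bound_of_lyapunovExponent_lt hμ1
  filter_upwards [H (by exact_mod_cast hμ2) ht₀] with ε ⟨c, _, hε⟩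
  exact (lyapunovExponent_le_of_bound hε).trans_lt hν2

/-- The upper half comes from block products, the lower half from traces. If the perturbed exponent
stayed below a level for a sequence of `ε`, the reduced one would not exceed it. Real rates inserted
between the levels also cover infinite exponents. -/
theorem DHurwitz.tendsto_lyapunovExponent (hK : IsCompact K) (hD : DHurwitz K) (hτ : 0 < τ) :
    Tendsto (fun ε : ℝ => lyapunovExponent (perturbed K τ ε)) (𝓝[>] 0)
      (𝓝 (lyapunovExponent (reduced K τ))) := by
  refine tendsto_order.2 ⟨fun a ha => ?_, fun a ha => ?_⟩
  · by_contra hcon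
    obtain ⟨ν, hν1, hν2⟩ := EReal.lt_iff_exists_real_btwn.1 ha
    obtain ⟨μ, hμ1, hμ2⟩ := EReal.lt_iff_exists_real_btwn.1 hν1
    obtain ⟨c, hc⟩ := hD.reduced_bound_of_frequently hK hτ (by exact_mod_cast hμ2)
      ((not_eventually.1 hcon).mono fun ε hε => by
        obtain ⟨t₀, -, ht₀⟩ := exists_bound_of_lyapunovExponent_lt ((not_lt.1 hε).trans_lt hμ1)
        exact ⟨t₀, ht₀⟩)
    exact absurd hν2 (not_lt.2 (lyapunovExponent_le_of_bound hc))
  · exact eventually_lyapunovExponent_lt (fun hμν h => hD.eventually_perturbed_bound hK hτ hμν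
      (C := 1) fun t ht _ σ => by simpa using h t ht σ) ha

end Limits

end SwitchedSystem

end

/-! ### The main theorem -/

theorem mainTheorem2 (d : ℕ) (hd : 2 ≤ d) (K : Set (SwitchedSystem.Mode d)) (hK : IsCompact K)
    (hD : SwitchedSystem.DHurwitz K) :
    (∀ τ : ℝ, 0 < τ →
      (∃ L : EReal,
        Tendsto (fun ε : ℝ => SwitchedSystem.lyapunovExponent (SwitchedSystem.perturbed K τ ε))
          (𝓝[>] 0) (𝓝 L) ∧
        L ≤ SwitchedSystem.lyapunovExponent (SwitchedSystem.reduced K τ)) ∧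
      (SwitchedSystem.ExponentiallyStable (SwitchedSystem.reduced K τ) →
        ∀ᶠ ε : ℝ in 𝓝[>] 0,
          SwitchedSystem.ExponentiallyStable (SwitchedSystem.perturbed K τ ε))) ∧
    (SwitchedSystem.switchingExponent K < 0 →
      limsup (fun ε : ℝ => SwitchedSystem.lyapunovExponent (SwitchedSystem.perturbed K 0 ε))
          (𝓝[>] 0) ≤
        SwitchedSystem.lyapunovExponent (SwitchedSystem.corrected K) ∧
      (SwitchedSystem.ExponentiallyStable (SwitchedSystem.corrected K) →
        ∀ᶠ ε : ℝ in 𝓝[>] 0,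
          SwitchedSystem.ExponentiallyStable (SwitchedSystem.perturbed K 0 ε))) := by
  refine ⟨fun τ hτ => ⟨⟨_, hD.tendsto_lyapunovExponent hK hτ, le_rfl⟩, ?_⟩, fun hsw => ⟨?_, ?_⟩⟩
  · exact SwitchedSystem.ExponentiallyStable.of_eventually_bound fun hμν h =>
      hD.eventually_perturbed_bound hK hτ hμν (t₀ := 0) fun t _ => h t
  · refine le_of_forall_gt_imp_ge_of_dense fun a ha => limsup_le_of_le (by isBoundedDefault) ?_
    refine (SwitchedSystem.eventually_lyapunovExponent_lt (fun hμν h =>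
      hD.eventually_perturbed_bound_of_switchingExponent_neg hK hsw hμν (C := 1)
        fun t ht _ σF => by simpa using h t ht σF) ha).mono fun ε hε => hε.le
  · exact SwitchedSystem.ExponentiallyStable.of_eventually_bound fun hμν h =>
      hD.eventually_perturbed_bound_of_switchingExponent_neg hK hsw hμν (t₀ := 0) fun t _ => h t
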